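/- Let $d\ge 1$, write $|x-y|=\sum_j|x_j-y_j|$ on $\mathbb Z^d$, and consider the random Schrödinger operators $H_\omega=-\Delta+\lambda V_\omega$ on $\ell^2(\mathbb Z^d)$, $\lambda>0$, where $(-\Delta\psi)(x)=\sum_{|y-x|=1}(\psi(x)-\psi(y))$ and the site potentials $V_\omega(x)$, $x\in\mathbb Z^d$, are i.i.d. real random variables whose distribution has a bounded density with compact support. For $\Omega\subset\mathbb Z^d$ let $H_{\Omega;\omega}$ be the restriction (compression) of $H_\omega$ to $\ell^2(\Omega)$, let $G_\Omega(x,y;z)=\langle x|(H_{\Omega;\omega}-z)^{-1}|y\rangle$, let $\partial\Omega$ be the set of sites of $\Omega$ with a nearest neighbour outside $\Omega$, and put $$\operatorname{dist}_\Omega(x,y)=\min\{|x-y|,\ \operatorname{dist}(x,\partial\Omega)+\operatorname{dist}(y,\partial\Omega)\},\qquad \operatorname{dist}(x,\emptyset)=\infty .$$ For finite $\Lambda\subset\mathbb Z^d$ let $\Gamma(\Lambda)$ be the set of nearest-neighbour bonds $\langle u,u'\rangle$ with $u\in\Lambda$, $u'\notin\Lambda$. Then for each $s\in(0,1)$ there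 is $C_s\in(0,\infty)$, not depending on $\lambda$, such that the following holds for all $\lambda>0$ and all finite $\Lambda\ni 0$. For every $b<1$ there are $\mu>0$ and $A<\infty$ such that for every $E\in\mathbb C$ with $$\Big(1+\frac{C_s}{\lambda^s}|\Gamma(\Lambda)|\Big)^2\sum_{\langle u,u'\rangle\in\Gamma(\Lambda)}\mathbb E\big(|\langle 0|(H_{\Lambda;\omega}-E)^{-1}|u\rangle|^s\big)=b$$ (so $A,\mu$ depend on $E$ only through the value $b$ of the left side): 1. if $E$ is real, then $H_\omega$ satisfies the fractional-moment condition near $E$: there are an open interval $(a_1,a_2)\ni E$ and $A'<\infty$, $\mu'>0$ such that $\mathbb E(|\langle x|(H_\omega-E'-i\eta)^{-1}|y\rangle|^s)\le A'e^{-\mu'|x-y|}$ for all $E'\in(a_1,a_2)$, all real $\eta\ne0$ and all $x,y\in\mathbb Z^d$; 2. for every region $\Omega\subset\mathbb Z^d$ and all $x,y\in\Omega$, $$\limsup_{\eta\searrow0}\mathbb E\big(|G_\Omega(x,y;E+i\eta)|^s\big)\le A\,e^{-\mu\operatorname{dist}_\Omega(x,y)}\quad\text{and}\quad \limsup_{\eta\nearrow0}\mathbb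 E\big(|G_\Omega(x,y;E+i\eta)|^s\big)\le A\,e^{-\mu\operatorname{dist}_\Omega(x,y)} .$$ -/

import Mathlib

open MeasureTheory ProbabilityTheory Filter Topology
open scoped ENNReal

noncomputable section

namespace Anderson

/-- The sites of the lattice `ℤ^d`. -/
abbrev Site (d : ℕ) : Type := Fin d → ℤ

/-- The lattice distance `|x - y| = ∑ j, |x j - y j|`. -/
def siteDist {d : ℕ} (x y : Site d) : ℕ := ∑ j, (x j - y j).natAbs

/-- The `2 d` unit steps `± e_j`; the nearest neighbours of `x` are the sites `x + e`,
`e ∈ steps d`. -/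
def steps (d : ℕ) : Finset (Site d) :=
  (Finset.univ.image fun j : Fin d => (Pi.single j 1 : Site d)) ∪
    (Finset.univ.image fun j : Fin d => (Pi.single j (-1) : Site d))

/-- `Γ(Λ)`: the nearest neighbour bonds `(u, u')` with `u ∈ Λ` and `u' ∉ Λ`. -/
def bonds {d : ℕ} (Λ : Finset (Site d)) : Finset (Site d × Site d) :=
  ((Λ ×ˢ steps d).image fun p => (p.1, p.1 + p.2)).filter fun b => b.2 ∉ Λ

/-- `∂R`: the sites of `R` which have a nearest neighbour outside of `R`. -/
def boundary {d : ℕ} (R : Set (Site d)) : Set (Site d) :=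
  {u | u ∈ R ∧ ∃ e ∈ steps d, u + e ∉ R}

/-- The distance from `x` to `∂R`; it is `⊤` if `∂R` is empty (for instance, if `R` is the whole
lattice). -/
def boundaryDist {d : ℕ} (R : Set (Site d)) (x : Site d) : ℕ∞ :=
  ⨅ u ∈ boundary R, (siteDist x u : ℕ∞)

/-- `dist_R(x, y) = min {|x - y|, dist(x, ∂R) + dist(y, ∂R)}`, which is always finite. -/
def regionDist {d : ℕ} (R : Set (Site d)) (x y : Site d) : ℕ :=
  (min (siteDist x y : ℕ∞) (boundaryDist R x + boundaryDist R y)).toNat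

/-- The Hilbert space `ℓ²(R)`. -/
abbrev L2 {d : ℕ} (R : Set (Site d)) : Type := lp (fun _ : R => ℂ) 2

open Classical in
/-- The function `x ↦ f (x + e)` on `R`, where `f` is extended by zero outside of `R`. -/
def hopFun {d : ℕ} (R : Set (Site d)) (e : Site d) (f : R → ℂ) (x : R) : ℂ :=
  if h : (x : Site d) + e ∈ R then f ⟨x + e, h⟩ else 0

lemma sum_hopFun_le {d : ℕ} (R : Set (Site d)) (e : Site d) (f : L2 R) (t : Finset R) :
    ∑ x ∈ t, ‖hopFun R e f x‖ ^ (2 : ℝ≥0∞).toReal ≤ ‖f‖ ^ (2 : ℝ≥0∞).toReal := by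
  classical
  let t' : Finset R := t.filter fun x => (x : Site d) + e ∈ R
  have hfil : ∑ x ∈ t, ‖hopFun R e f x‖ ^ (2 : ℝ≥0∞).toReal
      = ∑ x ∈ t', ‖hopFun R e f x‖ ^ (2 : ℝ≥0∞).toReal := by
    refine (Finset.sum_subset (Finset.filter_subset _ _) ?_).symm
    intro x hx hx'
    have : ¬ (x : Site d) + e ∈ R := fun h => hx' (Finset.mem_filter.2 ⟨hx, h⟩)
    simp [hopFun, this]
  let φ : R → R := fun x => if h : (x : Site d) + e ∈ R then ⟨x + e, h⟩ else x
  have hinj : Set.InjOn φ t' := by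
    intro x hx y hy hxy
    have hx2 := (Finset.mem_filter.1 hx).2
    have hy2 := (Finset.mem_filter.1 hy).2
    simp only [φ, dif_pos hx2, dif_pos hy2, Subtype.mk.injEq, add_left_inj] at hxy
    exact Subtype.ext hxy
  rw [hfil]
  calc ∑ x ∈ t', ‖hopFun R e f x‖ ^ (2 : ℝ≥0∞).toReal
      = ∑ x ∈ t', ‖f (φ x)‖ ^ (2 : ℝ≥0∞).toReal := by
        refine Finset.sum_congr rfl fun x hx => ?_
        have hx2 := (Finset.mem_filter.1 hx).2
        simp [hopFun, φ, dif_pos hx2]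
    _ = ∑ y ∈ t'.image φ, ‖f y‖ ^ (2 : ℝ≥0∞).toReal :=
        (Finset.sum_image (f := fun y => ‖f y‖ ^ (2 : ℝ≥0∞).toReal) hinj).symm
    _ ≤ ‖f‖ ^ (2 : ℝ≥0∞).toReal := lp.sum_rpow_le_norm_rpow (by norm_num) f _

/-- The hopping term `(T_e f)(x) = f (x + e)` on `ℓ²(R)`, with Dirichlet (zero) values outside
of `R`. -/
def hop {d : ℕ} (R : Set (Site d)) (e : Site d) : L2 R →L[ℂ] L2 R :=
  LinearMap.mkContinuous
    { toFun := fun f => ⟨hopFun R e f, memℓp_gen' (sum_hopFun_le R e f)⟩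
      map_add' := by
        intro f g
        ext x
        change hopFun R e (f + g : L2 R) x = hopFun R e f x + hopFun R e g x
        by_cases h : (x : Site d) + e ∈ R <;> simp [hopFun, h]
      map_smul' := by
        intro c f
        ext x
        by_cases h : (x : Site d) + e ∈ R <;> simp [hopFun, h] }
    1
    (by
      intro f
      rw [one_mul]
      exact lp.norm_le_of_forall_sum_le (by norm_num) (norm_nonneg f) (sum_hopFun_le R e f))

lemma sum_mul_le {d : ℕ} {R : Set (Site d)} {v : Site d → ℝ} {M : ℝ}
    (hM : ∀ x ∈ R, |v x| ≤ M) (f : L2 R) (t : Finset R) :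
    ∑ x ∈ t, ‖(v x : ℂ) * f x‖ ^ (2 : ℝ≥0∞).toReal ≤ (|M| * ‖f‖) ^ (2 : ℝ≥0∞).toReal := by
  have h2 : (0 : ℝ) ≤ (2 : ℝ≥0∞).toReal := by norm_num
  calc ∑ x ∈ t, ‖(v x : ℂ) * f x‖ ^ (2 : ℝ≥0∞).toReal
      ≤ ∑ x ∈ t, |M| ^ (2 : ℝ≥0∞).toReal * ‖f x‖ ^ (2 : ℝ≥0∞).toReal := by
        refine Finset.sum_le_sum fun x _ => ?_
        rw [← Real.mul_rpow (abs_nonneg _) (norm_nonneg _), norm_mul]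
        refine Real.rpow_le_rpow (by positivity) ?_ h2
        have hx : ‖(v x : ℂ)‖ ≤ |M| := by
          rw [Complex.norm_real, Real.norm_eq_abs]
          exact (hM x x.2).trans (le_abs_self M)
        gcongr
    _ = |M| ^ (2 : ℝ≥0∞).toReal * ∑ x ∈ t, ‖f x‖ ^ (2 : ℝ≥0∞).toReal := by
        rw [Finset.mul_sum]
    _ ≤ |M| ^ (2 : ℝ≥0∞).toReal * ‖f‖ ^ (2 : ℝ≥0∞).toReal := by
        have := lp.sum_rpow_le_norm_rpow (p := 2) (by norm_num) f t
        gcongr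
    _ = (|M| * ‖f‖) ^ (2 : ℝ≥0∞).toReal :=
        (Real.mul_rpow (abs_nonneg _) (norm_nonneg _)).symm

/-- Multiplication by a function `v` which is bounded on `R`, as an operator on `ℓ²(R)`. -/
def mulBdd {d : ℕ} (R : Set (Site d)) (v : Site d → ℝ) (hv : ∃ M, ∀ x ∈ R, |v x| ≤ M) :
    L2 R →L[ℂ] L2 R :=
  LinearMap.mkContinuous
    { toFun := fun f => ⟨fun x => (v x : ℂ) * f x, memℓp_gen' (sum_mul_le hv.choose_spec f)⟩
      map_add' := by
        intro f g
        ext x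
        exact mul_add (v x : ℂ) (f x) (g x)
      map_smul' := by
        intro c f
        ext x
        simp [mul_left_comm] }
    |hv.choose|
    (fun f => lp.norm_le_of_forall_sum_le (by norm_num) (by positivity)
      (sum_mul_le hv.choose_spec f))

open Classical in
/-- The multiplication operator by the potential `v` on `ℓ²(R)`. (A random potential whose site
values have one compactly supported law is almost surely bounded; the value `0` for an unbounded
potential only concerns a null event.) -/
def potential {d : ℕ} (R : Set (Site d)) (v : Site d → ℝ) : L2 R →L[ℂ] L2 R :=
  if hv : ∃ M, ∀ x ∈ R, |v x| ≤ M then mulBdd R v hv else 0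

/-- The discrete Schrödinger operator `H_R = -Δ + lam v` restricted to `ℓ²(R)`:
`(H_R f)(x) = 2 d f(x) - ∑ f(y) + lam v(x) f(x)`, with the sum over the nearest neighbours `y`
of `x` in `R`. -/
def hamiltonian {d : ℕ} (R : Set (Site d)) (lam : ℝ) (v : Site d → ℝ) : L2 R →L[ℂ] L2 R :=
  (2 * d : ℂ) • (1 : L2 R →L[ℂ] L2 R) - ∑ e ∈ steps d, hop R e + (lam : ℂ) • potential R v

open Classical in
/-- The vector `|x⟩` of `ℓ²(R)`: the unit mass at `x` (zero if `x ∉ R`). -/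
def ket {d : ℕ} (R : Set (Site d)) (x : Site d) : L2 R :=
  if h : x ∈ R then lp.single 2 (⟨x, h⟩ : R) (1 : ℂ) else 0

/-- The Green function `⟨x| (H_R - z)⁻¹ |y⟩`. -/
def green {d : ℕ} (R : Set (Site d)) (lam : ℝ) (v : Site d → ℝ) (z : ℂ) (x y : Site d) : ℂ :=
  inner ℂ (ket R x)
    (Ring.inverse (hamiltonian R lam v - z • (1 : L2 R →L[ℂ] L2 R)) (ket R y))

/-- The site potentials `V x` are independent random variables with one common distribution,
which has a bounded density of compact support. -/
structure IsRegular {d : ℕ} {S : Type*} [MeasurableSpace S] (P : Measure S)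
    (V : Site d → S → ℝ) : Prop where
  measurable : ∀ x, Measurable (V x)
  indep : iIndepFun V P
  density : ∃ (ρ : ℝ → ℝ) (M : ℝ), Measurable ρ ∧ (∀ t, 0 ≤ ρ t ∧ ρ t ≤ M) ∧
    HasCompactSupport ρ ∧
    ∀ x, P.map (V x) = volume.withDensity fun t => ENNReal.ofReal (ρ t)

/-- The fractional moment `E(|⟨x| (H_R - z)⁻¹ |y⟩|^s)`, as an extended nonnegative number. -/
def fracMoment {d : ℕ} {S : Type*} [MeasurableSpace S] (P : Measure S) (V : Site d → S → ℝ)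
    (lam s : ℝ) (R : Set (Site d)) (z : ℂ) (x y : Site d) : ℝ≥0∞ :=
  ∫⁻ ω, ENNReal.ofReal (‖green R lam (fun w => V w ω) z x y‖ ^ s) ∂P

/-- The finite volume quantity
`(1 + (C / lam^s) |Γ(Λ)|)² ∑_{(u, u') ∈ Γ(Λ)} E(|⟨0| (H_Λ - E)⁻¹ |u⟩|^s)`. -/
def criterion {d : ℕ} {S : Type*} [MeasurableSpace S] (P : Measure S) (V : Site d → S → ℝ)
    (lam s C : ℝ) (Λ : Finset (Site d)) (E : ℂ) : ℝ≥0∞ :=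
  ENNReal.ofReal ((1 + C / lam ^ s * ((bonds Λ).card : ℝ)) ^ 2) *
    ∑ b ∈ bonds Λ, fracMoment P V lam s (Λ : Set (Site d)) E 0 b.1

/-- The fractional moment condition on the energy interval `(a₁, a₂)`, for the operator on the
whole lattice: exponential decay, uniformly in `η ≠ 0` and in the energy. -/
def FractionalMomentCondition {d : ℕ} {S : Type*} [MeasurableSpace S] (P : Measure S)
    (V : Site d → S → ℝ) (lam s a₁ a₂ : ℝ) : Prop :=
  ∃ A μ : ℝ, 0 < μ ∧ ∀ E ∈ Set.Ioo a₁ a₂, ∀ η : ℝ, η ≠ 0 → ∀ x y : Site d,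
    fracMoment P V lam s Set.univ (E + η * Complex.I) x y
      ≤ ENNReal.ofReal (A * Real.exp (-μ * siteDist x y))

end Anderson

end

noncomputable section

namespace Anderson

variable {d : ℕ}

/-! ### The lattice -/

/-! Fractional moments stay bounded up to the real axis. As a function of the potential at `x` and
`y` alone, `G(x, y)` is a rational expression with explicit poles, and `|t + b|⁻ˢ` is integrable
against a bounded density because `s < 1`. So, even conditionally on the potential elsewhere, the
moment is at most a constant times `λ⁻ˢ` (`norm_green_eq`, `lintegral_pairKernel_le`,
`lintegral_mul_green_le`).

Let `W = x + Λ` lie inside the region. The geometric resolvent identity `green_eq_sum_bonds` writes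
`G(x, y)` as a sum over bonds `(u, u')` of `W` of `G_W(x, u) G(u', y)`. The two factors are
dependent, since `G(u', y)` sees the potential in `W`. To decouple them, the potential on `W` and on
a collar of width two is replaced by an independent copy: `norm_green_le_sum_collar` bounds `|G(u',
y)|` by a sum over collar sites `q` of `|G(u', q)|` times resampled Green functions at `q` and its
neighbours. Averaging over the potential at `u'` and `q`, which enters neither `G_W` nor the
resampled factor, removes `G(u', q)` at the cost of the a priori bound; what remains is independent.
Thus the moment at `x` is at most `contractionFactor` times a bound for the moments at sites near
`x` (`moment_contraction`). Iterating at whichever endpoint is far from the boundary gives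
exponential decay in `regionDist` (`moment_le_pow`, `exists_moment_le_exp`).

The prefactor in `contractionFactor` is linear in `|Γ(Λ)|` and of order `λ⁻ˢ (1 + λˢ)`. For `λ ≤ λ₀`
it is dominated by `(1 + C λ⁻ˢ |Γ(Λ)|)²`, so the criterion forces contraction on `Λ`; for `λ ≥ λ₀` a
single site contracts at every energy. This dichotomy makes the constant independent of `λ`
(`exists_contracting_scale`).

The iteration runs at non-real `z`, the hypothesis is at `E`. In finite volume the moments are upper
semicontinuous at `E` (`eventually_moment_le`), so strict contraction persists for all non-real `z`
near `E`. This yields both upper limits, and for real `E` the bound at small `|η|`; larger `|η|` is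
covered by the deterministic decay `exists_norm_green_le`. -/

lemma siteDist_comm (x y : Site d) : siteDist x y = siteDist y x := by
  unfold siteDist
  exact Finset.sum_congr rfl fun j _ => by omega

lemma siteDist_self (x : Site d) : siteDist x x = 0 := by simp [siteDist]

lemma siteDist_triangle (x y w : Site d) : siteDist x w ≤ siteDist x y + siteDist y w := by
  unfold siteDist
  rw [← Finset.sum_add_distrib]
  exact Finset.sum_le_sum fun j _ => by omega

lemma siteDist_add_left (a x y : Site d) : siteDist (a + x) (a + y) = siteDist x y := by
  simp [siteDist]

lemma eq_of_siteDist_eq_zero {x y : Site d} (h : siteDist x y = 0) : x = y := by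
  funext j
  have h1 := (Finset.sum_eq_zero_iff.1 h) j (Finset.mem_univ j)
  omega

lemma neg_mem_steps {e : Site d} (he : e ∈ steps d) : -e ∈ steps d := by
  simp only [steps, Finset.mem_union, Finset.mem_image, Finset.mem_univ, true_and] at he ⊢
  rcases he with ⟨j, rfl⟩ | ⟨j, rfl⟩
  · exact Or.inr ⟨j, Pi.single_neg j 1⟩
  · exact Or.inl ⟨j, by rw [← Pi.single_neg]; simp⟩

lemma sum_steps_neg {A : Type*} [AddCommMonoid A] (f : Site d → A) :
    ∑ e ∈ steps d, f (-e) = ∑ e ∈ steps d, f e :=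
  Finset.sum_nbij' (fun e => -e) (fun e => -e) (fun _ h => neg_mem_steps h)
    (fun _ h => neg_mem_steps h) (fun _ _ => neg_neg _) (fun _ _ => neg_neg _) (fun _ _ => rfl)

lemma card_steps_le : (steps d).card ≤ 2 * d := by
  refine (Finset.card_union_le _ _).trans ?_
  have h1 := Finset.card_image_le (s := Finset.univ) (f := fun j : Fin d => (Pi.single j 1 : Site d))
  have h2 := Finset.card_image_le (s := Finset.univ)
    (f := fun j : Fin d => (Pi.single j (-1) : Site d))
  simp only [Finset.card_univ, Fintype.card_fin] at h1 h2
  omega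

lemma siteDist_step {e : Site d} (he : e ∈ steps d) (x : Site d) : siteDist x (x + e) = 1 := by
  have key : ∀ (j : Fin d) (c : ℤ), siteDist x (x + Pi.single j c) = c.natAbs := by
    intro j c
    unfold siteDist
    rw [Finset.sum_eq_single j]
    · simp
    · intro i _ hi
      simp [Pi.single_eq_of_ne hi]
    · simp
  simp only [steps, Finset.mem_union, Finset.mem_image, Finset.mem_univ, true_and] at he
  rcases he with ⟨j, rfl⟩ | ⟨j, rfl⟩
  · simpa using key j 1
  · simpa using key j (-1)

/-! ### Extension by zero and the Hamiltonian -/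

open Classical in
/-- Extension of a vector in `ℓ²(R)` by zero to the whole lattice. -/
def zeroExt (R : Set (Site d)) : L2 R →ₗ[ℂ] (Site d → ℂ) where
  toFun f x := if h : x ∈ R then f ⟨x, h⟩ else 0
  map_add' f g := by
    funext x
    by_cases h : x ∈ R <;> simp [h]
  map_smul' c f := by
    funext x
    by_cases h : x ∈ R <;> simp [h]

variable {R : Set (Site d)}

lemma zeroExt_mem (f : L2 R) {x : Site d} (h : x ∈ R) : zeroExt R f x = f ⟨x, h⟩ := by
  simp [zeroExt, h]

lemma zeroExt_notMem (f : L2 R) {x : Site d} (h : x ∉ R) : zeroExt R f x = 0 := by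
  simp [zeroExt, h]

lemma zeroExt_coe (f : L2 R) (x : R) : zeroExt R f x = f x := zeroExt_mem f x.2

lemma zeroExt_injective : Function.Injective (zeroExt R) := by
  intro f g h
  ext x
  rw [← zeroExt_coe, ← zeroExt_coe, h]

lemma zeroExt_ket {x : Site d} (hx : x ∈ R) (q : Site d) :
    zeroExt R (ket R x) q = if q = x then 1 else 0 := by
  classical
  by_cases hq : q ∈ R
  · rw [zeroExt_mem _ hq]
    by_cases h : q = x
    · subst h
      simp [ket, hq]
    · rw [if_neg h]
      simp [ket, hx, h]
  · rw [zeroExt_notMem _ hq, if_neg]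
    rintro rfl
    exact hq hx

lemma ket_notMem {x : Site d} (hx : x ∉ R) : ket R x = 0 := by simp [ket, hx]

lemma inner_ket (x : Site d) (f : L2 R) : inner ℂ (ket R x) f = zeroExt R f x := by
  classical
  by_cases hx : x ∈ R
  · rw [zeroExt_mem _ hx, ket, dif_pos hx]
    have := lp.inner_single_left (𝕜 := ℂ) (⟨x, hx⟩ : R) (1 : ℂ) f
    rw [RCLike.inner_apply, map_one, mul_one] at this
    convert this
  · rw [zeroExt_notMem _ hx, ket_notMem hx, inner_zero_left]

lemma norm_ket_le (x : Site d) : ‖ket R x‖ ≤ 1 := by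
  classical
  by_cases hx : x ∈ R
  · rw [ket, dif_pos hx, lp.norm_single (by norm_num)]
    simp
  · simp [ket_notMem hx]

lemma norm_zeroExt_le (f : L2 R) (x : Site d) : ‖zeroExt R f x‖ ≤ ‖f‖ := by
  by_cases hx : x ∈ R
  · rw [zeroExt_mem _ hx]
    exact lp.norm_apply_le_norm (by norm_num) f _
  · simp [zeroExt_notMem _ hx]

/-- Summing over the whole lattice instead of `R` makes lattice shifts available as changes of
variable. -/
lemma inner_eq_tsum_zeroExt (f g : L2 R) :
    inner ℂ f g = ∑' x, star (zeroExt R f x) * zeroExt R g x := by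
  rw [lp.inner_eq_tsum]
  have h := tsum_subtype R fun x => star (zeroExt R f x) * zeroExt R g x
  rw [Set.indicator_eq_self.2] at h
  · rw [← h]
    refine tsum_congr fun x => ?_
    rw [zeroExt_coe, zeroExt_coe, RCLike.inner_apply, mul_comm]
    rfl
  · intro x hx
    by_contra hR
    exact hx (by simp [zeroExt_notMem _ hR])

open Classical in
lemma zeroExt_hop (e : Site d) (f : L2 R) (x : Site d) :
    zeroExt R (hop R e f) x = if x ∈ R then zeroExt R f (x + e) else 0 := by
  by_cases hx : x ∈ R
  · rw [zeroExt_mem _ hx, if_pos hx]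
    rfl
  · rw [zeroExt_notMem _ hx, if_neg hx]

lemma inner_hop (e : Site d) (f g : L2 R) :
    inner ℂ (hop R e f) g = inner ℂ f (hop R (-e) g) := by
  classical
  rw [inner_eq_tsum_zeroExt, inner_eq_tsum_zeroExt]
  have h := (Equiv.addRight e).tsum_eq fun x => star (zeroExt R f x) * zeroExt R (hop R (-e) g) x
  rw [← h]
  refine tsum_congr fun x => ?_
  rw [zeroExt_hop, zeroExt_hop, Equiv.coe_addRight, add_neg_cancel_right]
  by_cases hx : x ∈ R <;> by_cases hx' : x + e ∈ R <;>
    simp [hx, hx', zeroExt_notMem]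

lemma potential_apply {v : Site d → ℝ} (hv : ∃ M, ∀ x, |v x| ≤ M) (f : L2 R) (x : Site d) :
    zeroExt R (potential R v f) x = v x * zeroExt R f x := by
  have hv' : ∃ M, ∀ x ∈ R, |v x| ≤ M := hv.imp fun M h x _ => h x
  rw [potential, dif_pos hv']
  by_cases hx : x ∈ R
  · rw [zeroExt_mem _ hx, zeroExt_mem _ hx]
    rfl
  · simp [zeroExt_notMem _ hx]

lemma hamiltonian_apply (lam : ℝ) (v : Site d → ℝ) (f : L2 R) : hamiltonian R lam v f
    = (2 * d : ℂ) • f - ∑ e ∈ steps d, hop R e f + (lam : ℂ) • potential R v f := by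
  rw [hamiltonian, add_apply, sub_apply, smul_apply, smul_apply, sum_apply,
    one_apply_eq_self]

lemma zeroExt_hamiltonian {v : Site d → ℝ} (hv : ∃ M, ∀ x, |v x| ≤ M) (lam : ℝ) (f : L2 R)
    {x : Site d} (hx : x ∈ R) :
    zeroExt R (hamiltonian R lam v f) x
      = (2 * d + lam * v x) * zeroExt R f x - ∑ e ∈ steps d, zeroExt R f (x + e) := by
  rw [hamiltonian_apply]
  simp only [map_add, map_sub, map_smul, map_sum, Pi.add_apply, Pi.sub_apply, Pi.smul_apply,
    Finset.sum_apply, potential_apply hv, zeroExt_hop, if_pos hx, smul_eq_mul]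
  ring

lemma inner_potential {v : Site d → ℝ} (hv : ∃ M, ∀ x, |v x| ≤ M) (f g : L2 R) :
    inner ℂ (potential R v f) g = inner ℂ f (potential R v g) := by
  rw [inner_eq_tsum_zeroExt, inner_eq_tsum_zeroExt]
  refine tsum_congr fun x => ?_
  rw [potential_apply hv, potential_apply hv, star_mul]
  simp only [Complex.star_def, Complex.conj_ofReal]
  ring

lemma inner_hamiltonian {v : Site d → ℝ} (hv : ∃ M, ∀ x, |v x| ≤ M) (lam : ℝ) (f g : L2 R) :
    inner ℂ (hamiltonian R lam v f) g = inner ℂ f (hamiltonian R lam v g) := by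
  rw [hamiltonian_apply, hamiltonian_apply]
  simp only [inner_add_left, inner_sub_left, inner_smul_left, sum_inner, inner_add_right,
    inner_sub_right, inner_smul_right, inner_sum, inner_potential hv, inner_hop]
  rw [sum_steps_neg fun e => inner ℂ f (hop R e g)]
  have h2 : (starRingEnd ℂ) (2 * d : ℂ) = 2 * d := by
    rw [map_mul, Complex.conj_ofNat, Complex.conj_natCast]
  rw [h2, Complex.conj_ofReal]

lemma isSelfAdjoint_hamiltonian {v : Site d → ℝ} (hv : ∃ M, ∀ x, |v x| ≤ M) (lam : ℝ) :
    IsSelfAdjoint (hamiltonian R lam v) :=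
  (ContinuousLinearMap.isSelfAdjoint_iff_isSymmetric).2 fun f g => inner_hamiltonian hv lam f g

lemma norm_hop_le (e : Site d) : ‖hop R e‖ ≤ 1 := LinearMap.mkContinuous_norm_le _ zero_le_one _

lemma norm_potential_le {v : Site d → ℝ} {M : ℝ} (hM : 0 ≤ M) (hv : ∀ x, |v x| ≤ M) :
    ‖potential R v‖ ≤ M := by
  have hv' : ∃ M, ∀ x ∈ R, |v x| ≤ M := ⟨M, fun x _ => hv x⟩
  refine ContinuousLinearMap.opNorm_le_bound _ hM fun f => ?_
  rw [potential, dif_pos hv']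
  refine lp.norm_le_of_forall_sum_le (by norm_num) (by positivity) fun t => ?_
  have := sum_mul_le (fun x (_ : x ∈ R) => hv x) f t
  rwa [abs_of_nonneg hM] at this

lemma norm_hamiltonian_le {v : Site d → ℝ} {M : ℝ} (hM : 0 ≤ M) (hv : ∀ x, |v x| ≤ M) (lam : ℝ) :
    ‖hamiltonian R lam v‖ ≤ 4 * d + |lam| * M := by
  have h1 : ‖(2 * d : ℂ) • (1 : L2 R →L[ℂ] L2 R)‖ ≤ 2 * d := by
    rw [norm_smul]
    have : ‖(1 : L2 R →L[ℂ] L2 R)‖ ≤ 1 := ContinuousLinearMap.norm_id_le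
    have h2 : ‖(2 * d : ℂ)‖ = 2 * d := by simp
    rw [h2]
    exact mul_le_of_le_one_right (by positivity) this
  have h2 : ‖∑ e ∈ steps d, hop R e‖ ≤ 2 * d := by
    refine (norm_sum_le_of_le _ fun e _ => norm_hop_le e).trans ?_
    simpa using (by exact_mod_cast card_steps_le : ((steps d).card : ℝ) ≤ (2 * d : ℕ))
  have h3 : ‖(lam : ℂ) • potential R v‖ ≤ |lam| * M := by
    rw [norm_smul, Complex.norm_real, Real.norm_eq_abs]
    exact mul_le_mul_of_nonneg_left (norm_potential_le hM hv) (abs_nonneg _)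
  calc ‖hamiltonian R lam v‖ ≤ 2 * d + 2 * d + |lam| * M :=
        (norm_add_le _ _).trans (add_le_add ((norm_sub_le _ _).trans (add_le_add h1 h2)) h3)
    _ = _ := by ring

/-- All coefficients are real, so complex conjugation commutes with the operator; together with
self-adjointness this gives the symmetry of the Green function. -/
lemma star_hamiltonian {v : Site d → ℝ} (hv : ∃ M, ∀ x, |v x| ≤ M) (lam : ℝ) (f : L2 R) :
    star (hamiltonian R lam v f) = hamiltonian R lam v (star f) := by
  have hs : ∀ (g : L2 R) (q : Site d), zeroExt R (star g) q = star (zeroExt R g q) := by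
    intro g q
    by_cases hq : q ∈ R
    · rw [zeroExt_mem _ hq, zeroExt_mem _ hq]
      rfl
    · simp [zeroExt_notMem _ hq]
  refine zeroExt_injective (funext fun x => ?_)
  by_cases hx : x ∈ R
  · rw [hs, zeroExt_hamiltonian hv _ _ hx, zeroExt_hamiltonian hv _ _ hx]
    simp [hs]
  · rw [zeroExt_notMem _ hx, zeroExt_notMem _ hx]

/-! ### The Green function -/

/-- The spectrum of a self-adjoint operator is real. -/
lemma isUnit_hamiltonian_sub {v : Site d → ℝ} (hv : ∃ M, ∀ x, |v x| ≤ M) (lam : ℝ) {z : ℂ}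
    (hz : z.im ≠ 0) : IsUnit (hamiltonian R lam v - z • (1 : L2 R →L[ℂ] L2 R)) := by
  have h : z ∉ spectrum ℂ (hamiltonian R lam v) := by
    intro hz'
    have := (isSelfAdjoint_hamiltonian (R := R) hv lam).mem_spectrum_eq_re hz'
    rw [this] at hz
    simp at hz
  rw [spectrum.notMem_iff, Algebra.algebraMap_eq_smul_one] at h
  simpa using h.neg

/-- The column `G(·, y)` of the Green function, as a vector of `ℓ²(R)`. -/
def greenCol (R : Set (Site d)) (lam : ℝ) (v : Site d → ℝ) (z : ℂ) (y : Site d) : L2 R :=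
  Ring.inverse (hamiltonian R lam v - z • (1 : L2 R →L[ℂ] L2 R)) (ket R y)

lemma green_eq (lam : ℝ) (v : Site d → ℝ) (z : ℂ) (x y : Site d) :
    green R lam v z x y = zeroExt R (greenCol R lam v z y) x := inner_ket _ _

lemma green_left_notMem (lam : ℝ) (v : Site d → ℝ) (z : ℂ) {x : Site d} (hx : x ∉ R) (y : Site d) :
    green R lam v z x y = 0 := by rw [green_eq, zeroExt_notMem _ hx]

lemma green_right_notMem (lam : ℝ) (v : Site d → ℝ) (z : ℂ) (x : Site d) {y : Site d}
    (hy : y ∉ R) : green R lam v z x y = 0 := by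
  rw [green_eq, greenCol, ket_notMem hy, map_zero, map_zero, Pi.zero_apply]

section unit

variable {v : Site d → ℝ} {lam : ℝ} {z : ℂ}

lemma sub_greenCol (hu : IsUnit (hamiltonian R lam v - z • (1 : L2 R →L[ℂ] L2 R))) (y : Site d) :
    (hamiltonian R lam v - z • (1 : L2 R →L[ℂ] L2 R)) (greenCol R lam v z y) = ket R y := by
  rw [greenCol, ← mul_apply_eq_comp, Ring.mul_inverse_cancel _ hu]
  rfl

lemma inverse_sub_apply (hu : IsUnit (hamiltonian R lam v - z • (1 : L2 R →L[ℂ] L2 R)))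
    (f : L2 R) : Ring.inverse (hamiltonian R lam v - z • (1 : L2 R →L[ℂ] L2 R))
      ((hamiltonian R lam v - z • (1 : L2 R →L[ℂ] L2 R)) f) = f := by
  rw [← mul_apply_eq_comp, Ring.inverse_mul_cancel _ hu]
  rfl

lemma zeroExt_sub (hv : ∃ M, ∀ x, |v x| ≤ M) (f : L2 R) {x : Site d} (hx : x ∈ R) :
    zeroExt R ((hamiltonian R lam v - z • (1 : L2 R →L[ℂ] L2 R)) f) x
      = (2 * d + lam * v x - z) * zeroExt R f x - ∑ e ∈ steps d, zeroExt R f (x + e) := by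
  have : (hamiltonian R lam v - z • (1 : L2 R →L[ℂ] L2 R)) f = hamiltonian R lam v f - z • f := rfl
  rw [this, map_sub, map_smul, Pi.sub_apply, Pi.smul_apply, zeroExt_hamiltonian hv _ _ hx,
    smul_eq_mul]
  ring

/-- The equation `(H - z) G(·, y) = δ_y`. -/
lemma green_equation (hv : ∃ M, ∀ x, |v x| ≤ M)
    (hu : IsUnit (hamiltonian R lam v - z • (1 : L2 R →L[ℂ] L2 R)))
    {x y : Site d} (hx : x ∈ R) (hy : y ∈ R) :
    (2 * d + lam * v x - z) * green R lam v z x y - ∑ e ∈ steps d, green R lam v z (x + e) y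
      = if x = y then 1 else 0 := by
  have h := zeroExt_sub (z := z) (lam := lam) hv (greenCol R lam v z y) hx
  rw [sub_greenCol hu, zeroExt_ket hy] at h
  simp only [green_eq]
  exact h.symm

/-- A vector `φ` for which `(H - z) φ` is finitely supported is a combination of columns of the
Green function. -/
lemma zeroExt_eq_sum_green (hv : ∃ M, ∀ x, |v x| ≤ M)
    (hu : IsUnit (hamiltonian R lam v - z • (1 : L2 R →L[ℂ] L2 R)))
    (φ : L2 R) (S : Finset (Site d)) (c : Site d → ℂ)
    (hc : ∀ q ∈ R, (2 * d + lam * v q - z) * zeroExt R φ q - ∑ e ∈ steps d, zeroExt R φ (q + e)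
      = if q ∈ S then c q else 0) (x : Site d) :
    zeroExt R φ x = ∑ q ∈ S, c q * green R lam v z x q := by
  classical
  have h : (hamiltonian R lam v - z • (1 : L2 R →L[ℂ] L2 R)) φ
      = ∑ q ∈ S, c q • ket R q := by
    refine zeroExt_injective (funext fun w => ?_)
    by_cases hw : w ∈ R
    · rw [zeroExt_sub hv _ hw, hc w hw, map_sum, Finset.sum_apply]
      have : ∀ q ∈ S, zeroExt R (c q • ket R q) w = if w = q then c q else 0 := by
        intro q _
        rw [map_smul, Pi.smul_apply, smul_eq_mul]
        by_cases hq : q ∈ R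
        · rw [zeroExt_ket hq]
          simp
        · rw [ket_notMem hq, if_neg]
          · simp
          · rintro rfl
            exact hq hw
      rw [Finset.sum_congr rfl this, Finset.sum_ite_eq]
    · rw [zeroExt_notMem _ hw, zeroExt_notMem _ hw]
  have h2 := inverse_sub_apply hu φ
  rw [h, map_sum] at h2
  rw [← h2, map_sum, Finset.sum_apply]
  refine Finset.sum_congr rfl fun q _ => ?_
  rw [map_smul, map_smul, Pi.smul_apply, smul_eq_mul, green_eq]
  rfl

/-- The bilinear form `⟨f̄, g⟩` is symmetric, and the real self-adjoint operator is symmetric for it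
even at non-real `z`. Evaluating it on the two columns gives both entries. -/
lemma green_symm (hv : ∃ M, ∀ x, |v x| ≤ M)
    (hu : IsUnit (hamiltonian R lam v - z • (1 : L2 R →L[ℂ] L2 R))) (x y : Site d) :
    green R lam v z x y = green R lam v z y x := by
  have hB : ∀ f g : L2 R,
      inner ℂ (star ((hamiltonian R lam v - z • (1 : L2 R →L[ℂ] L2 R)) f)) g
        = inner ℂ (star f) ((hamiltonian R lam v - z • (1 : L2 R →L[ℂ] L2 R)) g) := by
    intro f g
    change inner ℂ (star (hamiltonian R lam v f - z • f)) g
      = inner ℂ (star f) (hamiltonian R lam v g - z • g)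
    rw [star_sub, star_hamiltonian hv, inner_sub_left, inner_sub_right, inner_hamiltonian hv,
      star_smul, inner_smul_left, inner_smul_right]
    simp
  have hk : ∀ w : Site d, star (ket R w) = ket R w := by
    intro w
    by_cases hw : w ∈ R
    · refine zeroExt_injective (funext fun q => ?_)
      by_cases hq : q ∈ R
      · have h1 := zeroExt_ket hw q
        rw [zeroExt_mem _ hq] at h1 ⊢
        rw [lp.star_apply, h1, zeroExt_ket hw]
        split_ifs <;> simp
      · rw [zeroExt_notMem _ hq, zeroExt_notMem _ hq]
    · simp [ket_notMem hw]
  have hs : ∀ (f : L2 R) (w : Site d), inner ℂ (star f) (ket R w) = zeroExt R f w := by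
    intro f w
    rw [← inner_ket, inner_eq_tsum_zeroExt, inner_eq_tsum_zeroExt]
    refine tsum_congr fun q => ?_
    by_cases hq : q ∈ R
    · nth_rewrite 2 [← hk w]
      rw [zeroExt_mem _ hq, zeroExt_mem _ hq, zeroExt_mem _ hq, zeroExt_mem _ hq, lp.star_apply,
        lp.star_apply, star_star, star_star, mul_comm]
    · simp [zeroExt_notMem _ hq]
  have h := hB (greenCol R lam v z y) (greenCol R lam v z x)
  rw [sub_greenCol hu, sub_greenCol hu, hk, inner_ket, hs] at h
  rw [green_eq, green_eq, h]

end unit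

end Anderson
end

noncomputable section

namespace Anderson

variable {d : ℕ} {R : Set (Site d)}

/-! ### A Neumann series for the resolvent: decay and measurability -/

/-- The operator `T` with `H - z = -i (Im z + K) (1 - T)`; it is a contraction if `K` is large and
of the sign of `Im z`. -/
def neumannOp (R : Set (Site d)) (lam : ℝ) (v : Site d → ℝ) (z : ℂ) (K : ℝ) : L2 R →L[ℂ] L2 R :=
  (((z.im + K : ℝ) : ℂ) * Complex.I)⁻¹ •
    (hamiltonian R lam v - ((z.re : ℂ) - K * Complex.I) • (1 : L2 R →L[ℂ] L2 R))

/-- The cross term vanishes because `⟨A f, f⟩` is real for symmetric `A`. -/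
lemma norm_sub_smul_sq {A : L2 R →L[ℂ] L2 R}
    (hA : ∀ f g : L2 R, inner ℂ (A f) g = inner ℂ f (A g)) (K : ℝ) (f : L2 R) :
    ‖A f + ((K : ℂ) * Complex.I) • f‖ ^ 2 = ‖A f‖ ^ 2 + K ^ 2 * ‖f‖ ^ 2 := by
  have hre : (inner ℂ (A f) f).im = 0 := by
    have h := inner_conj_symm (𝕜 := ℂ) (A f) f
    rw [← hA] at h
    exact Complex.conj_eq_iff_im.1 h
  rw [@norm_add_sq ℂ, inner_smul_right, norm_smul]
  have : RCLike.re ((K : ℂ) * Complex.I * inner ℂ (A f) f) = 0 := by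
    simp [hre]
  rw [this]
  simp [mul_pow]

lemma neumannOp_apply (lam : ℝ) (v : Site d → ℝ) (z : ℂ) (K : ℝ) (f : L2 R) :
    neumannOp R lam v z K f = (((z.im + K : ℝ) : ℂ) * Complex.I)⁻¹ •
      (hamiltonian R lam v f - ((z.re : ℂ) - K * Complex.I) • f) := rfl

/-- Adding `iK` with the sign of `Im z` enlarges the denominator linearly, whereas the numerator
grows only like the hypotenuse of `N + E₀` and `K`. -/
lemma norm_neumannOp_le {v : Site d → ℝ} (hv : ∃ M, ∀ x, |v x| ≤ M) {lam N E₀ η₀ K : ℝ} {z : ℂ}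
    (hN : ‖hamiltonian R lam v‖ ≤ N) (hz : |z.re| ≤ E₀) (hη₀ : 0 < η₀) (hη : η₀ ≤ |z.im|)
    (hK : 0 ≤ z.im * K) :
    ‖neumannOp R lam v z K‖ ≤ √((N + E₀) ^ 2 + K ^ 2) / (η₀ + |K|) := by
  refine ContinuousLinearMap.opNorm_le_bound _ (by positivity) fun f => ?_
  have hA : ∀ f g : L2 R, inner ℂ ((hamiltonian R lam v - (z.re : ℂ) • (1 : L2 R →L[ℂ] L2 R)) f) g
      = inner ℂ f ((hamiltonian R lam v - (z.re : ℂ) • (1 : L2 R →L[ℂ] L2 R)) g) := by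
    intro f g
    change inner ℂ (hamiltonian R lam v f - (z.re : ℂ) • f) g
      = inner ℂ f (hamiltonian R lam v g - (z.re : ℂ) • g)
    rw [inner_sub_left, inner_sub_right, inner_hamiltonian hv, inner_smul_left, inner_smul_right]
    simp
  have h1 : ‖hamiltonian R lam v f - ((z.re : ℂ) - K * Complex.I) • f‖ ^ 2
      ≤ ((N + E₀) ^ 2 + K ^ 2) * ‖f‖ ^ 2 := by
    have h2 := norm_sub_smul_sq hA K f
    have h3 : hamiltonian R lam v f - ((z.re : ℂ) - K * Complex.I) • f
        = (hamiltonian R lam v - (z.re : ℂ) • (1 : L2 R →L[ℂ] L2 R)) f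
          + ((K : ℂ) * Complex.I) • f := by
      change _ = (hamiltonian R lam v f - (z.re : ℂ) • f) + ((K : ℂ) * Complex.I) • f
      rw [sub_smul]
      abel
    rw [h3, h2]
    have h4 : ‖(hamiltonian R lam v - (z.re : ℂ) • (1 : L2 R →L[ℂ] L2 R)) f‖
        ≤ (N + E₀) * ‖f‖ := by
      change ‖hamiltonian R lam v f - (z.re : ℂ) • f‖ ≤ _
      refine (norm_sub_le _ _).trans ?_
      rw [norm_smul, Complex.norm_real, Real.norm_eq_abs, add_mul]
      exact add_le_add (ContinuousLinearMap.le_of_opNorm_le _ hN f)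
        (mul_le_mul_of_nonneg_right hz (norm_nonneg _))
    have h5 := pow_le_pow_left₀ (norm_nonneg _) h4 2
    rw [mul_pow] at h5
    linarith
  have h6 : ‖hamiltonian R lam v f - ((z.re : ℂ) - K * Complex.I) • f‖
      ≤ √((N + E₀) ^ 2 + K ^ 2) * ‖f‖ := by
    rw [← Real.sqrt_sq (norm_nonneg f), ← Real.sqrt_mul (by positivity)]
    exact Real.le_sqrt_of_sq_le h1
  have h7 : η₀ + |K| ≤ ‖((z.im + K : ℝ) : ℂ) * Complex.I‖ := by
    rw [norm_mul, Complex.norm_I, mul_one, Complex.norm_real, Real.norm_eq_abs,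
      (abs_add_eq_add_abs_iff _ _).2 (by
        rcases le_total 0 z.im with h | h
        · rcases h.lt_or_eq with h0 | h0
          · exact Or.inl ⟨h, by nlinarith⟩
          · rw [← h0, abs_zero] at hη
            linarith
        · rcases h.lt_or_eq with h0 | h0
          · exact Or.inr ⟨h, by nlinarith⟩
          · rw [h0, abs_zero] at hη
            linarith)]
    gcongr
  rw [neumannOp_apply, norm_smul, norm_inv]
  calc ‖((z.im + K : ℝ) : ℂ) * Complex.I‖⁻¹
        * ‖hamiltonian R lam v f - ((z.re : ℂ) - K * Complex.I) • f‖
      ≤ (η₀ + |K|)⁻¹ * (√((N + E₀) ^ 2 + K ^ 2) * ‖f‖) := by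
        gcongr
    _ = _ := by ring

lemma zeroExt_neumannOp {v : Site d → ℝ} (hv : ∃ M, ∀ x, |v x| ≤ M) (lam : ℝ) (z : ℂ) (K : ℝ)
    (f : L2 R) {x : Site d} (hx : x ∈ R) :
    zeroExt R (neumannOp R lam v z K f) x = (((z.im + K : ℝ) : ℂ) * Complex.I)⁻¹ *
      ((2 * d + lam * v x - (z.re - K * Complex.I)) * zeroExt R f x
        - ∑ e ∈ steps d, zeroExt R f (x + e)) := by
  rw [neumannOp_apply, map_smul, Pi.smul_apply, map_sub, Pi.sub_apply, map_smul, Pi.smul_apply,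
    zeroExt_hamiltonian hv _ _ hx, smul_eq_mul, smul_eq_mul]
  ring

/-- The operator has range one, so `n` applications reach only distance `n`. -/
lemma zeroExt_neumannOp_pow_eq_zero {v : Site d → ℝ} (hv : ∃ M, ∀ x, |v x| ≤ M) (lam : ℝ) (z : ℂ)
    (K : ℝ) (y : Site d) (n : ℕ) {x : Site d} (hxy : n < siteDist x y) :
    zeroExt R ((neumannOp R lam v z K ^ n) (ket R y)) x = 0 := by
  by_cases hy : y ∈ R
  swap
  · rw [ket_notMem hy, map_zero, map_zero, Pi.zero_apply]
  induction n generalizing x with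
  | zero =>
    rw [pow_zero, one_apply_eq_self, zeroExt_ket hy, if_neg]
    rintro rfl
    rw [siteDist_self] at hxy
    exact lt_irrefl _ hxy
  | succ n ih =>
    by_cases hx : x ∈ R
    · rw [pow_succ', mul_apply_eq_comp, zeroExt_neumannOp hv _ _ _ _ hx, ih (by omega),
        Finset.sum_eq_zero, mul_zero, sub_zero, mul_zero]
      intro e he
      refine ih ?_
      have h1 := siteDist_triangle x (x + e) y
      rw [siteDist_step he] at h1
      omega
    · exact zeroExt_notMem _ hx

/-- This is the geometric series for `(1 - T)⁻¹`, applied to `δ_y` and read off at `x`. -/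
lemma hasSum_green {v : Site d → ℝ} (hv : ∃ M, ∀ x, |v x| ≤ M) {lam : ℝ} {z : ℂ} {K : ℝ}
    (hz : z.im ≠ 0) (hK : 0 ≤ z.im * K) (hT : ‖neumannOp R lam v z K‖ < 1) (x y : Site d) :
    HasSum (fun n => -(((z.im + K : ℝ) : ℂ) * Complex.I)⁻¹ *
      zeroExt R ((neumannOp R lam v z K ^ n) (ket R y)) x) (green R lam v z x y) := by
  set T := neumannOp R lam v z K with hTdef
  set c : ℂ := ((z.im + K : ℝ) : ℂ) * Complex.I with hc
  have hc0 : c ≠ 0 := by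
    rw [hc]
    refine mul_ne_zero ?_ Complex.I_ne_zero
    rw [Complex.ofReal_ne_zero]
    intro h
    have : z.im * (z.im + K) = 0 := by rw [h, mul_zero]
    nlinarith [sq_pos_of_ne_zero hz]
  have hs : HasSum (fun n => T ^ n) (∑' n, T ^ n) :=
    (summable_geometric_of_norm_lt_one hT).hasSum
  set u := greenCol R lam v z y
  have hu := sub_greenCol (R := R) (isUnit_hamiltonian_sub hv lam hz) y
  have h1 : (1 - T) u = (-c⁻¹) • ket R y := by
    rw [← hu]
    change u - T u = (-c⁻¹) • (hamiltonian R lam v u - z • u)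
    rw [hTdef, neumannOp_apply, ← hc]
    have : z • u = ((z.re : ℂ) - K * Complex.I) • u + c • u := by
      rw [← add_smul, hc]
      congr 1
      nth_rewrite 1 [← Complex.re_add_im z]
      push_cast
      ring
    rw [this, ← sub_sub, smul_sub (-c⁻¹), neg_smul, neg_smul, smul_smul, inv_mul_cancel₀ hc0,
      one_smul]
    abel
  have h2 : u = (-c⁻¹) • (∑' n, T ^ n) (ket R y) := by
    rw [← map_smul, ← h1, ← mul_apply_eq_comp, geom_series_mul_neg T hT, one_apply_eq_self]
  have h3 : HasSum (fun n => (T ^ n) (ket R y)) ((∑' n, T ^ n) (ket R y)) :=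
    (ContinuousLinearMap.apply ℂ (L2 R) (ket R y)).hasSum hs
  have h4 := (innerSL ℂ (ket R x)).hasSum h3
  have h5 := h4.mul_left (-c⁻¹)
  rw [green_eq, show greenCol R lam v z y = u from rfl, h2, map_smul, Pi.smul_apply, smul_eq_mul]
  simpa only [innerSL_apply_apply, inner_ket] using h5

/-- Parameters for which the Neumann series converges uniformly. -/
lemma exists_neumann_parameters (M lam E₀ η₀ : ℝ) (hM : 0 ≤ M) (hη₀ : 0 < η₀) :
    ∃ K q : ℝ, 0 < K ∧ 0 < q ∧ q < 1 ∧ ∀ (R : Set (Site d)) (v : Site d → ℝ), (∀ x, |v x| ≤ M) →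
      ∀ z : ℂ, |z.re| ≤ E₀ → η₀ ≤ |z.im| →
        ∃ K' : ℝ, |K'| = K ∧ 0 ≤ z.im * K' ∧ ‖neumannOp R lam v z K'‖ ≤ q := by
  set N : ℝ := 4 * d + |lam| * M with hN
  -- The ratio is below one exactly when `(N + E₀)² < η₀² + 2 η₀ K`; this `K` makes `2 η₀ K` alone
  -- exceed the left side.
  set K : ℝ := (N + E₀) ^ 2 / (2 * η₀) + 1 with hK
  have hK0 : 0 < K := by positivity
  refine ⟨K, √((N + E₀) ^ 2 + K ^ 2) / (η₀ + K), hK0, by positivity, ?_, ?_⟩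
  · rw [div_lt_one (by positivity), Real.sqrt_lt' (by positivity)]
    have : 2 * η₀ * K = (N + E₀) ^ 2 + 2 * η₀ := by
      rw [hK]
      field_simp
    nlinarith
  · intro R v hv z hz hη
    have key : ∀ K' : ℝ, |K'| = K → 0 ≤ z.im * K' →
        ‖neumannOp R lam v z K'‖ ≤ √((N + E₀) ^ 2 + K ^ 2) / (η₀ + K) := by
      intro K' h1 h2
      have := norm_neumannOp_le (R := R) ⟨M, hv⟩ (norm_hamiltonian_le hM hv lam) hz hη₀ hη h2
      rwa [h1, ← sq_abs K', h1] at this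
    rcases le_total 0 z.im with h | h
    · have h1 : |K| = K := abs_of_pos hK0
      have h2 : 0 ≤ z.im * K := by positivity
      exact ⟨K, h1, h2, key K h1 h2⟩
    · have h1 : |-K| = K := by rw [abs_neg, abs_of_pos hK0]
      have h2 : 0 ≤ z.im * -K := by nlinarith
      exact ⟨-K, h1, h2, key (-K) h1 h2⟩

/-- Exponential decay of the Green function, uniformly away from the real axis. -/
lemma exists_norm_green_le (M lam E₀ η₀ : ℝ) (hM : 0 ≤ M) (hη₀ : 0 < η₀) :
    ∃ C q : ℝ, 0 < C ∧ 0 < q ∧ q < 1 ∧ ∀ (R : Set (Site d)) (v : Site d → ℝ), (∀ x, |v x| ≤ M) →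
      ∀ z : ℂ, |z.re| ≤ E₀ → η₀ ≤ |z.im| → ∀ x y, ‖green R lam v z x y‖ ≤ C * q ^ siteDist x y := by
  obtain ⟨K, q, hK, hq0, hq1, hT⟩ := exists_neumann_parameters (d := d) M lam E₀ η₀ hM hη₀
  refine ⟨K⁻¹ * (1 - q)⁻¹, q, by have := sub_pos.2 hq1; positivity, hq0, hq1, ?_⟩
  intro R v hv z hz hη x y
  obtain ⟨K', hK', hs, hle⟩ := hT R v hv z hz hη
  have hz0 : z.im ≠ 0 := by
    intro h
    rw [h, abs_zero] at hη
    linarith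
  have hsum := hasSum_green ⟨M, hv⟩ hz0 hs (hle.trans_lt hq1) x y
  -- The terms with index below `|x - y|` vanish by finite range; the tail of the geometric series
  -- supplies the decay.
  rw [← hasSum_nat_add_iff' (siteDist x y), Finset.sum_eq_zero, sub_zero] at hsum
  swap
  · intro n hn
    rw [zeroExt_neumannOp_pow_eq_zero ⟨M, hv⟩ _ _ _ _ _ (Finset.mem_range.1 hn), mul_zero]
  have hc : ‖-(((z.im + K' : ℝ) : ℂ) * Complex.I)⁻¹‖ ≤ K⁻¹ := by
    rw [norm_neg, norm_inv, norm_mul, Complex.norm_I, mul_one, Complex.norm_real, Real.norm_eq_abs]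
    refine inv_anti₀ hK ?_
    rw [← hK']
    exact sq_le_sq.1 (by nlinarith)
  have hg : HasSum (fun n : ℕ => K⁻¹ * q ^ siteDist x y * q ^ n)
      (K⁻¹ * q ^ siteDist x y * (1 - q)⁻¹) :=
    (hasSum_geometric_of_lt_one hq0.le hq1).mul_left _
  rw [← hsum.tsum_eq]
  refine (tsum_of_norm_bounded hg fun n => ?_).trans_eq (by ring)
  rw [norm_mul, mul_assoc]
  refine mul_le_mul hc ?_ (norm_nonneg _) (by positivity)
  rw [← pow_add]
  calc ‖zeroExt R ((neumannOp R lam v z K' ^ (n + siteDist x y)) (ket R y)) x‖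
      ≤ ‖(neumannOp R lam v z K' ^ (n + siteDist x y)) (ket R y)‖ := norm_zeroExt_le _ _
    _ ≤ ‖neumannOp R lam v z K' ^ (n + siteDist x y)‖ * 1 :=
        ContinuousLinearMap.le_opNorm_of_le _ (norm_ket_le _)
    _ ≤ ‖neumannOp R lam v z K'‖ ^ (n + siteDist x y) := by
        rw [mul_one]
        rcases Nat.eq_zero_or_pos (n + siteDist x y) with h | h
        · rw [h, pow_zero, pow_zero]
          exact ContinuousLinearMap.norm_id_le
        · exact norm_pow_le' _ h
    _ ≤ q ^ (siteDist x y + n) := by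
        rw [add_comm n]
        exact pow_le_pow_left₀ (norm_nonneg _) hle _

/-- The potential `v` cut off at height `M`. -/
def clip (M : ℝ) (v : Site d → ℝ) (x : Site d) : ℝ := max (-M) (min M (v x))

lemma abs_clip_le {M : ℝ} (hM : 0 ≤ M) (v : Site d → ℝ) (x : Site d) : |clip M v x| ≤ M :=
  abs_le.2 ⟨le_max_left _ _, max_le (by linarith) (min_le_left _ _)⟩

lemma clip_eq_self {M : ℝ} {v : Site d → ℝ} (hv : ∀ x, |v x| ≤ M) : clip M v = v := by
  funext x
  have := abs_le.1 (hv x)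
  rw [clip, min_eq_right this.2, max_eq_right this.1]

lemma exists_clip_bound {M : ℝ} (hM : 0 ≤ M) (v : Site d → ℝ) : ∃ M', ∀ x, |clip M v x| ≤ M' :=
  ⟨M, abs_clip_le hM v⟩

/-- The partial sums of the Neumann series involve only arithmetic on finitely many coordinates of
`v`. Clipping makes one contraction bound valid for every `v`, so the limit exists everywhere. -/
lemma measurable_green_clip {M : ℝ} (hM : 0 ≤ M) (R : Set (Site d)) (lam : ℝ) {z : ℂ}
    (hz : z.im ≠ 0) (x y : Site d) : Measurable fun v => green R lam (clip M v) z x y := by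
  obtain ⟨K, q, hK, hq0, hq1, hT⟩ :=
    exists_neumann_parameters (d := d) M lam |z.re| |z.im| hM (abs_pos.2 hz)
  -- The shift must not depend on `v`. Its modulus is `K` and its sign is that of `Im z`, which
  -- determines it.
  obtain ⟨K', hs, hle⟩ : ∃ K' : ℝ, 0 ≤ z.im * K' ∧ ∀ v,
      ‖neumannOp R lam (clip M v) z K'‖ ≤ q := by
    obtain ⟨K', hK', hs, -⟩ := hT R 0 (fun _ => by simpa using hM) z le_rfl le_rfl
    refine ⟨K', hs, fun v => ?_⟩
    obtain ⟨K'', hK'', hs', hle⟩ := hT R (clip M v) (abs_clip_le hM v) z le_rfl le_rfl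
    have : K' = K'' := by
      rcases abs_eq_abs.1 (hK'.trans hK''.symm) with h | h
      · exact h
      · subst h
        exfalso
        have h0 : z.im * K'' = 0 := by linarith
        rcases mul_eq_zero.1 h0 with h | h
        · exact hz h
        · rw [h, abs_zero] at hK''
          exact hK.ne hK''
    rw [this]
    exact hle
  have hpow : ∀ (n : ℕ) (x : Site d), Measurable fun v =>
      zeroExt R ((neumannOp R lam (clip M v) z K' ^ n) (ket R y)) x := by
    intro n
    induction n with
    | zero =>
      intro x
      simp only [pow_zero]
      exact measurable_const
    | succ n ih =>
      intro x
      by_cases hx : x ∈ R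
      · simp only [pow_succ', mul_apply_eq_comp,
          fun v => zeroExt_neumannOp (exists_clip_bound hM v) lam z K'
            ((neumannOp R lam (clip M v) z K' ^ n) (ket R y)) hx]
        have hclip : Measurable fun v : Site d → ℝ => ((clip M v x : ℝ) : ℂ) :=
          Complex.measurable_ofReal.comp
            (measurable_const.max (measurable_const.min (measurable_pi_apply x)))
        have hsum : Measurable fun v => ∑ e ∈ steps d,
            zeroExt R ((neumannOp R lam (clip M v) z K' ^ n) (ket R y)) (x + e) :=
          Finset.measurable_fun_sum _ fun e _ => ih (x + e)
        exact ((((hclip.const_mul _).const_add _).sub_const _).mul (ih x)).sub hsum |>.const_mul _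
      · simp only [fun v => zeroExt_notMem
          ((neumannOp R lam (clip M v) z K' ^ (n + 1)) (ket R y)) hx]
        exact measurable_const
  refine measurable_of_tendsto_metrizable (f := fun n v => ∑ k ∈ Finset.range n,
    -(((z.im + K' : ℝ) : ℂ) * Complex.I)⁻¹ *
      zeroExt R ((neumannOp R lam (clip M v) z K' ^ k) (ket R y)) x)
    (fun n => Finset.measurable_fun_sum _ fun k _ => (hpow k x).const_mul _) ?_
  rw [tendsto_pi_nhds]
  intro v
  exact (hasSum_green (exists_clip_bound hM v) hz hs ((hle v).trans_lt hq1) x y).tendsto_sum_nat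

end Anderson
end

noncomputable section

namespace Anderson

variable {d : ℕ} {R : Set (Site d)}

/-! ### Dependence of the Green function on the potential at one or two sites -/

/-- The difference of the two columns is annihilated by `H - z` up to a source supported on `S`,
where the potentials differ: the second resolvent identity. -/
lemma green_resolvent {v v₀ : Site d → ℝ} (hv : ∃ M, ∀ x, |v x| ≤ M) (hv₀ : ∃ M, ∀ x, |v₀ x| ≤ M)
    (lam : ℝ) {z : ℂ} (hz : z.im ≠ 0) (S : Finset (Site d)) (hS : ∀ q ∉ S, v q = v₀ q)
    (x : Site d) {y : Site d} (hy : y ∈ R) :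
    green R lam v₀ z x y = green R lam v z x y
      + ∑ q ∈ S, lam * (v q - v₀ q) * green R lam v₀ z q y * green R lam v z x q := by
  have hu := isUnit_hamiltonian_sub (R := R) hv lam hz
  have hu₀ := isUnit_hamiltonian_sub (R := R) hv₀ lam hz
  have h := zeroExt_eq_sum_green hv hu (greenCol R lam v₀ z y - greenCol R lam v z y) S
    (fun q => lam * (v q - v₀ q) * green R lam v₀ z q y) ?_ x
  · rw [map_sub, Pi.sub_apply, ← green_eq, ← green_eq] at h
    rw [← h]
    ring
  · intro q hq
    simp only [map_sub, Pi.sub_apply, ← green_eq, Finset.sum_sub_distrib]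
    have h1 := green_equation hv hu hq hy
    have h2 := green_equation hv₀ hu₀ hq hy
    by_cases hqS : q ∈ S
    · rw [if_pos hqS]
      linear_combination h2 - h1
    · rw [if_neg hqS]
      rw [hS q hqS] at h1 ⊢
      linear_combination h2 - h1

/-- The quadratic form of `H` is real, so only `z` contributes; for non-real `z` this is a
quantitative form of injectivity. -/
lemma im_inner_sub (lam : ℝ) {v : Site d → ℝ} (hv : ∃ M, ∀ x, |v x| ≤ M) (z : ℂ) (u : L2 R) :
    (inner ℂ u ((hamiltonian R lam v - z • (1 : L2 R →L[ℂ] L2 R)) u)).im = -z.im * ‖u‖ ^ 2 := by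
  change (inner ℂ u (hamiltonian R lam v u - z • u)).im = _
  have hre : (inner ℂ u (hamiltonian R lam v u)).im = 0 := by
    have h := inner_conj_symm (𝕜 := ℂ) u (hamiltonian R lam v u)
    rw [inner_hamiltonian hv] at h
    exact Complex.conj_eq_iff_im.1 h
  rw [inner_sub_right, inner_smul_right, inner_self_eq_norm_sq_to_K, Complex.sub_im, hre,
    Complex.mul_im]
  have h1 : (((‖u‖ : ℂ)) ^ 2).im = 0 := by rw [← Complex.ofReal_pow, Complex.ofReal_im]
  have h2 : (((‖u‖ : ℂ)) ^ 2).re = ‖u‖ ^ 2 := by rw [← Complex.ofReal_pow, Complex.ofReal_re]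
  change 0 - (z.re * (((‖u‖ : ℂ)) ^ 2).im + z.im * (((‖u‖ : ℂ)) ^ 2).re) = _
  rw [h1, h2]
  ring

/-- The restriction of the resolvent to finitely many sites is injective. -/
lemma sum_green_injective {v : Site d → ℝ} (hv : ∃ M, ∀ x, |v x| ≤ M) (lam : ℝ) {z : ℂ}
    (hz : z.im ≠ 0) (S : Finset (Site d)) (hS : ∀ q ∈ S, q ∈ R) (c : Site d → ℂ)
    (hc : ∀ x ∈ S, ∑ q ∈ S, c q * green R lam v z x q = 0) : ∀ q ∈ S, c q = 0 := by
  classical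
  have hu := isUnit_hamiltonian_sub (R := R) hv lam hz
  set u : L2 R := ∑ q ∈ S, c q • greenCol R lam v z q with hudef
  have hAu : (hamiltonian R lam v - z • (1 : L2 R →L[ℂ] L2 R)) u = ∑ q ∈ S, c q • ket R q := by
    rw [hudef, map_sum]
    exact Finset.sum_congr rfl fun q _ => by rw [map_smul, sub_greenCol hu]
  have hux : ∀ x ∈ S, zeroExt R u x = 0 := by
    intro x hx
    rw [hudef, map_sum, Finset.sum_apply, ← hc x hx]
    exact Finset.sum_congr rfl fun q _ => by rw [map_smul, Pi.smul_apply, smul_eq_mul, green_eq]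
  have hin : inner ℂ u (∑ q ∈ S, c q • ket R q) = 0 := by
    rw [inner_sum]
    refine Finset.sum_eq_zero fun q hq => ?_
    rw [inner_smul_right, ← inner_conj_symm, inner_ket, hux q hq, map_zero, mul_zero]
  have h := im_inner_sub lam hv z u
  rw [hAu, hin, Complex.zero_im] at h
  have hu0 : u = 0 := by
    have : ‖u‖ ^ 2 = 0 := by
      rcases mul_eq_zero.1 h.symm with h | h
      · exact absurd (neg_eq_zero.1 h) hz
      · exact h
    exact norm_eq_zero.1 (pow_eq_zero_iff (by norm_num) |>.1 this)
  rw [hu0, map_zero] at hAu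
  intro q hq
  have h2 := congrFun (congrArg (zeroExt R) hAu) q
  rw [map_zero, map_sum, Finset.sum_apply, Finset.sum_eq_single q] at h2
  · rw [map_smul, Pi.smul_apply, zeroExt_ket (hS q hq), if_pos rfl, smul_eq_mul, mul_one] at h2
    exact h2.symm
  · intro w hw hne
    rw [map_smul, Pi.smul_apply, zeroExt_ket (hS w hw), if_neg hne.symm, smul_zero]
  · exact fun h => absurd hq h

lemma green_self_ne_zero {v : Site d → ℝ} (hv : ∃ M, ∀ x, |v x| ≤ M) (lam : ℝ) {z : ℂ}
    (hz : z.im ≠ 0) {x : Site d} (hx : x ∈ R) : green R lam v z x x ≠ 0 := by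
  intro h
  have := sum_green_injective (R := R) hv lam hz {x} (by simpa using hx) (fun _ => 1)
    (by simpa using h) x (by simp)
  exact one_ne_zero this

/-- The diagonal Green function as a function of the potential at `x`. -/
lemma norm_green_self_eq {v : Site d → ℝ} (hv : ∃ M, ∀ x, |v x| ≤ M) {lam : ℝ} (hlam : 0 < lam)
    {z : ℂ} (hz : z.im ≠ 0) {x : Site d} (hx : x ∈ R) :
    ∃ b : ℂ, ∀ v' : Site d → ℝ, (∃ M, ∀ x, |v' x| ≤ M) → (∀ q, q ≠ x → v' q = v q) →
      ‖green R lam v' z x x‖ = lam⁻¹ * ‖(v' x : ℂ) + b‖⁻¹ := by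
  have h0 := green_self_ne_zero hv lam hz hx
  -- Rank-one perturbation: `1 / G` is affine in the potential at `x`, with slope `λ`.
  refine ⟨(lam * green R lam v z x x)⁻¹ - v x, fun v' hv' h => ?_⟩
  have h1 := green_resolvent hv' hv lam hz {x} (by simpa using h) x hx
  rw [Finset.sum_singleton] at h1
  set g := green R lam v' z x x
  set g₀ := green R lam v z x x
  have hl : (lam : ℂ) ≠ 0 := by exact_mod_cast hlam.ne'
  have h2 : g * (lam * ((v' x : ℂ) + ((lam * g₀)⁻¹ - v x))) = 1 := by
    field_simp
    linear_combination -h1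
  have h3 : g = (lam * ((v' x : ℂ) + ((lam * g₀)⁻¹ - v x)))⁻¹ := eq_inv_of_mul_eq_one_left h2
  rw [h3, norm_inv, norm_mul, Complex.norm_real, Real.norm_of_nonneg hlam.le, mul_inv]

/-- The Green function `G(x, y)`, `x ≠ y`, as a function of the potential at `x` and `y`. -/
lemma norm_green_eq {v : Site d → ℝ} (hv : ∃ M, ∀ x, |v x| ≤ M) {lam : ℝ} (hlam : 0 < lam)
    {z : ℂ} (hz : z.im ≠ 0) {x y : Site d} (hx : x ∈ R) (hy : y ∈ R) (hxy : x ≠ y) :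
    ∃ b₁ b₂ p : ℂ, ∀ v' : Site d → ℝ, (∃ M, ∀ x, |v' x| ≤ M) →
      (∀ q, q ≠ x → q ≠ y → v' q = v q) →
      ‖green R lam v' z x y‖
        = lam⁻¹ * (‖p‖ * ‖((v' x : ℂ) + b₁) * ((v' y : ℂ) + b₂) - p ^ 2‖⁻¹) := by
  set a := green R lam v z x x with ha
  set b := green R lam v z y y with hb
  set p := green R lam v z x y with hp
  have hp' : green R lam v z y x = p := green_symm hv (isUnit_hamiltonian_sub hv lam hz) y x
  have ha0 : a ≠ 0 := green_self_ne_zero hv lam hz hx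
  have hb0 : b ≠ 0 := green_self_ne_zero hv lam hz hy
  have hΔ : a * b - p ^ 2 ≠ 0 := by
    intro h
    -- If the determinant vanished, `(p, -a)` would lie in the kernel of the two-by-two Green
    -- matrix.
    have := sum_green_injective (R := R) hv lam hz {x, y} (by simp [hx, hy])
      (fun q => if q = x then p else -a) (by
        intro w hw
        rw [Finset.sum_pair hxy]
        simp only [Finset.mem_insert, Finset.mem_singleton] at hw
        rw [if_pos rfl, if_neg hxy.symm]
        rcases hw with rfl | rfl
        · rw [← ha, ← hp]
          ring
        · rw [hp', ← hb]
          linear_combination -h) y (by simp)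
    rw [if_neg hxy.symm] at this
    exact ha0 (neg_eq_zero.1 this)
  set Δ := a * b - p ^ 2 with hΔdef
  have hl : (lam : ℂ) ≠ 0 := by exact_mod_cast hlam.ne'
  -- These are the entries of the inverse of `λ` times the two-by-two Green matrix. The sign of the
  -- off-diagonal entry is immaterial, since it enters only through its norm and its square.
  refine ⟨b / (lam * Δ) - v x, a / (lam * Δ) - v y, p / (lam * Δ), fun v' hv' h => ?_⟩
  have hS : ∀ q ∉ ({x, y} : Finset (Site d)), v' q = v q := by
    intro q hq
    simp only [Finset.mem_insert, Finset.mem_singleton, not_or] at hq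
    exact h q hq.1 hq.2
  have h1 := green_resolvent hv' hv lam hz {x, y} hS x hy
  have h2 := green_resolvent hv' hv lam hz {x, y} hS x hx
  have h3 := green_resolvent hv' hv lam hz {x, y} hS y hy
  rw [Finset.sum_pair hxy] at h1 h2 h3
  rw [hp'] at h2
  rw [← hp, ← hb] at h1 h3
  rw [← ha] at h2
  set X := green R lam v' z x y
  set Y := green R lam v' z x x
  set α : ℂ := (v' x : ℂ) - v x with hα
  set β : ℂ := (v' y : ℂ) - v y with hβ
  have e1 : (v' x : ℂ) + (b / (lam * Δ) - v x) = α + b / (lam * Δ) := by rw [hα]; ring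
  have e2 : (v' y : ℂ) + (a / (lam * Δ) - v y) = β + a / (lam * Δ) := by rw [hβ]; ring
  rw [e1, e2]
  -- Nonvanishing of the denominator is deduced below from `p ≠ 0`; if `p = 0` both sides are zero.
  by_cases hp0 : p = 0
  · rw [hp0] at h1 h3 ⊢
    have hX : X * (1 + lam * β * b) = 0 := by linear_combination -h1
    have hne : 1 + lam * β * b ≠ 0 := by
      intro h0
      refine hb0 ?_
      rw [h3]
      linear_combination green R lam v' z y y * h0
    rcases mul_eq_zero.1 hX with h0 | h0
    · simp [h0]
    · exact absurd h0 hne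
  · have hD : X * ((1 + lam * α * a) * (1 + lam * β * b) - lam ^ 2 * α * β * p ^ 2) = p := by
      linear_combination -(1 + lam * α * a) * h1 + lam * α * p * h2
    have hmul : X * (lam * ((α + b / (lam * Δ)) * (β + a / (lam * Δ)) - (p / (lam * Δ)) ^ 2))
        = p / (lam * Δ) := by
      have : lam * ((α + b / (lam * Δ)) * (β + a / (lam * Δ)) - (p / (lam * Δ)) ^ 2)
          = ((1 + lam * α * a) * (1 + lam * β * b) - lam ^ 2 * α * β * p ^ 2) / (lam * Δ) := by
        field_simp
        rw [hΔdef]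
        ring
      rw [this, ← mul_div_assoc, hD]
    have hne : lam * ((α + b / (lam * Δ)) * (β + a / (lam * Δ)) - (p / (lam * Δ)) ^ 2) ≠ 0 := by
      intro h0
      rw [h0, mul_zero] at hmul
      exact div_ne_zero hp0 (mul_ne_zero hl hΔ) hmul.symm
    have hX := eq_div_of_mul_eq hne hmul
    rw [hX, norm_div, norm_mul (lam : ℂ), Complex.norm_real, Real.norm_of_nonneg hlam.le,
      div_eq_mul_inv, mul_inv]
    ring

/-! ### Geometric resolvent identities -/

lemma sum_bonds {A : Type*} [AddCommMonoid A] (Λ : Finset (Site d)) (F : Site d → Site d → A) :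
    ∑ b ∈ bonds Λ, F b.1 b.2
      = ∑ q ∈ Λ, ∑ e ∈ steps d, if q + e ∈ Λ then 0 else F q (q + e) := by
  rw [bonds, Finset.sum_filter, Finset.sum_image, Finset.sum_product]
  · refine Finset.sum_congr rfl fun q _ => Finset.sum_congr rfl fun e _ => ?_
    by_cases h : q + e ∈ Λ <;> simp [h]
  · rintro ⟨q, e⟩ - ⟨q', e'⟩ - h
    simp only [Prod.mk.injEq] at h
    obtain ⟨rfl, h⟩ := h
    simpa using h

lemma mem_bonds {Λ : Finset (Site d)} {b : Site d × Site d} :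
    b ∈ bonds Λ ↔ b.1 ∈ Λ ∧ b.2 ∉ Λ ∧ ∃ e ∈ steps d, b.2 = b.1 + e := by
  simp only [bonds, Finset.mem_filter, Finset.mem_image, Finset.mem_product, Prod.exists]
  constructor
  · rintro ⟨⟨q, e, ⟨hq, he⟩, rfl⟩, h⟩
    exact ⟨hq, h, e, he, rfl⟩
  · rintro ⟨h1, h2, e, he, h3⟩
    exact ⟨⟨b.1, e, ⟨h1, he⟩, by rw [← h3]⟩, h2⟩

/-- Summation by parts on a finite set. -/
lemma sum_sub_eq_sum_bonds (Λ : Finset (Site d)) (f h : Site d → ℂ) (hf : ∀ q ∉ Λ, f q = 0) :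
    ∑ q ∈ Λ, (f q * ∑ e ∈ steps d, h (q + e) - h q * ∑ e ∈ steps d, f (q + e))
      = ∑ b ∈ bonds Λ, f b.1 * h b.2 := by
  rw [sum_bonds Λ fun q q' => f q * h q', Finset.sum_sub_distrib, sub_eq_iff_eq_add]
  have key : ∑ q ∈ Λ, h q * ∑ e ∈ steps d, f (q + e)
      = ∑ q ∈ Λ, ∑ e ∈ steps d, if q + e ∈ Λ then f q * h (q + e) else 0 := by
    have h1 : ∀ q ∈ Λ, h q * ∑ e ∈ steps d, f (q + e)
        = ∑ e ∈ steps d, if q + e ∈ Λ then h q * f (q + e) else 0 := by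
      intro q _
      rw [Finset.mul_sum]
      refine Finset.sum_congr rfl fun e _ => ?_
      by_cases hq : q + e ∈ Λ
      · rw [if_pos hq]
      · rw [if_neg hq, hf _ hq, mul_zero]
    rw [Finset.sum_congr rfl h1, ← Finset.sum_product', ← Finset.sum_product',
      ← Finset.sum_filter (fun p : Site d × Site d => p.1 + p.2 ∈ Λ)
        (fun p => h p.1 * f (p.1 + p.2)),
      ← Finset.sum_filter (fun p : Site d × Site d => p.1 + p.2 ∈ Λ)
        (fun p => f p.1 * h (p.1 + p.2))]
    have hmaps : ∀ p ∈ (Λ ×ˢ steps d).filter (fun p : Site d × Site d => p.1 + p.2 ∈ Λ),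
        ((p.1 + p.2, -p.2) : Site d × Site d)
          ∈ (Λ ×ˢ steps d).filter (fun p : Site d × Site d => p.1 + p.2 ∈ Λ) := by
      intro p hp
      simp only [Finset.mem_filter, Finset.mem_product] at hp ⊢
      exact ⟨⟨hp.2, neg_mem_steps hp.1.2⟩, by simpa using hp.1.1⟩
    -- Interior oriented bonds are reversed: `(q, e)` goes to `(q + e, -e)`, so only boundary bonds
    -- survive in the difference.
    refine Finset.sum_nbij' (fun p => (p.1 + p.2, -p.2)) (fun p => (p.1 + p.2, -p.2)) hmaps hmaps
      (fun p _ => by simp) (fun p _ => by simp) (fun p _ => ?_)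
    simp [mul_comm]
  rw [key, ← Finset.sum_add_distrib]
  refine Finset.sum_congr rfl fun q _ => ?_
  rw [← Finset.sum_add_distrib, Finset.mul_sum]
  refine Finset.sum_congr rfl fun e _ => ?_
  by_cases hq : q + e ∈ Λ <;> simp [hq]

/-- The geometric resolvent identity. -/
lemma green_eq_sum_bonds {v : Site d → ℝ} (hv : ∃ M, ∀ x, |v x| ≤ M) (lam : ℝ) {z : ℂ}
    (hz : z.im ≠ 0) (W : Finset (Site d)) (hW : ∀ q ∈ W, q ∈ R) {x y : Site d} (hx : x ∈ W)
    (hy : y ∈ R) (hyW : y ∉ W) :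
    green R lam v z x y = ∑ b ∈ bonds W, green (W : Set (Site d)) lam v z x b.1
      * green R lam v z b.2 y := by
  have hu := isUnit_hamiltonian_sub (R := R) hv lam hz
  have huW := isUnit_hamiltonian_sub (R := (W : Set (Site d))) hv lam hz
  simp only [green_symm hv huW x]
  rw [← sum_sub_eq_sum_bonds W (fun q => green (W : Set (Site d)) lam v z q x)
    (fun q => green R lam v z q y) (fun q hq => green_left_notMem _ _ _ (by simpa using hq) _)]
  -- This is the Wronskian of two solutions: cross-multiplying the equations for `G_W` and `G_R`
  -- cancels the diagonal terms and leaves the source at `x`, as `y` is outside `W`.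
  have : ∀ q ∈ W, green (W : Set (Site d)) lam v z q x * ∑ e ∈ steps d, green R lam v z (q + e) y
      - green R lam v z q y * ∑ e ∈ steps d, green (W : Set (Site d)) lam v z (q + e) x
      = if q = x then green R lam v z q y else 0 := by
    intro q hq
    have h1 := green_equation (R := (W : Set (Site d))) hv huW (Finset.mem_coe.2 hq)
      (Finset.mem_coe.2 hx)
    have h2 := green_equation hv hu (hW q hq) hy
    rw [if_neg (fun h : q = y => hyW (h ▸ hq))] at h2
    have h3 : (if q = x then green R lam v z q y else 0)
        = green R lam v z q y * if q = x then 1 else 0 := by split_ifs <;> simp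
    rw [h3, ← h1]
    linear_combination -green (W : Set (Site d)) lam v z q x * h2
  rw [Finset.sum_congr rfl this, Finset.sum_ite_eq' W x, if_pos hx]

/-! ### The collar of a finite set and comparison of Green functions across it -/

/-- The outer boundary of a finite set. -/
def outerBoundary (W : Finset (Site d)) : Finset (Site d) := (bonds W).image Prod.snd

/-- The sites outside of `W` which can be reached from `W` by at most two steps. -/
def collar (W : Finset (Site d)) : Finset (Site d) :=
  (outerBoundary W ∪ (outerBoundary W ×ˢ steps d).image fun p => p.1 + p.2) \ W

lemma outerBoundary_subset_collar (W : Finset (Site d)) : outerBoundary W ⊆ collar W := by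
  intro q hq
  refine Finset.mem_sdiff.2 ⟨Finset.mem_union_left _ hq, ?_⟩
  obtain ⟨b, hb, rfl⟩ := Finset.mem_image.1 hq
  exact (mem_bonds.1 hb).2.1

lemma add_mem_outerBoundary {W : Finset (Site d)} {q e : Site d} (hq : q ∈ W) (he : e ∈ steps d)
    (h : q + e ∉ W) : q + e ∈ outerBoundary W :=
  Finset.mem_image.2 ⟨(q, q + e), mem_bonds.2 ⟨hq, h, e, he, rfl⟩, rfl⟩

lemma add_notMem_of_notMem_collar {W : Finset (Site d)} {q e : Site d} (hq : q ∉ W)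
    (hq' : q ∉ collar W) (he : e ∈ steps d) : q + e ∉ W ∧ q + e ∉ outerBoundary W := by
  have hneg : q = q + e + -e := by simp
  constructor
  · intro h
    refine hq' (outerBoundary_subset_collar W ?_)
    rw [hneg]
    exact add_mem_outerBoundary h (neg_mem_steps he) (by rwa [← hneg])
  · intro h
    refine hq' (Finset.mem_sdiff.2 ⟨Finset.mem_union_right _ ?_, hq⟩)
    exact Finset.mem_image.2 ⟨(q + e, -e), Finset.mem_product.2 ⟨h, neg_mem_steps he⟩, hneg.symm⟩

lemma card_collar_le (W : Finset (Site d)) :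
    (collar W).card ≤ (1 + 2 * d) * (bonds W).card := by
  have h1 : (outerBoundary W).card ≤ (bonds W).card := Finset.card_image_le
  calc (collar W).card ≤ (outerBoundary W).card + ((outerBoundary W) ×ˢ steps d).card :=
        (Finset.card_le_card Finset.sdiff_subset).trans
          ((Finset.card_union_le _ _).trans (Nat.add_le_add_left Finset.card_image_le _))
    _ ≤ (bonds W).card + (bonds W).card * (2 * d) := by
        rw [Finset.card_product]
        exact add_le_add h1 (Nat.mul_le_mul h1 card_steps_le)
    _ = _ := by ring

/-- Comparison of two Green functions whose potentials agree outside of `W` and its collar. -/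
lemma norm_green_le_sum_collar {v v' : Site d → ℝ} (hv : ∃ M, ∀ x, |v x| ≤ M)
    (hv' : ∃ M, ∀ x, |v' x| ≤ M) (lam : ℝ) {z : ℂ} (hz : z.im ≠ 0) (W : Finset (Site d))
    (hvv' : ∀ q, q ∉ W → q ∉ collar W → v q = v' q) {a y : Site d} (ha : a ∈ outerBoundary W)
    (hy : y ∈ R) (hyW : y ∉ W) (hyF : y ∉ outerBoundary W) :
    ‖green R lam v z a y‖ ≤ ∑ q ∈ collar W, ‖green R lam v z a q‖ *
      (|lam| * |v q - v' q| * ‖green R lam v' z q y‖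
        + ∑ e ∈ steps d, ‖green R lam v' z (q + e) y‖) := by
  classical
  have hu := isUnit_hamiltonian_sub (R := R) hv lam hz
  have hu' := isUnit_hamiltonian_sub (R := R) hv' lam hz
  set ψ : Site d → ℂ := fun q => green R lam v' z q y with hψ
  -- The column for `v'` is set to zero on `W` and its outer boundary. Then `(H_v - z) φ - δ_y` is
  -- supported in the collar: inside `W` the vector and its neighbours vanish, and off `W` and the
  -- collar the two equations coincide. Since `φ(a) = 0`, the Green function at `a` is recovered
  -- entirely from these errors.
  set φ : L2 R := greenCol R lam v' z y - ∑ q ∈ W ∪ outerBoundary W, ψ q • ket R q with hφ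
  have hφx : ∀ q, zeroExt R φ q = if q ∈ W ∪ outerBoundary W then 0 else ψ q := by
    intro q
    rw [hφ, map_sub, Pi.sub_apply, ← green_eq, map_sum, Finset.sum_apply]
    have : ∀ w ∈ W ∪ outerBoundary W, zeroExt R (ψ w • ket R w) q = if q = w then ψ w else 0 := by
      intro w _
      rw [map_smul, Pi.smul_apply, smul_eq_mul]
      by_cases hw : w ∈ R
      · rw [zeroExt_ket hw]
        simp
      · simp only [hψ, green_left_notMem _ _ _ hw, zero_mul, ite_self]
    rw [Finset.sum_congr rfl this, Finset.sum_ite_eq]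
    by_cases hq : q ∈ W ∪ outerBoundary W
    · rw [if_pos hq, if_pos hq, hψ, sub_self]
    · rw [if_neg hq, if_neg hq, hψ, sub_zero]
  have hφle : ∀ q, ‖zeroExt R φ q‖ ≤ ‖ψ q‖ := by
    intro q
    rw [hφx]
    split_ifs <;> simp
  have hφle' : ∀ q, ‖ψ q - zeroExt R φ q‖ ≤ ‖ψ q‖ := by
    intro q
    rw [hφx]
    split_ifs <;> simp
  set c : Site d → ℂ := fun q => (2 * d + lam * v q - z) * zeroExt R φ q
    - ∑ e ∈ steps d, zeroExt R φ (q + e) - if q = y then 1 else 0 with hc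
  have hψeq : ∀ q ∈ R, (2 * d + lam * v' q - z) * ψ q - ∑ e ∈ steps d, ψ (q + e)
      = if q = y then 1 else 0 := fun q hq => green_equation hv' hu' hq hy
  have hrep := zeroExt_eq_sum_green hv hu (φ - greenCol R lam v z y) (collar W) c ?_ a
  · rw [map_sub, Pi.sub_apply, ← green_eq, hφx, if_pos (Finset.mem_union_right _ ha), zero_sub]
      at hrep
    rw [← norm_neg, hrep]
    refine norm_sum_le_of_le _ fun q hq => ?_
    by_cases hqR : q ∈ R
    · rw [norm_mul, mul_comm]
      refine mul_le_mul_of_nonneg_left ?_ (norm_nonneg _)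
      have hqW : q ∉ W := (Finset.mem_sdiff.1 hq).2
      by_cases hqF : q ∈ outerBoundary W
      · have hqy : q ≠ y := fun h => hyF (h ▸ hqF)
        rw [hc]
        simp only [if_neg hqy]
        rw [hφx q, if_pos (Finset.mem_union_right _ hqF), mul_zero, zero_sub, sub_zero, norm_neg]
        have h1 := norm_sum_le_of_le (steps d) fun e _ => hφle (q + e)
        have h2 : 0 ≤ |lam| * |v q - v' q| * ‖green R lam v' z q y‖ := by positivity
        exact h1.trans (le_add_of_nonneg_left h2)
      · have hφq : zeroExt R φ q = ψ q := by
          rw [hφx, if_neg]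
          rw [Finset.mem_union]
          exact fun h => h.elim hqW hqF
        have h1 : c q = lam * (v q - v' q) * ψ q
            + ∑ e ∈ steps d, (ψ (q + e) - zeroExt R φ (q + e)) := by
          rw [hc]
          simp only
          rw [hφq, ← hψeq q hqR, Finset.sum_sub_distrib]
          ring
        rw [h1]
        refine (norm_add_le _ _).trans (add_le_add (le_of_eq ?_)
          (norm_sum_le_of_le _ fun e _ => hφle' (q + e)))
        rw [norm_mul, norm_mul, ← Complex.ofReal_sub, Complex.norm_real, Complex.norm_real]
        rfl
    · rw [green_right_notMem _ _ _ _ hqR]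
      simp
  · intro q hq
    have h1 := green_equation hv hu hq hy
    simp only [map_sub, Pi.sub_apply, ← green_eq, Finset.sum_sub_distrib]
    by_cases hqQ : q ∈ collar W
    · rw [if_pos hqQ, hc]
      simp only
      rw [← h1]
      ring
    · rw [if_neg hqQ]
      suffices h : (2 * d + lam * v q - z) * zeroExt R φ q
          - ∑ e ∈ steps d, zeroExt R φ (q + e) = if q = y then 1 else 0 by
        linear_combination h - h1
      by_cases hqW : q ∈ W
      · rw [hφx q, if_pos (Finset.mem_union_left _ hqW), if_neg (fun h : q = y => hyW (h ▸ hqW)),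
          mul_zero, zero_sub, neg_eq_zero]
        refine Finset.sum_eq_zero fun e he => ?_
        rw [hφx, if_pos]
        by_cases h : q + e ∈ W
        · exact Finset.mem_union_left _ h
        · exact Finset.mem_union_right _ (add_mem_outerBoundary hqW he h)
      · have hφq : zeroExt R φ q = ψ q := by
          rw [hφx, if_neg]
          rw [Finset.mem_union]
          exact fun h => h.elim hqW fun h => hqQ (outerBoundary_subset_collar W h)
        rw [hφq, ← hψeq q hq, hvv' q hqW hqQ]
        congr 1
        refine Finset.sum_congr rfl fun e he => ?_
        have := add_notMem_of_notMem_collar hqW hqQ he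
        rw [hφx, if_neg]
        rw [Finset.mem_union]
        exact fun h => h.elim this.1 this.2

/-! ### Translations -/

/-- The translated column solves the equation that characterizes the column for the shifted
potential. -/
lemma green_translate {v : Site d → ℝ} (hv : ∃ M, ∀ x, |v x| ≤ M) (lam : ℝ) {z : ℂ}
    (hz : z.im ≠ 0) (Λ : Finset (Site d)) (x : Site d) (a : Site d) {b : Site d} (hb : b ∈ Λ) :
    green ((Λ.image (x + ·) : Finset (Site d)) : Set (Site d)) lam v z (x + a) (x + b)
      = green (Λ : Set (Site d)) lam (fun q => v (x + q)) z a b := by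
  classical
  have hv' : ∃ M, ∀ q, |v (x + q)| ≤ M := hv.imp fun M h q => h _
  set R' : Set (Site d) := ((Λ.image (x + ·) : Finset (Site d)) : Set (Site d)) with hR'
  have hmem : ∀ q, x + q ∈ R' ↔ q ∈ Λ := by
    intro q
    simp [hR']
  have hu' := isUnit_hamiltonian_sub (R := R') hv lam hz
  set g : Site d → ℂ := fun q => green R' lam v z (x + q) (x + b) with hg
  have hg0 : ∀ q ∉ Λ, g q = 0 := fun q hq =>
    green_left_notMem _ _ _ (fun h => hq ((hmem q).1 h)) _
  have hsum : ∀ q, zeroExt (Λ : Set (Site d)) (∑ w ∈ Λ, g w • ket (Λ : Set (Site d)) w) q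
      = g q := by
    intro q
    rw [map_sum, Finset.sum_apply]
    have : ∀ w ∈ Λ, zeroExt (Λ : Set (Site d)) (g w • ket (Λ : Set (Site d)) w) q
        = if q = w then g w else 0 := by
      intro w hw
      rw [map_smul, Pi.smul_apply, smul_eq_mul, zeroExt_ket (Finset.mem_coe.2 hw)]
      simp
    rw [Finset.sum_congr rfl this, Finset.sum_ite_eq]
    by_cases hq : q ∈ Λ
    · rw [if_pos hq]
    · rw [if_neg hq, hg0 q hq]
  have h := zeroExt_eq_sum_green hv' (isUnit_hamiltonian_sub (R := (Λ : Set (Site d))) hv' lam hz)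
    (∑ w ∈ Λ, g w • ket (Λ : Set (Site d)) w) {b} (fun _ => 1) ?_ a
  · rw [hsum, Finset.sum_singleton, one_mul] at h
    exact h
  · intro q hq
    simp only [hsum, Finset.mem_singleton]
    have h1 := green_equation hv hu' ((hmem q).2 (Finset.mem_coe.1 hq)) ((hmem b).2 hb)
    simp only [add_right_inj] at h1
    simp only [hg]
    simp only [← add_assoc]
    exact h1

lemma sum_bonds_translate {A : Type*} [AddCommMonoid A] (Λ : Finset (Site d)) (x : Site d)
    (F : Site d → Site d → A) :
    ∑ b ∈ bonds (Λ.image (x + ·)), F b.1 b.2 = ∑ b ∈ bonds Λ, F (x + b.1) (x + b.2) := by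
  rw [sum_bonds, sum_bonds Λ fun p q => F (x + p) (x + q),
    Finset.sum_image fun _ _ _ _ h => add_left_cancel h]
  refine Finset.sum_congr rfl fun q _ => Finset.sum_congr rfl fun e _ => ?_
  have : x + (q + e) ∈ Λ.image (x + ·) ↔ q + e ∈ Λ := by simp
  simp only [add_assoc, this]

lemma card_bonds_translate (Λ : Finset (Site d)) (x : Site d) :
    (bonds (Λ.image (x + ·))).card = (bonds Λ).card := by
  rw [Finset.card_eq_sum_ones, Finset.card_eq_sum_ones]
  exact sum_bonds_translate Λ x fun _ _ => 1

end Anderson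
end

noncomputable section

namespace Anderson

variable {d : ℕ} {R : Set (Site d)}

/-! ### Averages over the potential at one or two sites -/

/-- The distribution of the potential: the product of copies of `μ`. -/
abbrev potLaw (d : ℕ) (μ : Measure ℝ) [IsProbabilityMeasure μ] : Measure (Site d → ℝ) :=
  Measure.infinitePi fun _ : Site d => μ

section resampling

variable (μ : Measure ℝ) [IsProbabilityMeasure μ]

lemma measurable_piecewise (D : Finset (Site d)) :
    Measurable fun p : (Site d → ℝ) × (Site d → ℝ) => D.piecewise p.1 p.2 := by
  refine measurable_pi_lambda _ fun x => ?_
  by_cases h : x ∈ D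
  · simp only [Finset.piecewise, if_pos h]
    exact (measurable_pi_apply x).comp measurable_fst
  · simp only [Finset.piecewise, if_neg h]
    exact (measurable_pi_apply x).comp measurable_snd

/-- Splitting the coordinates of a cylinder set into those in `D` and those outside factorizes its
measure, and cylinders determine the product law. -/
lemma map_piecewise (D : Finset (Site d)) :
    ((potLaw d μ).prod (potLaw d μ)).map (fun p => D.piecewise p.1 p.2) = potLaw d μ := by
  refine Measure.eq_infinitePi _ fun S t ht => ?_
  rw [Measure.map_apply (measurable_piecewise D)
    (MeasurableSet.pi S.countable_toSet fun i _ => ht i)]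
  have : (fun p : (Site d → ℝ) × (Site d → ℝ) => D.piecewise p.1 p.2) ⁻¹' (Set.pi S t)
      = (Set.pi (S.filter (· ∈ D) : Finset (Site d)) t)
        ×ˢ (Set.pi (S.filter (· ∉ D) : Finset (Site d)) t) := by
    ext p
    simp only [Set.mem_preimage, Set.mem_pi, Set.mem_prod, Finset.mem_coe, Finset.mem_filter]
    constructor
    · intro h
      refine ⟨fun i hi => ?_, fun i hi => ?_⟩
      · have := h i hi.1
        rwa [Finset.piecewise_eq_of_mem _ _ _ hi.2] at this
      · have := h i hi.1
        rwa [Finset.piecewise_eq_of_notMem _ _ _ hi.2] at this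
    · intro h i hi
      by_cases hD : i ∈ D
      · rw [Finset.piecewise_eq_of_mem _ _ _ hD]
        exact h.1 i ⟨hi, hD⟩
      · rw [Finset.piecewise_eq_of_notMem _ _ _ hD]
        exact h.2 i ⟨hi, hD⟩
  rw [this, Measure.prod_prod, Measure.infinitePi_pi _ fun i _ => ht i,
    Measure.infinitePi_pi _ fun i _ => ht i]
  exact Finset.prod_filter_mul_prod_filter_not S (· ∈ D) fun i => μ (t i)

/-- The potential on a finite set may be replaced by an independent copy. -/
lemma lintegral_resample (D : Finset (Site d)) {f : (Site d → ℝ) → ℝ≥0∞} (hf : Measurable f) :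
    ∫⁻ v, f v ∂potLaw d μ = ∫⁻ w, ∫⁻ v, f (D.piecewise w v) ∂potLaw d μ ∂potLaw d μ := by
  nth_rewrite 1 [← map_piecewise μ D]
  rw [lintegral_map hf (measurable_piecewise D)]
  exact lintegral_prod _ (hf.comp (measurable_piecewise D)).aemeasurable

lemma lintegral_update (x : Site d) {f : (Site d → ℝ) → ℝ≥0∞} (hf : Measurable f) :
    ∫⁻ v, f v ∂potLaw d μ = ∫⁻ v, ∫⁻ t, f (Function.update v x t) ∂μ ∂potLaw d μ := by
  rw [lintegral_resample μ {x} hf, lintegral_lintegral_swap]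
  · refine lintegral_congr fun v => ?_
    have hm : Measurable fun t => f (Function.update v x t) :=
      hf.comp (measurable_update v)
    rw [← (measurePreserving_eval_infinitePi (fun _ : Site d => μ) x).lintegral_comp hm]
    refine lintegral_congr fun w => ?_
    rw [Finset.piecewise_singleton]
  · exact (hf.comp (measurable_piecewise {x})).aemeasurable

end resampling

/-! ### One-site and two-site fractional moment bounds -/

/-- The `s`-th fractional moments of `|t + b|⁻¹` are bounded by `C`, uniformly in `b`. -/
def HasFracBound (μ : Measure ℝ) (s : ℝ) (C : ℝ≥0∞) : Prop :=
  ∀ b : ℂ, ∫⁻ t : ℝ, ENNReal.ofReal (‖(t : ℂ) + b‖⁻¹ ^ s) ∂μ ≤ C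

lemma lintegral_abs_rpow_lt_top {s : ℝ} (hs1 : s < 1) :
    ∫⁻ t in Set.Icc (-1 : ℝ) 1, ENNReal.ofReal (|t|⁻¹ ^ s) < ⊤ := by
  have h0 : ∫⁻ t in Set.Icc (0 : ℝ) 1, ENNReal.ofReal (|t|⁻¹ ^ s) < ⊤ := by
    have h := intervalIntegral.intervalIntegrable_rpow' (a := 0) (b := 1) (r := -s) (by linarith)
    rw [intervalIntegrable_iff_integrableOn_Icc_of_le zero_le_one] at h
    refine lt_of_le_of_lt (setLIntegral_mono' measurableSet_Icc fun t ht => ?_)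
      h.lintegral_lt_top
    rw [abs_of_nonneg ht.1, Real.inv_rpow ht.1, Real.rpow_neg ht.1]
  have h1 : ∫⁻ t in Set.Icc (-1 : ℝ) 0, ENNReal.ofReal (|t|⁻¹ ^ s) < ⊤ := by
    have h := (Measure.measurePreserving_neg (volume : Measure ℝ)).setLIntegral_comp_preimage_emb
      (MeasurableEquiv.neg ℝ).measurableEmbedding (fun t => ENNReal.ofReal (|t|⁻¹ ^ s))
      (Set.Icc (0 : ℝ) 1)
    simp only [abs_neg] at h
    have h2 : Neg.neg ⁻¹' Set.Icc (0 : ℝ) 1 = Set.Icc (-1) 0 := by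
      ext t
      simp only [Set.mem_preimage, Set.mem_Icc]
      constructor <;> intro h <;> constructor <;> linarith [h.1, h.2]
    rw [h2] at h
    rwa [h]
  rw [← Set.Icc_union_Icc_eq_Icc (b := 0) (by norm_num) (by norm_num)]
  exact (lintegral_union_le _ _ _).trans_lt (ENNReal.add_lt_top.2 ⟨h1, h0⟩)

/-- Replacing `b` by its real part only increases `|t + b|⁻¹`. The singular part within distance one
is bounded by the density bound times a translation-invariant Lebesgue integral; the rest is at most
one. -/
lemma exists_hasFracBound {μ : Measure ℝ} [IsProbabilityMeasure μ] {ρ : ℝ → ℝ} {m : ℝ}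
    (hρ : Measurable ρ) (hρm : ∀ t, ρ t ≤ m)
    (hμ : μ = volume.withDensity fun t => ENNReal.ofReal (ρ t)) {s : ℝ} (hs0 : 0 < s)
    (hs1 : s < 1) : ∃ C : ℝ≥0∞, C ≠ ⊤ ∧ HasFracBound μ s C := by
  set I := ∫⁻ t in Set.Icc (-1 : ℝ) 1, ENNReal.ofReal (|t|⁻¹ ^ s) with hI
  refine ⟨ENNReal.ofReal m * I + 1, ENNReal.add_ne_top.2 ⟨ENNReal.mul_ne_top
    ENNReal.ofReal_ne_top (lintegral_abs_rpow_lt_top hs1).ne, ENNReal.one_ne_top⟩, fun b => ?_⟩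
  have hac : μ ≪ volume := hμ ▸ withDensity_absolutelyContinuous _ _
  -- Since `0⁻¹ = 0`, the comparison function vanishes at its own pole, so this null point has to be
  -- excluded.
  have hne : ∀ᵐ t ∂μ, t ≠ -b.re := hac.ae_le (Measure.ae_ne volume (-b.re))
  set F : ℝ → ℝ≥0∞ := (Set.Icc (-1 : ℝ) 1).indicator fun t => ENNReal.ofReal (|t|⁻¹ ^ s) with hF
  have hFm : Measurable F := by
    refine Measurable.indicator ?_ measurableSet_Icc
    fun_prop
  calc ∫⁻ t : ℝ, ENNReal.ofReal (‖(t : ℂ) + b‖⁻¹ ^ s) ∂μ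
      ≤ ∫⁻ t : ℝ, (F (t + b.re) + 1) ∂μ := by
        refine lintegral_mono_ae (hne.mono fun t ht => ?_)
        have hpos : 0 < |t + b.re| := abs_pos.2 fun h => ht (by linarith)
        have hle : |t + b.re| ≤ ‖(t : ℂ) + b‖ := by
          have := Complex.abs_re_le_norm ((t : ℂ) + b)
          simpa using this
        by_cases h1 : |t + b.re| ≤ 1
        · rw [hF, Set.indicator_of_mem (Set.mem_Icc.2 (abs_le.1 h1))]
          refine le_add_right (ENNReal.ofReal_le_ofReal ?_)
          exact Real.rpow_le_rpow (by positivity) (inv_anti₀ hpos hle) hs0.le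
        · refine le_add_left ?_
          rw [← ENNReal.ofReal_one]
          refine ENNReal.ofReal_le_ofReal (Real.rpow_le_one (by positivity) ?_ hs0.le)
          exact inv_le_one_of_one_le₀ ((not_le.1 h1).le.trans hle)
    _ = ∫⁻ t : ℝ, F (t + b.re) ∂μ + 1 := by
        rw [lintegral_add_right _ measurable_const, lintegral_const, measure_univ, one_mul]
    _ ≤ ENNReal.ofReal m * I + 1 := by
        gcongr
        have hFb : Measurable fun t => F (t + b.re) := hFm.comp (measurable_id.add_const _)
        rw [hμ, lintegral_withDensity_eq_lintegral_mul _ hρ.ennreal_ofReal hFb]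
        calc ∫⁻ t, ENNReal.ofReal (ρ t) * F (t + b.re)
            ≤ ∫⁻ t, ENNReal.ofReal m * F (t + b.re) := by
              refine lintegral_mono fun t => ?_
              gcongr
              exact hρm t
          _ = ENNReal.ofReal m * I := by
              rw [lintegral_const_mul _ hFb,
                lintegral_add_right_eq_self F, hF, lintegral_indicator measurableSet_Icc]

/-- The two-site quotient `|p| / |(α + b₁) (β + b₂) - p²|`, to the power `s`. -/
def pairKernel (s : ℝ) (b₁ b₂ p : ℂ) (α β : ℝ) : ℝ≥0∞ :=
  ENNReal.ofReal ((‖p‖ * ‖((α : ℂ) + b₁) * ((β : ℂ) + b₂) - p ^ 2‖⁻¹) ^ s)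

lemma measurable_pairKernel (s : ℝ) (b₁ b₂ p : ℂ) :
    Measurable (Function.uncurry (pairKernel s b₁ b₂ p)) := by
  unfold pairKernel Function.uncurry
  fun_prop

lemma lintegral_const_mul_pairKernel {μ : Measure ℝ} [SFinite μ] (s : ℝ) (b₁ b₂ p : ℂ)
    (k : ℝ≥0∞) : ∫⁻ α, ∫⁻ β, k * pairKernel s b₁ b₂ p α β ∂μ ∂μ
      = k * ∫⁻ α, ∫⁻ β, pairKernel s b₁ b₂ p α β ∂μ ∂μ := by
  have h := measurable_pairKernel s b₁ b₂ p
  generalize pairKernel s b₁ b₂ p = κ at h ⊢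
  have h1 : ∀ t, Measurable fun r => κ t r := fun t => h.comp measurable_prodMk_left
  have h2 : Measurable fun t => ∫⁻ r, κ t r ∂μ := h.lintegral_prod_right'
  rw [← lintegral_const_mul _ h2]
  exact lintegral_congr fun t => lintegral_const_mul _ (h1 t)

/-- With `α` fixed, dividing the determinant by `α + b₁` makes it affine in `β` with slope one, so
the one-site bound applies. -/
lemma lintegral_pairKernel_le_of_ne {μ : Measure ℝ} {s : ℝ} {C : ℝ≥0∞} (hC : HasFracBound μ s C)
    (b₁ b₂ p : ℂ) {α : ℝ} (hα : (α : ℂ) + b₁ ≠ 0) :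
    ∫⁻ β, pairKernel s b₁ b₂ p α β ∂μ
      ≤ ENNReal.ofReal ((‖p‖ * ‖(α : ℂ) + b₁‖⁻¹) ^ s) * C := by
  have h : ∀ β : ℝ, pairKernel s b₁ b₂ p α β = ENNReal.ofReal ((‖p‖ * ‖(α : ℂ) + b₁‖⁻¹) ^ s) *
      ENNReal.ofReal (‖(β : ℂ) + (b₂ - p ^ 2 / ((α : ℂ) + b₁))‖⁻¹ ^ s) := by
    intro β
    rw [← ENNReal.ofReal_mul (by positivity), ← Real.mul_rpow (by positivity) (by positivity),
      pairKernel]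
    have : ((α : ℂ) + b₁) * ((β : ℂ) + b₂) - p ^ 2
        = ((α : ℂ) + b₁) * ((β : ℂ) + (b₂ - p ^ 2 / ((α : ℂ) + b₁))) := by
      field_simp
      ring
    rw [this, norm_mul, mul_inv, mul_assoc]
  simp only [h]
  rw [lintegral_const_mul _ (by fun_prop)]
  gcongr
  exact hC _

/-- A fractional moment bound for one site implies one for two sites. -/
lemma lintegral_pairKernel_le {μ : Measure ℝ} [IsProbabilityMeasure μ] [NullSingletonClass μ] {s : ℝ}
    (hs0 : 0 < s) (hs1 : s < 1) {C : ℝ≥0∞} (hC : HasFracBound μ s C) (b₁ b₂ p : ℂ) :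
    ∫⁻ α, ∫⁻ β, pairKernel s b₁ b₂ p α β ∂μ ∂μ ≤ C * C + (2 * C + 2 * C + 2) := by
  have htwo : (2 : ℝ) ^ s ≤ 2 := by
    simpa using Real.rpow_le_rpow_of_exponent_le (by norm_num : (1 : ℝ) ≤ 2) hs1.le
  -- For `|p| ≤ 1` the numerator may be dropped and the variables integrated in turn. For larger
  -- `|p|` the numerator is kept: where one linear factor is at least `|p| / 2`, integrating the
  -- other variable costs `2ˢ C`; where both are smaller, the determinant is at least `|p|² / 2` and
  -- the kernel is at most `2ˢ`.
  rcases le_or_gt ‖p‖ 1 with hp | hp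
  · refine le_add_right ?_
    have hne : ∀ᵐ α : ℝ ∂μ, (α : ℂ) + b₁ ≠ 0 := by
      refine (Measure.ae_ne μ (-b₁.re)).mono fun α hα h => hα ?_
      have := congrArg Complex.re h
      simp only [Complex.add_re, Complex.ofReal_re, Complex.zero_re] at this
      linarith
    calc ∫⁻ α, ∫⁻ β, pairKernel s b₁ b₂ p α β ∂μ ∂μ
        ≤ ∫⁻ α : ℝ, ENNReal.ofReal (‖(α : ℂ) + b₁‖⁻¹ ^ s) * C ∂μ := by
          refine lintegral_mono_ae (hne.mono fun α hα => ?_)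
          refine (lintegral_pairKernel_le_of_ne hC b₁ b₂ p hα).trans ?_
          gcongr
          exact mul_le_of_le_one_left (by positivity) hp
      _ ≤ C * C := by
          rw [lintegral_mul_const _ (by fun_prop)]
          gcongr
          exact hC b₁
  · refine le_add_left ?_
    have key : ∀ b₁ b₂ : ℂ, ∫⁻ α, ∫⁻ β,
        (if ‖p‖ / 2 ≤ ‖(α : ℂ) + b₁‖ then pairKernel s b₁ b₂ p α β else 0) ∂μ ∂μ ≤ 2 * C := by
      intro b₁ b₂
      calc ∫⁻ α, ∫⁻ β,
          (if ‖p‖ / 2 ≤ ‖(α : ℂ) + b₁‖ then pairKernel s b₁ b₂ p α β else 0) ∂μ ∂μ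
          ≤ ∫⁻ _, 2 * C ∂μ := by
            refine lintegral_mono fun α => ?_
            by_cases h : ‖p‖ / 2 ≤ ‖(α : ℂ) + b₁‖
            · simp only [if_pos h]
              have hpos : 0 < ‖(α : ℂ) + b₁‖ := by linarith
              refine (lintegral_pairKernel_le_of_ne hC b₁ b₂ p (norm_pos_iff.1 hpos)).trans ?_
              gcongr
              rw [← ENNReal.ofReal_ofNat]
              refine ENNReal.ofReal_le_ofReal (le_trans ?_ htwo)
              refine Real.rpow_le_rpow (by positivity) ?_ hs0.le
              rw [← div_eq_mul_inv, div_le_iff₀ hpos]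
              linarith
            · simp only [if_neg h, lintegral_zero]
              exact zero_le
        _ = 2 * C := by rw [lintegral_const, measure_univ, mul_one]
    have hmeas : ∀ b₁ b₂ : ℂ, Measurable (Function.uncurry fun α β : ℝ =>
        if ‖p‖ / 2 ≤ ‖(α : ℂ) + b₁‖ then pairKernel s b₁ b₂ p α β else 0) := by
      intro b₁ b₂
      refine Measurable.ite ?_ (measurable_pairKernel s b₁ b₂ p) measurable_const
      refine measurableSet_le measurable_const ?_
      fun_prop
    have hcomm : ∀ α β : ℝ, pairKernel s b₁ b₂ p α β = pairKernel s b₂ b₁ p β α := by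
      intro α β
      rw [pairKernel, pairKernel, mul_comm ((α : ℂ) + b₁)]
    have hpt : ∀ α β : ℝ, pairKernel s b₁ b₂ p α β
        ≤ (if ‖p‖ / 2 ≤ ‖(α : ℂ) + b₁‖ then pairKernel s b₁ b₂ p α β else 0)
          + (if ‖p‖ / 2 ≤ ‖(β : ℂ) + b₂‖ then pairKernel s b₂ b₁ p β α else 0) + 2 := by
      intro α β
      by_cases h1 : ‖p‖ / 2 ≤ ‖(α : ℂ) + b₁‖
      · rw [if_pos h1, add_assoc]
        exact le_self_add
      by_cases h2 : ‖p‖ / 2 ≤ ‖(β : ℂ) + b₂‖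
      · rw [if_pos h2, hcomm, add_right_comm]
        exact le_add_left le_rfl
      refine le_add_left ?_
      rw [pairKernel, ← ENNReal.ofReal_ofNat]
      refine ENNReal.ofReal_le_ofReal (le_trans ?_ htwo)
      refine Real.rpow_le_rpow (by positivity) ?_ hs0.le
      have h3 : ‖((α : ℂ) + b₁) * ((β : ℂ) + b₂)‖ ≤ ‖p‖ / 2 * (‖p‖ / 2) := by
        rw [norm_mul]
        exact mul_le_mul (not_le.1 h1).le (not_le.1 h2).le (norm_nonneg _) (by positivity)
      have h4 : ‖p‖ ^ 2 / 2 ≤ ‖((α : ℂ) + b₁) * ((β : ℂ) + b₂) - p ^ 2‖ := by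
        have := norm_sub_norm_le (p ^ 2) (((α : ℂ) + b₁) * ((β : ℂ) + b₂))
        rw [norm_sub_rev, norm_pow] at this
        nlinarith
      rw [← div_eq_mul_inv, div_le_iff₀ (by nlinarith)]
      nlinarith
    calc ∫⁻ α, ∫⁻ β, pairKernel s b₁ b₂ p α β ∂μ ∂μ
        ≤ ∫⁻ α, ∫⁻ β, ((if ‖p‖ / 2 ≤ ‖(α : ℂ) + b₁‖ then pairKernel s b₁ b₂ p α β else 0)
          + (if ‖p‖ / 2 ≤ ‖(β : ℂ) + b₂‖ then pairKernel s b₂ b₁ p β α else 0) + 2) ∂μ ∂μ :=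
          lintegral_mono fun α => lintegral_mono fun β => hpt α β
      _ = ∫⁻ α, ∫⁻ β, (if ‖p‖ / 2 ≤ ‖(α : ℂ) + b₁‖ then pairKernel s b₁ b₂ p α β else 0) ∂μ ∂μ
          + ∫⁻ α, ∫⁻ β, (if ‖p‖ / 2 ≤ ‖(β : ℂ) + b₂‖ then pairKernel s b₂ b₁ p β α else 0) ∂μ ∂μ
          + 2 := by
          have h1 : ∀ α : ℝ, ∫⁻ β,
              ((if ‖p‖ / 2 ≤ ‖(α : ℂ) + b₁‖ then pairKernel s b₁ b₂ p α β else 0)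
              + (if ‖p‖ / 2 ≤ ‖(β : ℂ) + b₂‖ then pairKernel s b₂ b₁ p β α else 0) + 2) ∂μ
              = ∫⁻ β, (if ‖p‖ / 2 ≤ ‖(α : ℂ) + b₁‖ then pairKernel s b₁ b₂ p α β else 0) ∂μ
              + ∫⁻ β, (if ‖p‖ / 2 ≤ ‖(β : ℂ) + b₂‖ then pairKernel s b₂ b₁ p β α else 0) ∂μ
              + 2 := by
            intro α
            have h2 : Measurable fun β : ℝ =>
                if ‖p‖ / 2 ≤ ‖(α : ℂ) + b₁‖ then pairKernel s b₁ b₂ p α β else 0 :=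
              (hmeas b₁ b₂).comp measurable_prodMk_left
            rw [lintegral_add_right _ measurable_const, lintegral_add_left h2, lintegral_const,
              measure_univ, mul_one]
          have h3 : Measurable fun α : ℝ => ∫⁻ β : ℝ,
              (if ‖p‖ / 2 ≤ ‖(α : ℂ) + b₁‖ then pairKernel s b₁ b₂ p α β else 0) ∂μ :=
            (hmeas b₁ b₂).lintegral_prod_right'
          simp only [h1]
          rw [lintegral_add_right _ measurable_const, lintegral_const, measure_univ, mul_one,
            lintegral_add_left h3]
      _ ≤ 2 * C + 2 * C + 2 := by
          gcongr
          · exact key b₁ b₂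
          · rw [lintegral_lintegral_swap]
            · exact key b₂ b₁
            · exact ((hmeas b₂ b₁).comp measurable_swap).aemeasurable

/-! ### Fractional moments under the product law and the a priori bound -/

/-- The fractional moment of the Green function, as an integral over the clipped potentials. -/
def moment (μ : Measure ℝ) [IsProbabilityMeasure μ] (M lam s : ℝ) (R : Set (Site d)) (z : ℂ)
    (x y : Site d) : ℝ≥0∞ :=
  ∫⁻ v, ENNReal.ofReal (‖green R lam (clip M v) z x y‖ ^ s) ∂potLaw d μ

lemma measurable_green_rpow {M : ℝ} (hM : 0 ≤ M) (R : Set (Site d)) (lam s : ℝ) {z : ℂ}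
    (hz : z.im ≠ 0) (x y : Site d) :
    Measurable fun v => ENNReal.ofReal (‖green R lam (clip M v) z x y‖ ^ s) :=
  ((measurable_green_clip hM R lam hz x y).norm.pow_const s).ennreal_ofReal

/-- Almost every resampled value is within the cutoff, so clipping is invisible to averages over one
coordinate. -/
lemma clip_update (M : ℝ) (v : Site d → ℝ) (x : Site d) {t : ℝ} (ht : |t| ≤ M) :
    clip M (Function.update v x t) = Function.update (clip M v) x t := by
  have h := abs_le.1 ht
  funext q
  by_cases hq : q = x
  · subst hq
    rw [Function.update_self, clip, Function.update_self, min_eq_right h.2, max_eq_right h.1]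
  · rw [Function.update_of_ne hq, clip, clip, Function.update_of_ne hq]

section averages

variable {μ : Measure ℝ} [IsProbabilityMeasure μ] [NullSingletonClass μ] {M s : ℝ} {C : ℝ≥0∞}

/-- The constant in the a priori bound. -/
def aprioriConst (C : ℝ≥0∞) : ℝ≥0∞ := C + (C * C + (2 * C + 2 * C + 2))

lemma aprioriConst_ne_top (hC : C ≠ ⊤) : aprioriConst C ≠ ⊤ := by
  simp [aprioriConst, hC, ENNReal.mul_eq_top]

/-- The conditional a priori bound: the fractional moment of `G(x, y)` given the potential away
from `x` and `y`. -/
lemma lintegral_mul_green_le (hM : 0 ≤ M) (hμM : ∀ᵐ t ∂μ, |t| ≤ M) (hs0 : 0 < s) (hs1 : s < 1)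
    (hC : HasFracBound μ s C) {lam : ℝ} (hlam : 0 < lam) {z : ℂ} (hz : z.im ≠ 0) {x y : Site d}
    (hx : x ∈ R) (hy : y ∈ R) {K : (Site d → ℝ) → ℝ≥0∞} (hK : Measurable K)
    (hKx : ∀ v t, K (Function.update v x t) = K v) (hKy : ∀ v t, K (Function.update v y t) = K v) :
    ∫⁻ v, K v * ENNReal.ofReal (‖green R lam (clip M v) z x y‖ ^ s) ∂potLaw d μ
      ≤ aprioriConst C * ENNReal.ofReal (lam⁻¹ ^ s) * ∫⁻ v, K v ∂potLaw d μ := by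
  have hm := measurable_green_rpow hM R lam s hz x y
  have hf : Measurable fun v => K v * ENNReal.ofReal (‖green R lam (clip M v) z x y‖ ^ s) :=
    hK.mul hm
  rw [mul_comm (aprioriConst C * _), ← lintegral_mul_const _ hK]
  by_cases hxy : x = y
  · subst hxy
    rw [lintegral_update μ x hf]
    refine lintegral_mono fun v => ?_
    obtain ⟨b, hb⟩ := norm_green_self_eq (exists_clip_bound hM v) hlam hz hx
    have hmt : Measurable fun t =>
        ENNReal.ofReal (‖green R lam (clip M (Function.update v x t)) z x x‖ ^ s) :=
      hm.comp (measurable_update v)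
    simp only [hKx]
    rw [lintegral_const_mul _ hmt]
    gcongr
    calc ∫⁻ t, ENNReal.ofReal (‖green R lam (clip M (Function.update v x t)) z x x‖ ^ s) ∂μ
        = ∫⁻ t : ℝ, ENNReal.ofReal (lam⁻¹ ^ s) * ENNReal.ofReal (‖(t : ℂ) + b‖⁻¹ ^ s) ∂μ := by
          refine lintegral_congr_ae (hμM.mono fun t ht => ?_)
          simp only
          rw [hb _ (exists_clip_bound hM _), clip_update M v x ht, Function.update_self,
            Real.mul_rpow (by positivity) (by positivity), ENNReal.ofReal_mul (by positivity)]
          intro q hq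
          rw [clip_update M v x ht, Function.update_of_ne hq]
      _ ≤ ENNReal.ofReal (lam⁻¹ ^ s) * C := by
          rw [lintegral_const_mul _ (by fun_prop)]
          gcongr
          exact hC b
      _ ≤ aprioriConst C * ENNReal.ofReal (lam⁻¹ ^ s) := by
          rw [mul_comm]
          gcongr
          exact le_self_add
  · have hm2 : Measurable fun v => ∫⁻ r, K (Function.update v y r) * ENNReal.ofReal
        (‖green R lam (clip M (Function.update v y r)) z x y‖ ^ s) ∂μ := by
      have : Measurable fun p : (Site d → ℝ) × ℝ => Function.update p.1 y p.2 := by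
        refine measurable_pi_lambda _ fun q => ?_
        by_cases hq : q = y
        · subst hq
          simpa using measurable_snd
        · simp only [Function.update_of_ne hq]
          exact (measurable_pi_apply q).comp measurable_fst
      exact (hf.comp this).lintegral_prod_right'
    -- Both coordinates are integrated with all others frozen; the weight does not see either, and
    -- the remaining double integral is that of `pairKernel`.
    rw [lintegral_update μ y hf, lintegral_update μ x hm2]
    refine lintegral_mono fun v => ?_
    obtain ⟨b₁, b₂, p, hb⟩ := norm_green_eq (exists_clip_bound hM v) hlam hz hx hy hxy
    simp only [hKx, hKy]
    calc ∫⁻ t, ∫⁻ r, K v * ENNReal.ofReal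
          (‖green R lam (clip M (Function.update (Function.update v x t) y r)) z x y‖ ^ s) ∂μ ∂μ
        = ∫⁻ t, ∫⁻ r, (K v * ENNReal.ofReal (lam⁻¹ ^ s)) * pairKernel s b₁ b₂ p t r ∂μ ∂μ := by
          refine lintegral_congr_ae (hμM.mono fun t ht => ?_)
          refine lintegral_congr_ae (hμM.mono fun r hr => ?_)
          simp only
          rw [hb _ (exists_clip_bound hM _), clip_update M _ y hr, Function.update_self,
            Function.update_of_ne hxy, clip_update M _ x ht, Function.update_self,
            Real.mul_rpow (by positivity) (by positivity), ENNReal.ofReal_mul (by positivity),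
            pairKernel, mul_assoc]
          intro q hqx hqy
          rw [clip_update M _ y hr, Function.update_of_ne hqy, clip_update M _ x ht,
            Function.update_of_ne hqx]
      _ = K v * ENNReal.ofReal (lam⁻¹ ^ s) * ∫⁻ t, ∫⁻ r, pairKernel s b₁ b₂ p t r ∂μ ∂μ := by
          exact lintegral_const_mul_pairKernel s b₁ b₂ p _
      _ ≤ K v * ENNReal.ofReal (lam⁻¹ ^ s) * aprioriConst C := by
          refine mul_le_mul_right ((lintegral_pairKernel_le hs0 hs1 hC b₁ b₂ p).trans ?_) _
          rw [aprioriConst]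
          exact le_add_self
      _ = K v * (aprioriConst C * ENNReal.ofReal (lam⁻¹ ^ s)) := by ring

/-- The a priori bound on fractional moments. -/
lemma moment_le (hM : 0 ≤ M) (hμM : ∀ᵐ t ∂μ, |t| ≤ M) (hs0 : 0 < s) (hs1 : s < 1)
    (hC : HasFracBound μ s C) {lam : ℝ} (hlam : 0 < lam) {z : ℂ} (hz : z.im ≠ 0) (R : Set (Site d))
    (x y : Site d) :
    moment μ M lam s R z x y ≤ aprioriConst C * ENNReal.ofReal (lam⁻¹ ^ s) := by
  by_cases hx : x ∈ R
  · by_cases hy : y ∈ R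
    · have := lintegral_mul_green_le hM hμM hs0 hs1 hC hlam hz hx hy (K := fun _ => 1)
        measurable_const (fun _ _ => rfl) (fun _ _ => rfl)
      simpa [moment] using this
    · simp [moment, green_right_notMem _ _ _ _ hy, hs0.ne']
  · simp [moment, green_left_notMem _ _ _ hx, hs0.ne']

end averages

end Anderson
end

noncomputable section

namespace Anderson

variable {d : ℕ} {R : Set (Site d)}

/-! ### The contraction estimate -/

lemma ofReal_add_rpow_le {s : ℝ} (hs0 : 0 < s) (hs1 : s < 1) {a b : ℝ} (ha : 0 ≤ a) (hb : 0 ≤ b) :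
    ENNReal.ofReal ((a + b) ^ s) ≤ ENNReal.ofReal (a ^ s) + ENNReal.ofReal (b ^ s) := by
  rw [← ENNReal.ofReal_rpow_of_nonneg (add_nonneg ha hb) hs0.le,
    ← ENNReal.ofReal_rpow_of_nonneg ha hs0.le, ← ENNReal.ofReal_rpow_of_nonneg hb hs0.le,
    ENNReal.ofReal_add ha hb]
  exact ENNReal.rpow_add_le_add_rpow _ _ hs0.le hs1.le

lemma ofReal_sum_rpow_le {ι : Type*} {s : ℝ} (hs0 : 0 < s) (hs1 : s < 1) (t : Finset ι)
    (f : ι → ℝ) (hf : ∀ i, 0 ≤ f i) :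
    ENNReal.ofReal ((∑ i ∈ t, f i) ^ s) ≤ ∑ i ∈ t, ENNReal.ofReal (f i ^ s) := by
  classical
  induction t using Finset.induction_on with
  | empty => simp [hs0.ne']
  | insert i t hi ih =>
    rw [Finset.sum_insert hi, Finset.sum_insert hi]
    exact (ofReal_add_rpow_le hs0 hs1 (hf i) (Finset.sum_nonneg fun j _ => hf j)).trans (by gcongr)

lemma green_congr {v v' : Site d → ℝ} (hv : ∃ M, ∀ x, |v x| ≤ M) (hv' : ∃ M, ∀ x, |v' x| ≤ M)
    (h : ∀ x ∈ R, v x = v' x) (lam : ℝ) (z : ℂ) (x y : Site d) :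
    green R lam v z x y = green R lam v' z x y := by
  have hp : potential R v = potential R v' := by
    ext1 f
    refine zeroExt_injective (funext fun q => ?_)
    rw [potential_apply hv, potential_apply hv']
    by_cases hq : q ∈ R
    · rw [h q hq]
    · rw [zeroExt_notMem _ hq, mul_zero, mul_zero]
  rw [green, green, hamiltonian, hamiltonian, hp]

lemma clip_congr {M : ℝ} {v v' : Site d → ℝ} {x : Site d} (h : v x = v' x) :
    clip M v x = clip M v' x := by rw [clip, clip, h]

lemma piecewise_update_of_mem (D : Finset (Site d)) (w v : Site d → ℝ) {x : Site d} (hx : x ∈ D)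
    (t : ℝ) : D.piecewise w (Function.update v x t) = D.piecewise w v := by
  funext q
  by_cases hq : q ∈ D
  · simp [hq]
  · have : q ≠ x := fun h => hq (h ▸ hx)
    simp [hq, this]

lemma measurable_piecewise_right (D : Finset (Site d)) (w : Site d → ℝ) :
    Measurable fun v : Site d → ℝ => D.piecewise w v :=
  (measurable_piecewise D).comp measurable_prodMk_left

/-- A function of the potential on `D` is independent of the potential resampled on `D`. -/
lemma lintegral_mul_resample (μ : Measure ℝ) [IsProbabilityMeasure μ] (D : Finset (Site d))
    {F Ψ : (Site d → ℝ) → ℝ≥0∞} (hF : Measurable F) (hΨ : Measurable Ψ)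
    (hFD : ∀ w v, F (D.piecewise w v) = F w) :
    ∫⁻ w, ∫⁻ v, F v * Ψ (D.piecewise w v) ∂potLaw d μ ∂potLaw d μ
      = (∫⁻ v, F v ∂potLaw d μ) * ∫⁻ v, Ψ v ∂potLaw d μ := by
  have h : ∀ w, ∫⁻ v, F v * Ψ (D.piecewise w v) ∂potLaw d μ
      = (∫⁻ v, F v ∂potLaw d μ) * ∫⁻ v, Ψ (D.piecewise w v) ∂potLaw d μ := by
    intro w
    have hm : Measurable fun v => Ψ (D.piecewise w v) := hΨ.comp (measurable_piecewise_right D w)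
    have hm' : Measurable fun v => F v * Ψ (D.piecewise w v) := hF.mul hm
    rw [lintegral_resample μ D hm', ← lintegral_mul_const _ hF]
    refine lintegral_congr fun w' => ?_
    rw [← lintegral_const_mul _ hm]
    refine lintegral_congr fun v => ?_
    have : D.piecewise w (D.piecewise w' v) = D.piecewise w v := by
      funext q
      by_cases hq : q ∈ D <;> simp [hq]
    rw [hFD, this]
  have hm2 : Measurable fun w => ∫⁻ v, Ψ (D.piecewise w v) ∂potLaw d μ :=
    (hΨ.comp (measurable_piecewise D)).lintegral_prod_right'
  simp only [h]
  rw [lintegral_const_mul _ hm2, ← lintegral_resample μ D hΨ]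

/-- The Green function is covariant under translation and the product law is invariant. -/
lemma moment_translate {μ : Measure ℝ} [IsProbabilityMeasure μ] {M s : ℝ} (hM : 0 ≤ M) (lam : ℝ) {z : ℂ} (hz : z.im ≠ 0) (Λ : Finset (Site d))
    (x : Site d) {u : Site d} (hu : u ∈ Λ) :
    moment μ M lam s ((Λ.image (x + ·) : Finset (Site d)) : Set (Site d)) z x (x + u)
      = moment μ M lam s (Λ : Set (Site d)) z 0 u := by
  have hτ : (potLaw d μ).map (fun v q => v (x + q)) = potLaw d μ :=
    Measure.map_infinitePi_infinitePi_of_inj (P := fun _ => μ) (add_right_injective x)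
  have hτm : Measurable fun (v : Site d → ℝ) q => v (x + q) :=
    measurable_pi_lambda _ fun q => measurable_pi_apply _
  rw [moment, moment]
  nth_rewrite 2 [← hτ]
  rw [lintegral_map (measurable_green_rpow hM _ lam s hz _ _) hτm]
  refine lintegral_congr fun v => ?_
  have h := green_translate (exists_clip_bound hM v) lam hz Λ x 0 hu
  rw [add_zero] at h
  rw [h]
  rfl

lemma moment_comm {μ : Measure ℝ} [IsProbabilityMeasure μ] {M s : ℝ} (hM : 0 ≤ M) (lam : ℝ) {z : ℂ} (hz : z.im ≠ 0) (x y : Site d) :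
    moment μ M lam s R z x y = moment μ M lam s R z y x := by
  refine lintegral_congr fun v => ?_
  rw [green_symm (exists_clip_bound hM v)
    (isUnit_hamiltonian_sub (exists_clip_bound hM v) lam hz)]

section contraction

variable {μ : Measure ℝ} [IsProbabilityMeasure μ] [NullSingletonClass μ] {M s : ℝ} {C : ℝ≥0∞}

/-- Decoupling of the Green function of a finite set `W` and the Green function of the region. -/
lemma lintegral_green_mul_green_le (hM : 0 ≤ M) (hμM : ∀ᵐ t ∂μ, |t| ≤ M) (hs0 : 0 < s)
    (hs1 : s < 1) (hC : HasFracBound μ s C) {lam : ℝ} (hlam : 0 < lam) {z : ℂ} (hz : z.im ≠ 0)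
    (W : Finset (Site d)) (x u : Site d) {a y : Site d} (ha : a ∈ outerBoundary W) (hy : y ∈ R)
    (hyW : y ∉ W) (hyF : y ∉ outerBoundary W) {B : ℝ≥0∞}
    (hB : ∀ q ∈ collar W, moment μ M lam s R z q y ≤ B
      ∧ ∀ e ∈ steps d, moment μ M lam s R z (q + e) y ≤ B) :
    ∫⁻ v, ENNReal.ofReal (‖green (W : Set (Site d)) lam (clip M v) z x u‖ ^ s)
        * ENNReal.ofReal (‖green R lam (clip M v) z a y‖ ^ s) ∂potLaw d μ
      ≤ ((collar W).card : ℝ≥0∞) * (aprioriConst C * ENNReal.ofReal (lam⁻¹ ^ s) *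
        (moment μ M lam s (W : Set (Site d)) z x u
          * ((ENNReal.ofReal ((2 * M * lam) ^ s) + 2 * d) * B))) := by
  -- Resampling on all of `D` makes the comparison Green functions independent of `v` on `W`, at `a`
  -- and at every collar site `q`.
  set D := W ∪ collar W with hD
  set F : (Site d → ℝ) → ℝ≥0∞ := fun v =>
    ENNReal.ofReal (‖green (W : Set (Site d)) lam (clip M v) z x u‖ ^ s) with hF
  have hFm : Measurable F := measurable_green_rpow hM _ lam s hz x u
  set g : Site d → Site d → (Site d → ℝ) → ℝ≥0∞ := fun p q v =>
    ENNReal.ofReal (‖green R lam (clip M v) z p q‖ ^ s) with hg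
  have hgm : ∀ p q, Measurable (g p q) := fun p q => measurable_green_rpow hM R lam s hz p q
  set Ψ : Site d → (Site d → ℝ) → ℝ≥0∞ := fun q v =>
    ENNReal.ofReal ((2 * M * lam) ^ s) * g q y v + ∑ e ∈ steps d, g (q + e) y v with hΨ
  have hΨm : ∀ q, Measurable (Ψ q) := fun q =>
    ((hgm q y).const_mul _).add (Finset.measurable_fun_sum _ fun e _ => hgm (q + e) y)
  have hFcongr : ∀ v v' : Site d → ℝ, (∀ q ∈ W, v q = v' q) → F v = F v' := by
    intro v v' h
    simp only [hF]
    rw [green_congr (exists_clip_bound hM v) (exists_clip_bound hM v')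
      fun q hq => clip_congr (h q hq)]
  have hpt : ∀ w v, g a y v ≤ ∑ q ∈ collar W, g a q v * Ψ q (D.piecewise w v) := by
    intro w v
    have h := norm_green_le_sum_collar (exists_clip_bound hM v)
      (exists_clip_bound hM (D.piecewise w v)) lam hz W (fun q hq hq' => clip_congr (by
        rw [Finset.piecewise_eq_of_notMem]
        rw [hD, Finset.mem_union]
        exact fun h => h.elim hq hq')) ha hy hyW hyF
    refine (ENNReal.ofReal_le_ofReal (Real.rpow_le_rpow (norm_nonneg _) h hs0.le)).trans ?_
    refine (ofReal_sum_rpow_le hs0 hs1 _ _ fun q => by positivity).trans ?_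
    refine Finset.sum_le_sum fun q _ => ?_
    rw [Real.mul_rpow (norm_nonneg _) (by positivity), ENNReal.ofReal_mul (by positivity)]
    refine mul_le_mul_right ?_ _
    refine (ofReal_add_rpow_le hs0 hs1 (by positivity) (by positivity)).trans ?_
    refine add_le_add ?_ (ofReal_sum_rpow_le hs0 hs1 _ _ fun e => norm_nonneg _)
    rw [Real.mul_rpow (by positivity) (norm_nonneg _), ENNReal.ofReal_mul (by positivity)]
    refine mul_le_mul_left (ENNReal.ofReal_le_ofReal ?_) _
    refine Real.rpow_le_rpow (by positivity) ?_ hs0.le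
    rw [abs_of_pos hlam, mul_comm]
    refine mul_le_mul_of_nonneg_right ?_ hlam.le
    refine (abs_sub _ _).trans ?_
    linarith [abs_clip_le hM v q, abs_clip_le hM (D.piecewise w v) q]
  have haD : a ∈ D := Finset.mem_union_right _ (outerBoundary_subset_collar W ha)
  have hnotW : ∀ q ∈ collar W, q ∉ W := fun q hq => (Finset.mem_sdiff.1 hq).2
  have hFupd : ∀ q ∈ collar W, ∀ v t, F (Function.update v q t) = F v := fun q hq v t =>
    hFcongr _ _ fun p hp => Function.update_of_ne (by
      rintro rfl
      exact hnotW p hq hp) _ _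
  -- The a priori bound is used conditionally: `F` sees only `W`, and the resampled factor does not
  -- see `v` on `D`, so neither depends on the potential at `a` or `q`.
  have hterm : ∀ q ∈ collar W, ∀ w, ∫⁻ v, F v * Ψ q (D.piecewise w v) * g a q v ∂potLaw d μ
      ≤ aprioriConst C * ENNReal.ofReal (lam⁻¹ ^ s)
        * ∫⁻ v, F v * Ψ q (D.piecewise w v) ∂potLaw d μ := by
    intro q hq w
    by_cases haR : a ∈ R
    · by_cases hqR : q ∈ R
      · refine lintegral_mul_green_le hM hμM hs0 hs1 hC hlam hz haR hqR
          (hFm.mul ((hΨm q).comp (measurable_piecewise_right D w))) ?_ ?_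
        · intro v t
          rw [hFupd a (outerBoundary_subset_collar W ha), piecewise_update_of_mem D w v haD]
        · intro v t
          rw [hFupd q hq, piecewise_update_of_mem D w v (Finset.mem_union_right _ hq)]
      · simp [hg, green_right_notMem _ _ _ _ hqR, hs0.ne']
    · simp [hg, green_left_notMem _ _ _ haR, hs0.ne']
  have hΨint : ∀ q ∈ collar W, ∫⁻ v, Ψ q v ∂potLaw d μ
      ≤ (ENNReal.ofReal ((2 * M * lam) ^ s) + 2 * d) * B := by
    intro q hq
    simp only [hΨ]
    rw [lintegral_add_left ((hgm q y).const_mul _), lintegral_const_mul _ (hgm q y),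
      lintegral_finsetSum _ fun e _ => hgm (q + e) y, add_mul]
    refine add_le_add (mul_le_mul_right (hB q hq).1 _) ?_
    refine (Finset.sum_le_card_nsmul _ _ B fun e he => (hB q hq).2 e he).trans ?_
    rw [nsmul_eq_mul]
    gcongr
    exact_mod_cast card_steps_le
  calc ∫⁻ v, F v * g a y v ∂potLaw d μ
      -- A dummy average over the independent copy `w` is inserted, since the pointwise bound holds
      -- for every `w`.
      = ∫⁻ _w, ∫⁻ v, F v * g a y v ∂potLaw d μ ∂potLaw d μ := by
        rw [lintegral_const, measure_univ, mul_one]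
    _ ≤ ∫⁻ w, ∑ q ∈ collar W, aprioriConst C * ENNReal.ofReal (lam⁻¹ ^ s)
        * ∫⁻ v, F v * Ψ q (D.piecewise w v) ∂potLaw d μ ∂potLaw d μ := by
        refine lintegral_mono fun w => ?_
        calc ∫⁻ v, F v * g a y v ∂potLaw d μ
            ≤ ∫⁻ v, ∑ q ∈ collar W, F v * Ψ q (D.piecewise w v) * g a q v ∂potLaw d μ := by
              refine lintegral_mono fun v => ?_
              refine (mul_le_mul_right (hpt w v) (F v)).trans_eq ?_
              rw [Finset.mul_sum]
              exact Finset.sum_congr rfl fun q _ => by ring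
          _ = ∑ q ∈ collar W, ∫⁻ v, F v * Ψ q (D.piecewise w v) * g a q v ∂potLaw d μ :=
              lintegral_finsetSum _ fun q _ =>
                (hFm.mul ((hΨm q).comp (measurable_piecewise_right D w))).mul (hgm a q)
          _ ≤ _ := Finset.sum_le_sum fun q hq => hterm q hq w
    _ = ∑ q ∈ collar W, aprioriConst C * ENNReal.ofReal (lam⁻¹ ^ s)
        * ((∫⁻ v, F v ∂potLaw d μ) * ∫⁻ v, Ψ q v ∂potLaw d μ) := by
        have hm : ∀ q, Measurable fun w => ∫⁻ v, F v * Ψ q (D.piecewise w v) ∂potLaw d μ :=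
          fun q => Measurable.lintegral_prod_right' (f := fun p : (Site d → ℝ) × (Site d → ℝ) =>
            F p.2 * Ψ q (D.piecewise p.1 p.2))
            ((hFm.comp measurable_snd).mul ((hΨm q).comp (measurable_piecewise D)))
        rw [lintegral_finsetSum _ fun q _ => (hm q).const_mul _]
        refine Finset.sum_congr rfl fun q _ => ?_
        rw [lintegral_const_mul _ (hm q), lintegral_mul_resample μ D hFm (hΨm q)]
        intro w v
        refine hFcongr _ _ fun p hp => ?_
        rw [Finset.piecewise_eq_of_mem _ _ _ (Finset.mem_union_left _ hp)]
    _ ≤ ∑ q ∈ collar W, aprioriConst C * ENNReal.ofReal (lam⁻¹ ^ s) *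
        (moment μ M lam s (W : Set (Site d)) z x u
          * ((ENNReal.ofReal ((2 * M * lam) ^ s) + 2 * d) * B)) := by
        refine Finset.sum_le_sum fun q hq => ?_
        exact mul_le_mul_right (mul_le_mul_right (hΨint q hq) _) _
    _ = _ := by rw [Finset.sum_const, nsmul_eq_mul]

/-- The factor by which fractional moments contract on the scale of `Λ`. -/
def contractionFactor (μ : Measure ℝ) [IsProbabilityMeasure μ] (M lam s : ℝ) (C : ℝ≥0∞)
    (Λ : Finset (Site d)) (z : ℂ) : ℝ≥0∞ :=
  ((1 + 2 * d : ℕ) : ℝ≥0∞) * ((bonds Λ).card : ℝ≥0∞) *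
    (aprioriConst C * ENNReal.ofReal (lam⁻¹ ^ s) * (ENNReal.ofReal ((2 * M * lam) ^ s) + 2 * d)) *
      ∑ b ∈ bonds Λ, moment μ M lam s (Λ : Set (Site d)) z 0 b.1

/-- The geometric resolvent identity on the translate of `Λ`, followed by decoupling bond by bond;
translation invariance turns the finite-volume moments into those at the origin. -/
lemma moment_contraction (hM : 0 ≤ M) (hμM : ∀ᵐ t ∂μ, |t| ≤ M) (hs0 : 0 < s)
    (hs1 : s < 1) (hC : HasFracBound μ s C) {lam : ℝ} (hlam : 0 < lam) {z : ℂ} (hz : z.im ≠ 0)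
    (Λ : Finset (Site d)) (h0 : 0 ∈ Λ) {x y : Site d} (hR : ∀ q ∈ Λ, x + q ∈ R) (hy : y ∈ R)
    (hyW : y ∉ Λ.image (x + ·)) (hyF : y ∉ outerBoundary (Λ.image (x + ·))) {B : ℝ≥0∞}
    (hB : ∀ q ∈ collar (Λ.image (x + ·)), moment μ M lam s R z q y ≤ B
      ∧ ∀ e ∈ steps d, moment μ M lam s R z (q + e) y ≤ B) :
    moment μ M lam s R z x y ≤ contractionFactor μ M lam s C Λ z * B := by
  set W := Λ.image (x + ·) with hW
  have hxW : x ∈ W := Finset.mem_image.2 ⟨0, h0, add_zero x⟩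
  have hWR : ∀ q ∈ W, q ∈ R := by
    intro q hq
    obtain ⟨p, hp, rfl⟩ := Finset.mem_image.1 hq
    exact hR p hp
  have hcard : ((collar W).card : ℝ≥0∞)
      ≤ ((1 + 2 * d : ℕ) : ℝ≥0∞) * ((bonds Λ).card : ℝ≥0∞) := by
    rw [← card_bonds_translate Λ x]
    exact_mod_cast card_collar_le W
  have hgW := fun b : Site d × Site d => measurable_green_rpow hM (W : Set (Site d)) lam s hz x b.1
  have hgR := fun b : Site d × Site d => measurable_green_rpow hM R lam s hz b.2 y
  calc moment μ M lam s R z x y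
      ≤ ∫⁻ v, ∑ b ∈ bonds W, ENNReal.ofReal
          (‖green (W : Set (Site d)) lam (clip M v) z x b.1‖ ^ s)
          * ENNReal.ofReal (‖green R lam (clip M v) z b.2 y‖ ^ s) ∂potLaw d μ := by
        refine lintegral_mono fun v => ?_
        rw [green_eq_sum_bonds (exists_clip_bound hM v) lam hz W hWR hxW hy hyW]
        refine (ENNReal.ofReal_le_ofReal (Real.rpow_le_rpow (norm_nonneg _)
          (norm_sum_le _ _) hs0.le)).trans ?_
        refine (ofReal_sum_rpow_le hs0 hs1 _ _ fun _ => norm_nonneg _).trans_eq ?_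
        refine Finset.sum_congr rfl fun b _ => ?_
        rw [norm_mul, Real.mul_rpow (norm_nonneg _) (norm_nonneg _),
          ENNReal.ofReal_mul (by positivity)]
    _ = ∑ b ∈ bonds W, ∫⁻ v, ENNReal.ofReal
          (‖green (W : Set (Site d)) lam (clip M v) z x b.1‖ ^ s)
          * ENNReal.ofReal (‖green R lam (clip M v) z b.2 y‖ ^ s) ∂potLaw d μ :=
        lintegral_finsetSum _ fun b _ => (hgW b).mul (hgR b)
    _ ≤ ∑ b ∈ bonds W, ((collar W).card : ℝ≥0∞) * (aprioriConst C * ENNReal.ofReal (lam⁻¹ ^ s) *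
        (moment μ M lam s (W : Set (Site d)) z x b.1
          * ((ENNReal.ofReal ((2 * M * lam) ^ s) + 2 * d) * B))) :=
        Finset.sum_le_sum fun b hb => lintegral_green_mul_green_le hM hμM hs0 hs1 hC hlam hz W x b.1
          (Finset.mem_image_of_mem _ hb) hy hyW hyF hB
    _ = ((collar W).card : ℝ≥0∞) *
        (aprioriConst C * ENNReal.ofReal (lam⁻¹ ^ s)
          * (ENNReal.ofReal ((2 * M * lam) ^ s) + 2 * d)) *
        (∑ b ∈ bonds W, moment μ M lam s (W : Set (Site d)) z x b.1) * B := by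
        rw [Finset.mul_sum, Finset.sum_mul]
        exact Finset.sum_congr rfl fun b _ => by ring
    _ ≤ ((1 + 2 * d : ℕ) : ℝ≥0∞) * ((bonds Λ).card : ℝ≥0∞) *
        (aprioriConst C * ENNReal.ofReal (lam⁻¹ ^ s)
          * (ENNReal.ofReal ((2 * M * lam) ^ s) + 2 * d)) *
        (∑ b ∈ bonds W, moment μ M lam s (W : Set (Site d)) z x b.1) * B := by
        gcongr
    _ = contractionFactor μ M lam s C Λ z * B := by
        rw [contractionFactor, hW, sum_bonds_translate Λ x fun p _ =>
          moment μ M lam s ((Λ.image (x + ·) : Finset (Site d)) : Set (Site d)) z x p]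
        congr 2
        exact Finset.sum_congr rfl fun b hb => moment_translate hM lam hz Λ x (mem_bonds.1 hb).1

/-! ### Iteration -/

lemma exists_step_toward {x w : Site d} (h : x ≠ w) :
    ∃ e ∈ steps d, siteDist (x + e) w + 1 = siteDist x w := by
  obtain ⟨j, hj⟩ := Function.ne_iff.1 h
  have key : ∀ c : ℤ, ((x j + c - w j).natAbs + 1 = (x j - w j).natAbs) →
      siteDist (x + Pi.single j c) w + 1 = siteDist x w := by
    intro c hc
    unfold siteDist
    rw [← Finset.add_sum_erase _ _ (Finset.mem_univ j), ← Finset.add_sum_erase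
      (f := fun j => (x j - w j).natAbs) _ (Finset.mem_univ j), ← hc]
    have : ∑ i ∈ Finset.univ.erase j, ((x + Pi.single j c : Site d) i - w i).natAbs
        = ∑ i ∈ Finset.univ.erase j, (x i - w i).natAbs := by
      refine Finset.sum_congr rfl fun i hi => ?_
      rw [Pi.add_apply, Pi.single_eq_of_ne (Finset.ne_of_mem_erase hi), add_zero]
    rw [this, Pi.add_apply, Pi.single_eq_same]
    ring
  rcases lt_or_gt_of_ne hj with h1 | h1
  · exact ⟨Pi.single j 1, Finset.mem_union_left _ (Finset.mem_image_of_mem _ (Finset.mem_univ j)),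
      key 1 (by omega)⟩
  · exact ⟨Pi.single j (-1), Finset.mem_union_right _
      (Finset.mem_image_of_mem _ (Finset.mem_univ j)), key (-1) (by omega)⟩

/-- A shortest lattice path from `x` to `w` must leave `R`, and its last site before leaving belongs
to the boundary. -/
lemma boundaryDist_le_siteDist {x w : Site d} (hx : x ∈ R) (hw : w ∉ R) :
    boundaryDist R x ≤ siteDist x w := by
  suffices h : ∀ n : ℕ, ∀ x ∈ R, siteDist x w = n → ∃ u ∈ boundary R, siteDist x u ≤ n by
    obtain ⟨u, hu, hle⟩ := h _ x hx rfl
    exact (iInf₂_le u hu).trans (by exact_mod_cast hle)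
  intro n
  induction n with
  | zero =>
    intro x hx h
    exact absurd (eq_of_siteDist_eq_zero h ▸ hx) hw
  | succ n ih =>
    intro x hx h
    have hne : x ≠ w := fun h => hw (h ▸ hx)
    obtain ⟨e, he, hed⟩ := exists_step_toward hne
    by_cases hxe : x + e ∈ R
    · obtain ⟨u, hu, hle⟩ := ih (x + e) hxe (by omega)
      refine ⟨u, hu, ?_⟩
      have := siteDist_triangle x (x + e) u
      rw [siteDist_step he] at this
      omega
    · exact ⟨x, ⟨hx, e, he, hxe⟩, by rw [siteDist_self]; omega⟩

lemma boundaryDist_le_add (x w : Site d) :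
    boundaryDist R x ≤ siteDist x w + boundaryDist R w := by
  rw [← tsub_le_iff_left]
  refine le_iInf₂ fun u hu => ?_
  rw [tsub_le_iff_left]
  exact (iInf₂_le u hu).trans (by exact_mod_cast siteDist_triangle x w u)

lemma le_regionDist_iff {x y : Site d} {n : ℕ} : n ≤ regionDist R x y ↔
    n ≤ siteDist x y ∧ (n : ℕ∞) ≤ boundaryDist R x + boundaryDist R y := by
  have hne : min (siteDist x y : ℕ∞) (boundaryDist R x + boundaryDist R y) ≠ ⊤ :=
    ne_top_of_le_ne_top (ENat.natCast_ne_top _) (min_le_left _ _)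
  rw [regionDist, ← ENat.natCast_le_natCast, ENat.natCast_toNat hne, le_min_iff, ENat.natCast_le_natCast]

lemma regionDist_comm (x y : Site d) : regionDist R x y = regionDist R y x := by
  rw [regionDist, regionDist, siteDist_comm, add_comm]

lemma siteDist_outerBoundary_le {W : Finset (Site d)} {x : Site d} {ℓ : ℕ}
    (hW : ∀ q ∈ W, siteDist x q ≤ ℓ) {q : Site d} (hq : q ∈ outerBoundary W) :
    siteDist x q ≤ ℓ + 1 := by
  obtain ⟨b, hb, rfl⟩ := Finset.mem_image.1 hq
  obtain ⟨h1, -, e, he, h2⟩ := mem_bonds.1 hb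
  have := siteDist_triangle x b.1 b.2
  rw [h2, siteDist_step he] at this
  rw [h2]
  exact this.trans (Nat.add_le_add_right (hW _ h1) 1)

lemma siteDist_collar_le {W : Finset (Site d)} {x : Site d} {ℓ : ℕ}
    (hW : ∀ q ∈ W, siteDist x q ≤ ℓ) {q : Site d} (hq : q ∈ collar W) :
    siteDist x q ≤ ℓ + 2 := by
  rcases Finset.mem_union.1 (Finset.mem_sdiff.1 hq).1 with h | h
  · exact (siteDist_outerBoundary_le hW h).trans (Nat.le_succ _)
  · obtain ⟨p, hp, rfl⟩ := Finset.mem_image.1 h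
    obtain ⟨h1, h2⟩ := Finset.mem_product.1 hp
    have h3 := siteDist_triangle x p.1 (p.1 + p.2)
    rw [siteDist_step h2] at h3
    have := siteDist_outerBoundary_le hW h1
    omega

/-- Induction on the number of contractions. One contraction moves the first argument by at most `ℓ
+ 3`: `ℓ` within `Λ`, two more to the collar, and one to a neighbour. The reserve `2 (ℓ + 3)`
ensures that at least one endpoint is farther than `ℓ + 3` from the boundary. -/
lemma moment_le_pow (hM : 0 ≤ M) (hμM : ∀ᵐ t ∂μ, |t| ≤ M) (hs0 : 0 < s)
    (hs1 : s < 1) (hC : HasFracBound μ s C) {lam : ℝ} (hlam : 0 < lam) {z : ℂ} (hz : z.im ≠ 0)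
    (Λ : Finset (Site d)) (h0 : 0 ∈ Λ) {ℓ : ℕ} (hℓ : ∀ q ∈ Λ, siteDist 0 q ≤ ℓ) {β : ℝ≥0∞}
    (hβ : contractionFactor μ M lam s C Λ z ≤ β) (k : ℕ) {x y : Site d} (hx : x ∈ R) (hy : y ∈ R)
    (hxy : k * (ℓ + 3) + 2 * (ℓ + 3) < regionDist R x y) :
    moment μ M lam s R z x y ≤ aprioriConst C * ENNReal.ofReal (lam⁻¹ ^ s) * β ^ k := by
  induction k generalizing x y with
  | zero =>
    rw [pow_zero, mul_one]
    exact moment_le hM hμM hs0 hs1 hC hlam hz R x y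
  | succ k ih =>
    have step : ∀ x ∈ R, ∀ y ∈ R, (k + 1) * (ℓ + 3) + 2 * (ℓ + 3) < regionDist R x y →
        ((ℓ + 3 : ℕ) : ℕ∞) < boundaryDist R x →
        moment μ M lam s R z x y
          ≤ aprioriConst C * ENNReal.ofReal (lam⁻¹ ^ s) * β ^ (k + 1) := by
      intro x hx y hy hxy hbx
      obtain ⟨hd, hb⟩ := le_regionDist_iff.1 (Nat.succ_le_of_lt hxy)
      have hW : ∀ q ∈ Λ.image (x + ·), siteDist x q ≤ ℓ := by
        intro q hq
        obtain ⟨p, hp, rfl⟩ := Finset.mem_image.1 hq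
        have := siteDist_add_left x 0 p
        rw [add_zero] at this
        rw [this]
        exact hℓ p hp
      have hfar : ∀ q, siteDist x q ≤ ℓ + 3 → q ≠ y := by
        rintro q hq rfl
        nlinarith
      have hnear : ∀ q, siteDist x q ≤ ℓ + 3 → moment μ M lam s R z q y
          ≤ aprioriConst C * ENNReal.ofReal (lam⁻¹ ^ s) * β ^ k := by
        intro q hq
        by_cases hqR : q ∈ R
        · refine ih hqR hy (Nat.lt_of_succ_le (le_regionDist_iff.2 ⟨?_, ?_⟩))
          · have := siteDist_triangle x q y
            have h2 : (k + 1) * (ℓ + 3) = k * (ℓ + 3) + (ℓ + 3) := by ring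
            omega
          -- Distances to the boundary may be infinite, so the common summand `ℓ + 3` is cancelled
          -- in `ℕ∞` rather than subtracted.
          · have h1 := boundaryDist_le_add (R := R) x q
            have h2 : boundaryDist R x ≤ ((ℓ + 3 : ℕ) : ℕ∞) + boundaryDist R q :=
              h1.trans (add_le_add_left (by exact_mod_cast hq) _)
            have h3 := hb.trans (add_le_add_left h2 (boundaryDist R y))
            have h4 : ((((k + 1) * (ℓ + 3) + 2 * (ℓ + 3)).succ : ℕ) : ℕ∞)
                = ((ℓ + 3 : ℕ) : ℕ∞) + ((k * (ℓ + 3) + 2 * (ℓ + 3)).succ : ℕ) := by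
              rw [← Nat.cast_add]
              congr 1
              simp only [Nat.succ_eq_add_one]
              ring
            rw [h4, add_assoc] at h3
            exact (ENat.add_le_add_iff_left (ENat.natCast_ne_top _)).1 h3
        · simp [moment, green_left_notMem _ _ _ hqR, hs0.ne']
      have hcontr := moment_contraction (R := R) hM hμM hs0 hs1 hC hlam hz Λ h0 (x := x) (y := y)
        (B := aprioriConst C * ENNReal.ofReal (lam⁻¹ ^ s) * β ^ k) ?_ hy ?_ ?_ ?_
      · refine hcontr.trans ?_
        calc contractionFactor μ M lam s C Λ z
              * (aprioriConst C * ENNReal.ofReal (lam⁻¹ ^ s) * β ^ k)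
            ≤ β * (aprioriConst C * ENNReal.ofReal (lam⁻¹ ^ s) * β ^ k) := by gcongr
          _ = _ := by ring
      · intro q hq
        by_contra hqR
        have h1 := boundaryDist_le_siteDist hx hqR
        have h2 := hW _ (Finset.mem_image_of_mem _ hq)
        have h3 : ((siteDist x (x + q) : ℕ) : ℕ∞) ≤ ((ℓ + 3 : ℕ) : ℕ∞) := by
          exact_mod_cast h2.trans (by omega)
        exact absurd (hbx.trans_le (h1.trans h3)) (lt_irrefl _)
      · exact fun h => hfar y ((hW y h).trans (by omega)) rfl
      · exact fun h => hfar y ((siteDist_outerBoundary_le hW h).trans (by omega)) rfl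
      · intro q hq
        have h1 := siteDist_collar_le hW hq
        refine ⟨hnear q (by omega), fun e he => hnear _ ?_⟩
        have := siteDist_triangle x q (q + e)
        rw [siteDist_step he] at this
        omega
    by_cases hbx : ((ℓ + 3 : ℕ) : ℕ∞) < boundaryDist R x
    · exact step x hx y hy hxy hbx
    -- If `x` is close to the boundary, the contraction is carried out at `y`; both being close
    -- would contradict the lower bound on the sum of their boundary distances.
    · rw [moment_comm hM lam hz]
      refine step y hy x hx (by rwa [regionDist_comm]) ?_
      by_contra hby
      have h1 := (le_regionDist_iff.1 (Nat.succ_le_of_lt hxy)).2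
      have h2 := h1.trans (add_le_add (not_lt.1 hbx) (not_lt.1 hby))
      have h3 : ((k + 1) * (ℓ + 3) + 2 * (ℓ + 3)).succ ≤ (ℓ + 3) + (ℓ + 3) := by exact_mod_cast h2
      nlinarith

/-- Exponential decay of the fractional moments if the contraction factor is less than one. -/
lemma exists_moment_le_exp (hM : 0 ≤ M) (hμM : ∀ᵐ t ∂μ, |t| ≤ M) (hs0 : 0 < s)
    (hs1 : s < 1) (hCtop : C ≠ ⊤) (hC : HasFracBound μ s C) {lam : ℝ} (hlam : 0 < lam)
    (Λ : Finset (Site d)) (h0 : 0 ∈ Λ) {β : ℝ} (hβ0 : 0 < β) (hβ1 : β < 1) :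
    ∃ A m : ℝ, 0 ≤ A ∧ 0 < m ∧ ∀ z : ℂ, z.im ≠ 0 →
      contractionFactor μ M lam s C Λ z ≤ ENNReal.ofReal β → ∀ R : Set (Site d), ∀ x ∈ R, ∀ y ∈ R,
        moment μ M lam s R z x y ≤ ENNReal.ofReal (A * Real.exp (-m * regionDist R x y)) := by
  set ℓ := Λ.sup (siteDist 0)
  have hℓ : ∀ q ∈ Λ, siteDist 0 q ≤ ℓ := fun q hq => Finset.le_sup hq
  set A₀ := aprioriConst C * ENNReal.ofReal (lam⁻¹ ^ s) with hA₀
  have hA₀top : A₀ ≠ ⊤ := ENNReal.mul_ne_top (aprioriConst_ne_top hCtop) ENNReal.ofReal_ne_top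
  have hlog : Real.log β < 0 := Real.log_neg hβ0 hβ1
  have hL : (0 : ℝ) < ℓ + 3 := by positivity
  -- At least `dist / (ℓ + 3) - 3` contractions are available, two scales going to the reserve and
  -- one to rounding; the factor `β⁻³` pays for them.
  refine ⟨A₀.toReal * (β ^ 3)⁻¹, -Real.log β / (ℓ + 3), by positivity,
    div_pos (by linarith) hL, fun z hz hcf R x hx y hy => ?_⟩
  obtain ⟨k, hk, hle⟩ : ∃ k : ℕ, regionDist R x y ≤ (k + 3) * (ℓ + 3) ∧
      moment μ M lam s R z x y ≤ A₀ * ENNReal.ofReal β ^ k := by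
    by_cases h : 2 * (ℓ + 3) < regionDist R x y
    -- The `- 1` before the division accounts for the strict inequality required by `moment_le_pow`.
    · refine ⟨(regionDist R x y - 2 * (ℓ + 3) - 1) / (ℓ + 3), ?_,
        moment_le_pow hM hμM hs0 hs1 hC hlam hz Λ h0 hℓ hcf _ hx hy ?_⟩
      · have h1 := Nat.div_add_mod (regionDist R x y - 2 * (ℓ + 3) - 1) (ℓ + 3)
        have h2 := Nat.mod_lt (regionDist R x y - 2 * (ℓ + 3) - 1) (by omega : 0 < ℓ + 3)
        set k := (regionDist R x y - 2 * (ℓ + 3) - 1) / (ℓ + 3)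
        have h3 : (k + 3) * (ℓ + 3) = (ℓ + 3) * k + 3 * (ℓ + 3) := by ring
        omega
      · have h1 := Nat.div_mul_le_self (regionDist R x y - 2 * (ℓ + 3) - 1) (ℓ + 3)
        omega
    · refine ⟨0, by omega, ?_⟩
      rw [pow_zero, mul_one]
      exact moment_le hM hμM hs0 hs1 hC hlam hz R x y
  refine hle.trans ?_
  rw [← ENNReal.ofReal_toReal hA₀top, ← ENNReal.ofReal_pow hβ0.le,
    ← ENNReal.ofReal_mul ENNReal.toReal_nonneg, ENNReal.toReal_ofReal ENNReal.toReal_nonneg,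
    mul_assoc]
  refine ENNReal.ofReal_le_ofReal (mul_le_mul_of_nonneg_left ?_ ENNReal.toReal_nonneg)
  rw [← div_eq_inv_mul, le_div_iff₀ (by positivity), ← pow_add, ← Real.rpow_natCast,
    Real.rpow_def_of_pos hβ0, Real.exp_le_exp]
  have hk' : (regionDist R x y : ℝ) ≤ (k + 3) * (ℓ + 3) := by exact_mod_cast hk
  have h1 : (regionDist R x y : ℝ) / (ℓ + 3) ≤ k + 3 := by rwa [div_le_iff₀ hL]
  have h2 : -(-Real.log β / (ℓ + 3)) * (regionDist R x y : ℝ)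
      = Real.log β * ((regionDist R x y : ℝ) / (ℓ + 3)) := by ring
  rw [h2]
  push_cast
  exact mul_le_mul_of_nonpos_left h1 hlog.le

end contraction

end Anderson
end

noncomputable section

namespace Anderson

variable {d : ℕ} {R : Set (Site d)}

/-! ### Finite volume: approach to the real axis -/

lemma tendsto_green {v : Site d → ℝ} {lam : ℝ} {E : ℂ}
    (hu : IsUnit (hamiltonian R lam v - E • (1 : L2 R →L[ℂ] L2 R))) (x y : Site d) :
    Tendsto (fun z => green R lam v z x y) (𝓝 E) (𝓝 (green R lam v E x y)) := by
  obtain ⟨U, hU⟩ := hu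
  have h1 : Tendsto (fun z : ℂ => hamiltonian R lam v - z • (1 : L2 R →L[ℂ] L2 R)) (𝓝 E)
      (𝓝 (U : L2 R →L[ℂ] L2 R)) := by
    rw [hU]
    exact Continuous.tendsto (by fun_prop) E
  have h2 := (NormedRing.inverse_continuousAt U).tendsto.comp h1
  have h3 : Continuous fun T : L2 R →L[ℂ] L2 R => inner ℂ (ket R x) (T (ket R y)) := by fun_prop
  have h4 := (h3.tendsto _).comp h2
  rw [hU] at h4
  exact h4

/-- A null vector `φ` of `H - E` satisfies `φ = -iη G(E + iη) φ`. If the finite matrix `G` stays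
bounded along a sequence `η → 0`, then `φ = 0`, and injectivity suffices in finite dimension. -/
lemma isUnit_of_frequently_bounded {v : Site d → ℝ} (hv : ∃ M, ∀ x, |v x| ≤ M) (lam : ℝ) {E : ℂ}
    (hE : E.im = 0) (Λ : Finset (Site d)) {K : ℝ}
    (hK : ∃ᶠ n : ℕ in atTop, ∀ x ∈ Λ, ∀ y ∈ Λ,
      ‖green (Λ : Set (Site d)) lam v (E + (1 / ((n : ℝ) + 1) : ℝ) * Complex.I) x y‖ ≤ K) :
    IsUnit (hamiltonian (Λ : Set (Site d)) lam v
      - E • (1 : L2 (Λ : Set (Site d)) →L[ℂ] L2 (Λ : Set (Site d)))) := by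
  have hker : ∀ φ : L2 (Λ : Set (Site d)), (hamiltonian (Λ : Set (Site d)) lam v
      - E • (1 : L2 (Λ : Set (Site d)) →L[ℂ] L2 (Λ : Set (Site d)))) φ = 0 → φ = 0 := by
    intro φ hφ
    refine zeroExt_injective (funext fun x => ?_)
    rw [map_zero, Pi.zero_apply]
    by_cases hx : x ∈ (Λ : Set (Site d))
    swap
    · exact zeroExt_notMem _ hx
    have hbound : ∀ n : ℕ, (∀ x ∈ Λ, ∀ y ∈ Λ,
        ‖green (Λ : Set (Site d)) lam v (E + (1 / ((n : ℝ) + 1) : ℝ) * Complex.I) x y‖ ≤ K) →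
        ‖zeroExt (Λ : Set (Site d)) φ x‖
          ≤ (∑ q ∈ Λ, ‖zeroExt (Λ : Set (Site d)) φ q‖ * K) * (1 / ((n : ℝ) + 1)) := by
      intro n hn
      set η : ℝ := 1 / ((n : ℝ) + 1) with hη
      have hη0 : 0 < η := by positivity
      have hz : (E + (η : ℂ) * Complex.I).im ≠ 0 := by simp [hE, hη0.ne']
      rw [zeroExt_eq_sum_green hv (isUnit_hamiltonian_sub hv lam hz) φ Λ
        (fun q => -((η : ℂ) * Complex.I) * zeroExt (Λ : Set (Site d)) φ q) ?_ x, Finset.sum_mul]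
      · refine norm_sum_le_of_le _ fun q hq => ?_
        rw [norm_mul, norm_mul, norm_neg, norm_mul, Complex.norm_I, Complex.norm_real,
          Real.norm_of_nonneg hη0.le, mul_one]
        have := hn x (Finset.mem_coe.1 hx) q hq
        calc η * ‖zeroExt (Λ : Set (Site d)) φ q‖ * _
            ≤ η * ‖zeroExt (Λ : Set (Site d)) φ q‖ * K := by gcongr
          _ = _ := by ring
      · intro q hq
        have h := zeroExt_sub (z := E) (lam := lam) hv φ hq
        rw [hφ, map_zero, Pi.zero_apply] at h
        rw [if_pos (Finset.mem_coe.1 hq)]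
        linear_combination -h
    by_contra hne
    have hpos : 0 < ‖zeroExt (Λ : Set (Site d)) φ x‖ := norm_pos_iff.2 hne
    have hlim := tendsto_one_div_add_atTop_nhds_zero_nat (𝕜 := ℝ).const_mul
      (∑ q ∈ Λ, ‖zeroExt (Λ : Set (Site d)) φ q‖ * K)
    rw [mul_zero] at hlim
    obtain ⟨n, hn, hlt⟩ := (hK.and_eventually (hlim.eventually_lt_const hpos)).exists
    exact absurd (hbound n hn) (not_le.2 hlt)
  have hfin : FiniteDimensional ℂ (L2 (Λ : Set (Site d))) := by
    let ι : L2 (Λ : Set (Site d)) →ₗ[ℂ] (Λ → ℂ) :=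
      (LinearMap.funLeft ℂ ℂ (fun q : Λ => (q : Site d))).comp (zeroExt (Λ : Set (Site d)))
    refine FiniteDimensional.of_injective ι fun f g hfg => ?_
    refine zeroExt_injective (funext fun q => ?_)
    by_cases hq : q ∈ Λ
    · exact congrFun hfg ⟨q, hq⟩
    · rw [zeroExt_notMem _ (by simpa using hq), zeroExt_notMem _ (by simpa using hq)]
  rw [ContinuousLinearMap.isUnit_iff_bijective]
  have hinj : Function.Injective (hamiltonian (Λ : Set (Site d)) lam v
      - E • (1 : L2 (Λ : Set (Site d)) →L[ℂ] L2 (Λ : Set (Site d)))) :=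
    (injective_iff_map_eq_zero _).2 hker
  have hsurj := (LinearMap.injective_iff_surjective (f := (hamiltonian (Λ : Set (Site d)) lam v
      - E • (1 : L2 (Λ : Set (Site d)) →L[ℂ] L2 (Λ : Set (Site d)))).toLinearMap)).1 hinj
  exact ⟨hinj, hsurj⟩

section approach

variable {μ : Measure ℝ} [IsProbabilityMeasure μ] [NullSingletonClass μ] {M s : ℝ} {C : ℝ≥0∞}

/-- Almost surely, a given energy is not an eigenvalue of a finite volume Hamiltonian. -/
lemma ae_isUnit (hM : 0 ≤ M) (hμM : ∀ᵐ t ∂μ, |t| ≤ M) (hs0 : 0 < s) (hs1 : s < 1) (hCtop : C ≠ ⊤)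
    (hC : HasFracBound μ s C) {lam : ℝ} (hlam : 0 < lam) (Λ : Finset (Site d)) (E : ℂ) :
    ∀ᵐ v ∂potLaw d μ, IsUnit (hamiltonian (Λ : Set (Site d)) lam (clip M v)
      - E • (1 : L2 (Λ : Set (Site d)) →L[ℂ] L2 (Λ : Set (Site d)))) := by
  by_cases hE : E.im = 0
  swap
  · exact ae_of_all _ fun v => isUnit_hamiltonian_sub (exists_clip_bound hM v) lam hE
  set zseq : ℕ → ℂ := fun n => E + (1 / ((n : ℝ) + 1) : ℝ) * Complex.I with hzseq
  have hz : ∀ n, (zseq n).im ≠ 0 := by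
    intro n
    have : 0 < 1 / ((n : ℝ) + 1) := by positivity
    simp only [hzseq, Complex.add_im, hE, Complex.mul_im, Complex.ofReal_re, Complex.I_im,
      Complex.ofReal_im, Complex.I_re, mul_one, mul_zero, add_zero, zero_add]
    exact this.ne'
  set f : ℕ → (Site d → ℝ) → ℝ≥0∞ := fun n v => ∑ x ∈ Λ, ∑ y ∈ Λ,
    ENNReal.ofReal (‖green (Λ : Set (Site d)) lam (clip M v) (zseq n) x y‖ ^ s) with hf
  have hg := fun n x y => measurable_green_rpow hM (Λ : Set (Site d)) lam s (hz n) x y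
  have hfm : ∀ n, Measurable (f n) := fun n =>
    Finset.measurable_fun_sum _ fun x _ => Finset.measurable_fun_sum _ fun y _ => hg n x y
  set A := ∑ _x ∈ Λ, ∑ _y ∈ Λ, aprioriConst C * ENNReal.ofReal (lam⁻¹ ^ s) with hA
  have hAtop : A ≠ ⊤ := by
    rw [hA]
    refine ENNReal.sum_ne_top.2 fun _ _ => ENNReal.sum_ne_top.2 fun _ _ => ?_
    exact ENNReal.mul_ne_top (aprioriConst_ne_top hCtop) ENNReal.ofReal_ne_top
  have hfA : ∀ n, ∫⁻ v, f n v ∂potLaw d μ ≤ A := by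
    intro n
    rw [hf, lintegral_finsetSum _ fun x _ => Finset.measurable_fun_sum _ fun y _ => hg n x y]
    refine Finset.sum_le_sum fun x _ => ?_
    rw [lintegral_finsetSum _ fun y _ => hg n x y]
    exact Finset.sum_le_sum fun y _ => moment_le hM hμM hs0 hs1 hC hlam (hz n) _ x y
  -- By Fatou, the uniform a priori bound makes the lower limit of the Green matrix entries almost
  -- surely finite, which is the boundedness along a subsequence needed for invertibility.
  have hlim : ∫⁻ v, liminf (fun n => f n v) atTop ∂potLaw d μ ≤ A :=
    (lintegral_liminf_le hfm).trans
      (liminf_le_of_frequently_le' (Eventually.frequently (Eventually.of_forall hfA)))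
  have hae := ae_lt_top (Measurable.liminf hfm) (ne_top_of_le_ne_top hAtop hlim)
  refine hae.mono fun v hv => ?_
  obtain ⟨K, hvK, hK⟩ := exists_between hv
  have hfreq := frequently_lt_of_liminf_lt (by isBoundedDefault) hvK
  refine isUnit_of_frequently_bounded (exists_clip_bound hM v) lam hE Λ
    (K := K.toReal ^ s⁻¹) (hfreq.mono fun n hn x hx y hy => ?_)
  have h1 : ENNReal.ofReal (‖green (Λ : Set (Site d)) lam (clip M v) (zseq n) x y‖ ^ s) ≤ K := by
    refine le_trans ?_ hn.le
    refine le_trans ?_ (Finset.single_le_sum (f := fun x => ∑ y ∈ Λ, ENNReal.ofReal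
      (‖green (Λ : Set (Site d)) lam (clip M v) (zseq n) x y‖ ^ s)) (fun _ _ => zero_le) hx)
    exact Finset.single_le_sum (f := fun y => ENNReal.ofReal
      (‖green (Λ : Set (Site d)) lam (clip M v) (zseq n) x y‖ ^ s)) (fun _ _ => zero_le) hy
  rw [ENNReal.ofReal_le_iff_le_toReal hK.ne] at h1
  rw [Real.le_rpow_inv_iff_of_pos (norm_nonneg _) ENNReal.toReal_nonneg hs0]
  exact h1

lemma ae_tendsto_green_rpow (hM : 0 ≤ M) (hμM : ∀ᵐ t ∂μ, |t| ≤ M) (hs0 : 0 < s) (hs1 : s < 1)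
    (hCtop : C ≠ ⊤) (hC : HasFracBound μ s C) {lam : ℝ} (hlam : 0 < lam) (Λ : Finset (Site d))
    (E : ℂ) (x y : Site d) : ∀ᵐ v ∂potLaw d μ,
      Tendsto (fun z => ENNReal.ofReal (‖green (Λ : Set (Site d)) lam (clip M v) z x y‖ ^ s)) (𝓝 E)
        (𝓝 (ENNReal.ofReal (‖green (Λ : Set (Site d)) lam (clip M v) E x y‖ ^ s))) := by
  refine (ae_isUnit hM hμM hs0 hs1 hCtop hC hlam Λ E).mono fun v hv => ?_
  have h := (tendsto_green hv x y).norm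
  exact ENNReal.tendsto_ofReal (h.rpow_const (Or.inr hs0.le))

lemma neBot_nhdsWithin_im_ne_zero (E : ℂ) : (𝓝[{z : ℂ | z.im ≠ 0}] E).NeBot := by
  rw [← mem_closure_iff_nhdsWithin_neBot]
  have hlim : Tendsto (fun η : ℝ => E + η * Complex.I) (𝓝[≠] 0) (𝓝 E) := by
    have : Continuous fun η : ℝ => E + η * Complex.I := by fun_prop
    simpa using (this.tendsto 0).mono_left nhdsWithin_le_nhds
  refine mem_closure_of_frequently_of_tendsto (Eventually.frequently ?_) hlim
  by_cases hE : E.im = 0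
  · refine eventually_nhdsWithin_of_forall fun η hη => ?_
    simpa [hE] using hη
  · have : Tendsto (fun η : ℝ => (E + η * Complex.I).im) (𝓝[≠] 0) (𝓝 E.im) :=
      (Complex.continuous_im.tendsto E).comp hlim
    exact this.eventually_ne hE

/-- At a real energy `Ring.inverse` takes its default value on the event that `E` is an eigenvalue.
This event is null, and elsewhere the function is a limit of measurable ones. -/
lemma aemeasurable_green_rpow (hM : 0 ≤ M) (hμM : ∀ᵐ t ∂μ, |t| ≤ M) (hs0 : 0 < s) (hs1 : s < 1)
    (hCtop : C ≠ ⊤) (hC : HasFracBound μ s C) {lam : ℝ} (hlam : 0 < lam) (Λ : Finset (Site d))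
    (E : ℂ) (x y : Site d) : AEMeasurable (fun v =>
      ENNReal.ofReal (‖green (Λ : Set (Site d)) lam (clip M v) E x y‖ ^ s)) (potLaw d μ) := by
  have := neBot_nhdsWithin_im_ne_zero E
  obtain ⟨zs, hzs⟩ := exists_seq_tendsto (𝓝[{z : ℂ | z.im ≠ 0}] E)
  obtain ⟨hlim, him⟩ := tendsto_nhdsWithin_iff.1 hzs
  obtain ⟨N, hN⟩ := eventually_atTop.1 him
  refine aemeasurable_of_tendsto_metrizable_ae atTop (f := fun n v =>
    ENNReal.ofReal (‖green (Λ : Set (Site d)) lam (clip M v) (zs (n + N)) x y‖ ^ s))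
    (fun n => (measurable_green_rpow hM _ lam s (hN _ (Nat.le_add_left _ _)) x y).aemeasurable) ?_
  refine (ae_tendsto_green_rpow hM hμM hs0 hs1 hCtop hC hlam Λ E x y).mono fun v hv => ?_
  exact hv.comp (hlim.comp (tendsto_add_atTop_nat N))

/-- Finite volume fractional moments are upper semicontinuous at every energy. -/
lemma eventually_moment_le (hM : 0 ≤ M) (hμM : ∀ᵐ t ∂μ, |t| ≤ M) (hs0 : 0 < s)
    (hC : ∀ r, 0 < r → r < 1 → ∃ C : ℝ≥0∞, C ≠ ⊤ ∧ HasFracBound μ r C) (hs1 : s < 1)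
    {lam : ℝ} (hlam : 0 < lam) (Λ : Finset (Site d)) (E : ℂ) (x y : Site d) {ε : ℝ≥0∞}
    (hε : ε ≠ 0) : ∀ᶠ z in 𝓝[{z : ℂ | z.im ≠ 0}] E, moment μ M lam s (Λ : Set (Site d)) z x y
      ≤ moment μ M lam s (Λ : Set (Site d)) E x y + ε := by
  -- A uniform bound on a moment of order `r` strictly between `s` and one gives uniform
  -- integrability of the `s`-th powers.
  set r : ℝ := (s + 1) / 2 with hr
  have hr0 : 0 < r := by linarith
  have hr1 : r < 1 := by linarith
  have hsr : s < r := by linarith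
  obtain ⟨C, hCtop, hCb⟩ := hC s hs0 hs1
  obtain ⟨C', hCtop', hCb'⟩ := hC r hr0 hr1
  set θ : ℝ := r / s - 1 with hθ
  have hθ0 : 0 < θ := by
    rw [hθ, sub_pos, one_lt_div hs0]
    exact hsr
  set A := aprioriConst C' * ENNReal.ofReal (lam⁻¹ ^ r) with hA
  have hAtop : A ≠ ⊤ := ENNReal.mul_ne_top (aprioriConst_ne_top hCtop') ENNReal.ofReal_ne_top
  obtain ⟨K, hK0, hKε⟩ : ∃ K : ℝ, 0 < K ∧ ENNReal.ofReal (K ^ (-θ)) * A < ε / 2 := by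
    have h1 : Tendsto (fun K : ℝ => ENNReal.ofReal (K ^ (-θ)) * A) atTop (𝓝 (0 * A)) := by
      refine ENNReal.Tendsto.mul_const ?_ (Or.inr hAtop)
      rw [← ENNReal.ofReal_zero]
      exact ENNReal.tendsto_ofReal (tendsto_rpow_neg_atTop hθ0)
    rw [zero_mul] at h1
    have h2 : (0 : ℝ≥0∞) < ε / 2 := ENNReal.half_pos hε
    obtain ⟨K, hK⟩ := ((eventually_gt_atTop 0).and (h1.eventually_lt_const h2)).exists
    exact ⟨K, hK⟩
  set g : ℂ → (Site d → ℝ) → ℝ≥0∞ := fun z v =>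
    ENNReal.ofReal (‖green (Λ : Set (Site d)) lam (clip M v) z x y‖ ^ s) with hg
  have hgm : ∀ z : ℂ, z.im ≠ 0 → Measurable (g z) := fun z hz =>
    measurable_green_rpow hM _ lam s hz x y
  -- Truncation at height `K`: above it, `g ≤ K^(-θ) g^(1 + θ)`, and `g^(1 + θ)` is the `r`-th power
  -- of the Green function. The truncated part converges by dominated convergence.
  have hpt : ∀ z v, g z v ≤ min (g z v) (ENNReal.ofReal K) + ENNReal.ofReal (K ^ (-θ))
      * ENNReal.ofReal (‖green (Λ : Set (Site d)) lam (clip M v) z x y‖ ^ r) := by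
    intro z v
    rcases le_or_gt (g z v) (ENNReal.ofReal K) with h | h
    · rw [min_eq_left h]
      exact le_self_add
    · refine le_add_left ?_
      simp only [hg] at h ⊢
      set a := ‖green (Λ : Set (Site d)) lam (clip M v) z x y‖
      have h1 : K < a ^ s := (ENNReal.ofReal_lt_ofReal_iff' .. |>.1 h).1
      rw [← ENNReal.ofReal_mul (by positivity)]
      refine ENNReal.ofReal_le_ofReal ?_
      have ha : 0 < a ^ s := hK0.trans h1
      have h2 : a ^ r = a ^ s * (a ^ s) ^ θ := by
        rw [← Real.rpow_one_add' ha.le (by linarith), hθ, ← Real.rpow_mul (norm_nonneg _)]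
        congr 1
        field_simp
        ring
      have h3 : K ^ θ ≤ (a ^ s) ^ θ := Real.rpow_le_rpow hK0.le h1.le hθ0.le
      rw [h2, Real.rpow_neg hK0.le]
      have h4 : 0 < K ^ θ := Real.rpow_pos_of_pos hK0 θ
      rw [← mul_assoc, mul_comm _ (a ^ s), mul_assoc]
      refine le_mul_of_one_le_right ha.le ?_
      rw [← div_eq_inv_mul, one_le_div h4]
      exact h3
  have hlim : Tendsto (fun z => ∫⁻ v, min (g z v) (ENNReal.ofReal K) ∂potLaw d μ)
      (𝓝[{z : ℂ | z.im ≠ 0}] E) (𝓝 (∫⁻ v, min (g E v) (ENNReal.ofReal K) ∂potLaw d μ)) := by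
    refine tendsto_lintegral_filter_of_dominated_convergence (fun _ => ENNReal.ofReal K) ?_ ?_ ?_ ?_
    · exact eventually_nhdsWithin_of_forall fun z hz => (hgm z hz).min measurable_const
    · exact Eventually.of_forall fun z => ae_of_all _ fun v => min_le_right _ _
    · rw [lintegral_const, measure_univ, mul_one]
      exact ENNReal.ofReal_ne_top
    · refine (ae_tendsto_green_rpow hM hμM hs0 hs1 hCtop hCb hlam Λ E x y).mono fun v hv => ?_
      exact (hv.mono_left nhdsWithin_le_nhds).min tendsto_const_nhds
  have htop : ∫⁻ v, min (g E v) (ENNReal.ofReal K) ∂potLaw d μ ≠ ⊤ := by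
    refine ne_top_of_le_ne_top (ENNReal.ofReal_ne_top (r := K)) ?_
    calc ∫⁻ v, min (g E v) (ENNReal.ofReal K) ∂potLaw d μ
        ≤ ∫⁻ _, ENNReal.ofReal K ∂potLaw d μ := lintegral_mono fun v => min_le_right _ _
      _ = ENNReal.ofReal K := by rw [lintegral_const, measure_univ, mul_one]
  have hev := hlim.eventually_le_const (ENNReal.lt_add_right htop (ENNReal.half_pos hε).ne')
  filter_upwards [hev, self_mem_nhdsWithin] with z hz1 hz2
  calc moment μ M lam s (Λ : Set (Site d)) z x y
      ≤ ∫⁻ v, (min (g z v) (ENNReal.ofReal K) + ENNReal.ofReal (K ^ (-θ))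
        * ENNReal.ofReal (‖green (Λ : Set (Site d)) lam (clip M v) z x y‖ ^ r)) ∂potLaw d μ :=
        lintegral_mono fun v => hpt z v
    _ = ∫⁻ v, min (g z v) (ENNReal.ofReal K) ∂potLaw d μ
        + ENNReal.ofReal (K ^ (-θ)) * moment μ M lam r (Λ : Set (Site d)) z x y := by
        have hm1 : Measurable fun v => min (g z v) (ENNReal.ofReal K) :=
          (hgm z hz2).min measurable_const
        rw [lintegral_add_left hm1, lintegral_const_mul _ (measurable_green_rpow hM _ lam r hz2 x y),
          moment]
    _ ≤ (∫⁻ v, min (g E v) (ENNReal.ofReal K) ∂potLaw d μ + ε / 2) + ε / 2 := by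
        refine add_le_add hz1 (le_trans ?_ hKε.le)
        exact mul_le_mul_right (moment_le hM hμM hr0 hr1 hCb' hlam hz2 _ x y) _
    _ ≤ moment μ M lam s (Λ : Set (Site d)) E x y + ε := by
        rw [add_assoc, ENNReal.add_halves]
        exact add_le_add_left (lintegral_mono fun v => min_le_left _ _) _

/-- The factor is a finite constant times finitely many moments, so the gap below `β` can be shared
among the bonds. -/
lemma eventually_contractionFactor_le (hM : 0 ≤ M) (hμM : ∀ᵐ t ∂μ, |t| ≤ M) (hs0 : 0 < s)
    (hs1 : s < 1) (hfb : ∀ r, 0 < r → r < 1 → ∃ C : ℝ≥0∞, C ≠ ⊤ ∧ HasFracBound μ r C)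
    (hCtop : C ≠ ⊤) {lam : ℝ} (hlam : 0 < lam) (Λ : Finset (Site d)) (E : ℂ) {β : ℝ≥0∞}
    (hβ : contractionFactor μ M lam s C Λ E < β) :
    ∀ᶠ z in 𝓝[{z : ℂ | z.im ≠ 0}] E, contractionFactor μ M lam s C Λ z ≤ β := by
  set k := ((1 + 2 * d : ℕ) : ℝ≥0∞) * ((bonds Λ).card : ℝ≥0∞) *
    (aprioriConst C * ENNReal.ofReal (lam⁻¹ ^ s)
      * (ENNReal.ofReal ((2 * M * lam) ^ s) + 2 * d)) with hk
  have hktop : k ≠ ⊤ := by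
    rw [hk]
    refine ENNReal.mul_ne_top (ENNReal.mul_ne_top (ENNReal.natCast_ne_top _)
      (ENNReal.natCast_ne_top _)) (ENNReal.mul_ne_top (ENNReal.mul_ne_top
      (aprioriConst_ne_top hCtop) ENNReal.ofReal_ne_top) (ENNReal.add_ne_top.2
      ⟨ENNReal.ofReal_ne_top, ENNReal.mul_ne_top ENNReal.ofNat_ne_top
        (ENNReal.natCast_ne_top _)⟩))
  set n : ℝ≥0∞ := ((bonds Λ).card : ℝ≥0∞) with hn
  have hkn : k * n + 1 ≠ ⊤ :=
    ENNReal.add_ne_top.2 ⟨ENNReal.mul_ne_top hktop (ENNReal.natCast_ne_top _), ENNReal.one_ne_top⟩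
  set δ := β - contractionFactor μ M lam s C Λ E with hδ
  have hδ0 : δ ≠ 0 := (tsub_pos_of_lt hβ).ne'
  -- The `+ 1` keeps the divisor nonzero when there are no bonds or the constant vanishes.
  have hε : δ / (k * n + 1) ≠ 0 := (ENNReal.div_pos hδ0 hkn).ne'
  have hev : ∀ᶠ z in 𝓝[{z : ℂ | z.im ≠ 0}] E, ∀ b ∈ bonds Λ,
      moment μ M lam s (Λ : Set (Site d)) z 0 b.1
        ≤ moment μ M lam s (Λ : Set (Site d)) E 0 b.1 + δ / (k * n + 1) :=
    (Filter.eventually_all_finset _).2 fun b _ =>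
      eventually_moment_le hM hμM hs0 hfb hs1 hlam Λ E 0 b.1 hε
  filter_upwards [hev] with z hz
  calc contractionFactor μ M lam s C Λ z
      ≤ k * ∑ b ∈ bonds Λ, (moment μ M lam s (Λ : Set (Site d)) E 0 b.1 + δ / (k * n + 1)) :=
        mul_le_mul_right (Finset.sum_le_sum hz) _
    _ = contractionFactor μ M lam s C Λ E + k * n * (δ / (k * n + 1)) := by
        rw [Finset.sum_add_distrib, Finset.sum_const, nsmul_eq_mul, mul_add, contractionFactor,
          mul_assoc k]
    _ ≤ contractionFactor μ M lam s C Λ E + δ := by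
        gcongr
        calc k * n * (δ / (k * n + 1)) ≤ (k * n + 1) * (δ / (k * n + 1)) := by
              gcongr
              exact le_self_add
          _ = δ := ENNReal.mul_div_cancel (by simp) hkn
    _ = β := add_tsub_cancel_of_le hβ.le

end approach

end Anderson
end

noncomputable section

namespace Anderson

variable {d : ℕ}

/-! ### Passage to the given random variables -/

section regular

variable {S : Type*} [MeasurableSpace S] {P : Measure S} {V : Site d → S → ℝ}

lemma IsRegular.exists_law [IsProbabilityMeasure P] (hV : IsRegular P V) :
    ∃ (μ : Measure ℝ) (_ : IsProbabilityMeasure μ) (_ : NullSingletonClass μ) (M : ℝ), 0 ≤ M ∧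
      (∀ᵐ t ∂μ, |t| ≤ M) ∧ P.map (fun ω x => V x ω) = potLaw d μ ∧ (∀ x, P.map (V x) = μ) ∧
      ∀ r, 0 < r → r < 1 → ∃ C : ℝ≥0∞, C ≠ ⊤ ∧ HasFracBound μ r C := by
  obtain ⟨ρ, m, hρ, hρm, hsupp, hmap⟩ := hV.density
  have hprob : IsProbabilityMeasure (volume.withDensity fun t => ENNReal.ofReal (ρ t)) := by
    rw [← hmap 0]
    exact Measure.isProbabilityMeasure_map (hV.measurable 0).aemeasurable
  have hac : (volume.withDensity fun t => ENNReal.ofReal (ρ t)) ≪ volume :=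
    withDensity_absolutelyContinuous _ _
  obtain ⟨M, hM⟩ := hsupp.isCompact.isBounded.exists_norm_le
  refine ⟨_, hprob, ⟨fun t => hac (measure_singleton t)⟩, max M 0, le_max_right _ _, ?_, ?_, hmap,
    fun r hr0 hr1 => exists_hasFracBound hρ (fun t => (hρm t).2) rfl hr0 hr1⟩
  · rw [ae_withDensity_iff hρ.ennreal_ofReal]
    refine ae_of_all _ fun t ht => ?_
    have hne : ρ t ≠ 0 := fun h => ht (by rw [h, ENNReal.ofReal_zero])
    exact (hM t (subset_tsupport ρ hne)).trans (le_max_left _ _)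
  · rw [hV.indep.map_fun_eq_infinitePi_map hV.measurable]
    simp only [hmap]

/-- Almost surely all values of the potential lie within the cutoff, so clipping changes nothing
under the given law. -/
lemma fracMoment_eq_moment {μ : Measure ℝ} [IsProbabilityMeasure μ] {M : ℝ}
    (hV : ∀ x, Measurable (V x)) (hμM : ∀ᵐ t ∂μ, |t| ≤ M)
    (hlaw : P.map (fun ω x => V x ω) = potLaw d μ) (hmap : ∀ x, P.map (V x) = μ) (lam s : ℝ)
    (R : Set (Site d)) (z : ℂ) (x y : Site d) (hm : AEMeasurable (fun v =>
      ENNReal.ofReal (‖green R lam (clip M v) z x y‖ ^ s)) (potLaw d μ)) :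
    fracMoment P V lam s R z x y = moment μ M lam s R z x y := by
  have hVm : Measurable fun ω x => V x ω := measurable_pi_lambda _ hV
  have hae : ∀ᵐ ω ∂P, ∀ x, |V x ω| ≤ M := by
    rw [ae_all_iff]
    intro x
    rw [← hmap x] at hμM
    exact ae_of_ae_map (hV x).aemeasurable hμM
  rw [← hlaw] at hm
  rw [moment, ← hlaw, lintegral_map' hm hVm.aemeasurable, fracMoment]
  refine lintegral_congr_ae (hae.mono fun ω hω => ?_)
  simp only
  rw [clip_eq_self hω]

end regular

/-! ### Disorder regimes -/

lemma boundaryDist_univ (x : Site d) : boundaryDist Set.univ x = ⊤ := by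
  simp [boundaryDist, boundary]

lemma regionDist_univ (x y : Site d) : regionDist Set.univ x y = siteDist x y := by
  simp [regionDist, boundaryDist_univ]

section regimes

variable {μ : Measure ℝ} [IsProbabilityMeasure μ] {M s : ℝ} {C : ℝ≥0∞}

/-- At high disorder, the fractional moments contract on the scale of one site. -/
lemma exists_contractionFactor_singleton_le [NullSingletonClass μ] (hM : 0 ≤ M) (hμM : ∀ᵐ t ∂μ, |t| ≤ M) (hs0 : 0 < s)
    (hs1 : s < 1) (hCtop : C ≠ ⊤) (hC : HasFracBound μ s C) :
    ∃ lam₀ : ℝ, 0 < lam₀ ∧ ∀ lam, lam₀ ≤ lam → ∀ z : ℂ, z.im ≠ 0 →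
      contractionFactor μ M lam s C ({0} : Finset (Site d)) z ≤ ENNReal.ofReal (1 / 2) := by
  obtain ⟨a, ha0, ha'⟩ : ∃ a : ℝ, 0 ≤ a ∧ aprioriConst C = ENNReal.ofReal a :=
    ⟨_, ENNReal.toReal_nonneg, (ENNReal.ofReal_toReal (aprioriConst_ne_top hCtop)).symm⟩
  set N : ℝ := ((bonds ({0} : Finset (Site d))).card : ℝ) with hN
  set T : ℝ := (1 + 2 * d) * N * (a * ((2 * M) ^ s + 2 * d)) * (N * a) with hT
  have hT0 : 0 ≤ T := by positivity
  -- For `λ ≥ 1` the prefactor is bounded uniformly in `λ`, while the a priori bound on the moments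
  -- contributes `λ⁻ˢ`. The factor is at most `T / λˢ`, which the second entry brings below one
  -- half.
  refine ⟨max 1 ((2 * T) ^ s⁻¹), by positivity, fun lam hlam z hz => ?_⟩
  have h1 : 1 ≤ lam := (le_max_left _ _).trans hlam
  have hlam0 : 0 < lam := by linarith
  have h2 : 2 * T ≤ lam ^ s := by
    have h := Real.rpow_le_rpow (by positivity) ((le_max_right _ _).trans hlam) hs0.le
    rwa [← Real.rpow_mul (by positivity), inv_mul_cancel₀ hs0.ne', Real.rpow_one] at h
  have h3 : 1 ≤ lam ^ s := Real.one_le_rpow h1 hs0.le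
  have hls : 0 < lam ^ s := by linarith
  have hsum : ∑ b ∈ bonds ({0} : Finset (Site d)),
      moment μ M lam s (({0} : Finset (Site d)) : Set (Site d)) z 0 b.1
      ≤ ENNReal.ofReal (N * (a * (lam ^ s)⁻¹)) := by
    refine (Finset.sum_le_card_nsmul _ _ _ fun b _ =>
      moment_le hM hμM hs0 hs1 hC hlam0 hz _ 0 b.1).trans_eq ?_
    rw [nsmul_eq_mul, ha', ← ENNReal.ofReal_mul ha0, Real.inv_rpow hlam0.le,
      ENNReal.ofReal_mul (Nat.cast_nonneg _), ENNReal.ofReal_natCast]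
  have hfac : ((1 + 2 * d : ℕ) : ℝ≥0∞) * ((bonds ({0} : Finset (Site d))).card : ℝ≥0∞) *
      (aprioriConst C * ENNReal.ofReal (lam⁻¹ ^ s)
        * (ENNReal.ofReal ((2 * M * lam) ^ s) + 2 * d))
      ≤ ENNReal.ofReal ((1 + 2 * d) * N * (a * ((2 * M) ^ s + 2 * d))) := by
    have e1 : ((1 + 2 * d : ℕ) : ℝ≥0∞) = ENNReal.ofReal (1 + 2 * d) := by
      rw [← ENNReal.ofReal_natCast]
      push_cast
      rfl
    have e2 : (2 * d : ℝ≥0∞) = ENNReal.ofReal (2 * d) := by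
      rw [ENNReal.ofReal_mul (by norm_num), ENNReal.ofReal_natCast, ENNReal.ofReal_ofNat]
    rw [e1, e2, ha', ← ENNReal.ofReal_natCast (bonds ({0} : Finset (Site d))).card,
      ← ENNReal.ofReal_add (by positivity) (by positivity), ← ENNReal.ofReal_mul (by positivity),
      ← ENNReal.ofReal_mul (by positivity), ← ENNReal.ofReal_mul (by positivity),
      ← ENNReal.ofReal_mul (by positivity)]
    refine ENNReal.ofReal_le_ofReal (mul_le_mul_of_nonneg_left ?_ (by positivity))
    rw [mul_assoc]
    refine mul_le_mul_of_nonneg_left ?_ ha0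
    rw [Real.inv_rpow hlam0.le, Real.mul_rpow (by positivity) hlam0.le, ← div_eq_inv_mul,
      div_le_iff₀ hls]
    nlinarith [mul_nonneg (by positivity : (0 : ℝ) ≤ 2 * d) (by linarith : 0 ≤ lam ^ s - 1)]
  refine (mul_le_mul' hfac hsum).trans ?_
  rw [← ENNReal.ofReal_mul (by positivity)]
  refine ENNReal.ofReal_le_ofReal ?_
  have : (1 + 2 * d) * N * (a * ((2 * M) ^ s + 2 * d)) * (N * (a * (lam ^ s)⁻¹))
      = T / lam ^ s := by
    rw [hT]
    field_simp
  rw [this, div_le_div_iff₀ hls (by norm_num)]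
  linarith

/-- At bounded disorder, the contraction factor is controlled by the finite volume criterion. -/
lemma exists_contractionFactor_le (hM : 0 ≤ M) (hs0 : 0 < s) (hCtop : C ≠ ⊤) (lam₀ : ℝ) :
    ∃ C' : ℝ, 0 < C' ∧ ∀ lam, 0 < lam → lam ≤ lam₀ → ∀ (Λ : Finset (Site d)) (E : ℂ),
      contractionFactor μ M lam s C Λ E
        ≤ ENNReal.ofReal ((1 + C' / lam ^ s * ((bonds Λ).card : ℝ)) ^ 2) *
          ∑ b ∈ bonds Λ, moment μ M lam s (Λ : Set (Site d)) E 0 b.1 := by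
  obtain ⟨a, ha0, ha'⟩ : ∃ a : ℝ, 0 ≤ a ∧ aprioriConst C = ENNReal.ofReal a :=
    ⟨_, ENNReal.toReal_nonneg, (ENNReal.ofReal_toReal (aprioriConst_ne_top hCtop)).symm⟩
  rcases le_or_gt lam₀ 0 with hneg | hpos
  · exact ⟨1, one_pos, fun lam h1 h2 => absurd (h1.trans_le h2) (not_lt.2 hneg)⟩
  -- The growing term `(2Mλ)ˢ` is frozen at `λ₀`; the `+ 1` ensures positivity.
  refine ⟨(1 + 2 * d) * (a * ((2 * M * lam₀) ^ s + 2 * d)) + 1, by positivity,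
    fun lam hlam hle Λ E => ?_⟩
  set C' : ℝ := (1 + 2 * d) * (a * ((2 * M * lam₀) ^ s + 2 * d)) + 1 with hC'
  have hls : 0 < lam ^ s := Real.rpow_pos_of_pos hlam s
  rw [contractionFactor]
  refine mul_le_mul_left ?_ _
  have e1 : ((1 + 2 * d : ℕ) : ℝ≥0∞) = ENNReal.ofReal (1 + 2 * d) := by
    rw [← ENNReal.ofReal_natCast]
    push_cast
    rfl
  have e2 : (2 * d : ℝ≥0∞) = ENNReal.ofReal (2 * d) := by
    rw [ENNReal.ofReal_mul (by norm_num), ENNReal.ofReal_natCast, ENNReal.ofReal_ofNat]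
  rw [e1, e2, ha', ← ENNReal.ofReal_natCast (bonds Λ).card,
    ← ENNReal.ofReal_add (by positivity) (by positivity), ← ENNReal.ofReal_mul (by positivity),
    ← ENNReal.ofReal_mul (by positivity), ← ENNReal.ofReal_mul (by positivity),
    ← ENNReal.ofReal_mul (by positivity)]
  refine ENNReal.ofReal_le_ofReal ?_
  set n : ℝ := ((bonds Λ).card : ℝ)
  have hn : 0 ≤ n := Nat.cast_nonneg _
  have h1 : (2 * M * lam) ^ s ≤ (2 * M * lam₀) ^ s :=
    Real.rpow_le_rpow (by positivity) (by gcongr) hs0.le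
  have h2 : (1 + 2 * d) * n * (a * lam⁻¹ ^ s * ((2 * M * lam) ^ s + 2 * d)) ≤ C' / lam ^ s * n := by
    calc (1 + 2 * d) * n * (a * lam⁻¹ ^ s * ((2 * M * lam) ^ s + 2 * d))
        ≤ (1 + 2 * d) * n * (a * lam⁻¹ ^ s * ((2 * M * lam₀) ^ s + 2 * d)) := by gcongr
      _ = (C' - 1) / lam ^ s * n := by
          rw [hC', Real.inv_rpow hlam.le]
          ring
      _ ≤ C' / lam ^ s * n := by
          gcongr
          linarith
  have h3 : 0 ≤ C' / lam ^ s * n := by positivity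
  -- With `t = C' λ⁻ˢ |Γ(Λ)| ≥ 0`, the prefactor is at most `t`, hence at most `(1 + t)²`.
  nlinarith

end regimes

lemma tendsto_add_mul_I (E : ℂ) :
    Tendsto (fun η : ℝ => E + η * Complex.I) (𝓝[≠] 0) (𝓝[{z : ℂ | z.im ≠ 0}] E) := by
  have hlim : Tendsto (fun η : ℝ => E + η * Complex.I) (𝓝[≠] 0) (𝓝 E) := by
    have : Continuous fun η : ℝ => E + η * Complex.I := by fun_prop
    simpa using (this.tendsto 0).mono_left nhdsWithin_le_nhds
  refine tendsto_nhdsWithin_iff.2 ⟨hlim, ?_⟩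
  by_cases hE : E.im = 0
  · refine eventually_nhdsWithin_of_forall fun η hη => ?_
    simpa [hE] using hη
  · have : Tendsto (fun η : ℝ => (E + η * Complex.I).im) (𝓝[≠] 0) (𝓝 E.im) :=
      (Complex.continuous_im.tendsto E).comp hlim
    exact this.eventually_ne hE

/-- Decay of the moments near a real energy, combined with the deterministic decay of the Green
function away from the real axis. -/
lemma exists_fractionalMomentCondition {S : Type*} [MeasurableSpace S] {P : Measure S}
    [IsProbabilityMeasure P] {V : Site d → S → ℝ} {M lam s : ℝ} (hM : 0 ≤ M) (hs0 : 0 < s)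
    (hVM : ∀ᵐ ω ∂P, ∀ x, |V x ω| ≤ M) {A m : ℝ} (hA : 0 ≤ A) (hm : 0 < m) {E : ℂ} (hE : E.im = 0)
    (hev : ∀ᶠ z in 𝓝[{z : ℂ | z.im ≠ 0}] E, ∀ x y, fracMoment P V lam s Set.univ z x y
      ≤ ENNReal.ofReal (A * Real.exp (-m * siteDist x y))) :
    ∃ a₁ a₂ : ℝ, E.re ∈ Set.Ioo a₁ a₂ ∧ FractionalMomentCondition P V lam s a₁ a₂ := by
  -- Half the radius is given to the energy and half to `η`. For `|η| < δ / 2` the moment bound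
  -- applies; for `|η| ≥ δ / 2` the deterministic bound `C qⁿ` has `s`-th power decaying at rate `-s
  -- log q`.
  obtain ⟨δ, hδ, hball⟩ := Metric.mem_nhdsWithin_iff.1 hev
  obtain ⟨C, q, hC, hq0, hq1, hdecay⟩ :=
    exists_norm_green_le (d := d) M lam (|E.re| + δ) (δ / 2) hM (by linarith)
  have hlog : Real.log q < 0 := Real.log_neg hq0 hq1
  refine ⟨E.re - δ / 2, E.re + δ / 2, ⟨by linarith, by linarith⟩, A + C ^ s,
    min m (-(s * Real.log q)), lt_min hm (by nlinarith), fun E' hE' η hη x y => ?_⟩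
  have hEabs : |E' - E.re| < δ / 2 := abs_lt.2 ⟨by linarith [hE'.1], by linarith [hE'.2]⟩
  have him : ((E' : ℂ) + η * Complex.I).im = η := by simp
  have hre : ((E' : ℂ) + η * Complex.I).re = E' := by simp
  set n : ℝ := (siteDist x y : ℝ) with hn
  have hn0 : 0 ≤ n := Nat.cast_nonneg _
  have hCs : 0 < C ^ s := Real.rpow_pos_of_pos hC s
  rcases lt_or_ge |η| (δ / 2) with h | h
  · have hz : (E' : ℂ) + η * Complex.I ∈ Metric.ball E δ ∩ {z : ℂ | z.im ≠ 0} := by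
      refine ⟨?_, by simpa using hη⟩
      rw [Metric.mem_ball, Complex.dist_eq]
      refine (Complex.norm_le_abs_re_add_abs_im _).trans_lt ?_
      rw [Complex.sub_re, Complex.sub_im, hre, him, hE, sub_zero]
      linarith
    refine (hball hz x y).trans (ENNReal.ofReal_le_ofReal ?_)
    refine mul_le_mul (by linarith) (Real.exp_le_exp.2 ?_) (Real.exp_pos _).le (by positivity)
    exact mul_le_mul_of_nonneg_right (neg_le_neg (min_le_left _ _)) hn0
  · calc fracMoment P V lam s Set.univ (E' + η * Complex.I) x y
        ≤ ∫⁻ _, ENNReal.ofReal ((A + C ^ s) * Real.exp (-min m (-(s * Real.log q)) * n)) ∂P := by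
          refine lintegral_mono_ae (hVM.mono fun ω hω => ENNReal.ofReal_le_ofReal ?_)
          have hg := hdecay Set.univ (fun w => V w ω) hω (E' + η * Complex.I) (by
            rw [hre]
            have := abs_add_le (E' - E.re) E.re
            rw [sub_add_cancel] at this
            linarith) (by rwa [him]) x y
          calc ‖green Set.univ lam (fun w => V w ω) (E' + η * Complex.I) x y‖ ^ s
              ≤ (C * q ^ siteDist x y) ^ s := Real.rpow_le_rpow (norm_nonneg _) hg hs0.le
            _ = C ^ s * Real.exp (-(-(s * Real.log q)) * n) := by
                rw [Real.mul_rpow hC.le (by positivity), ← Real.rpow_natCast, ← Real.rpow_mul hq0.le,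
                  Real.rpow_def_of_pos hq0]
                congr 2
                rw [← hn]
                ring
            _ ≤ (A + C ^ s) * Real.exp (-min m (-(s * Real.log q)) * n) := by
                refine mul_le_mul (by linarith) (Real.exp_le_exp.2 ?_) (Real.exp_pos _).le
                  (by positivity)
                exact mul_le_mul_of_nonneg_right (neg_le_neg (min_le_right _ _)) hn0
      _ = _ := by rw [lintegral_const, measure_univ, mul_one]

end Anderson
end

/-! ### Choice of the contracting scale and proof of the theorem -/

open Anderson in
/-- An energy scale `Λ'` on which the moments contract near every energy satisfying the
criterion. -/
lemma Anderson.exists_contracting_scale {d : ℕ} {μ : Measure ℝ} [IsProbabilityMeasure μ]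
    [NullSingletonClass μ] {M s : ℝ} {C : ℝ≥0∞} (hM : 0 ≤ M) (hμM : ∀ᵐ t ∂μ, |t| ≤ M) (hs0 : 0 < s)
    (hs1 : s < 1) (hfb : ∀ r, 0 < r → r < 1 → ∃ C : ℝ≥0∞, C ≠ ⊤ ∧ HasFracBound μ r C)
    (hCtop : C ≠ ⊤) (hC : HasFracBound μ s C) :
    ∃ C' : ℝ, 0 < C' ∧ ∀ lam : ℝ, 0 < lam → ∀ Λ : Finset (Site d), 0 ∈ Λ → ∀ b : ℝ≥0∞, b < 1 →
      ∃ (Λ' : Finset (Site d)) (β : ℝ), 0 ∈ Λ' ∧ 0 < β ∧ β < 1 ∧ ∀ E : ℂ,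
        ENNReal.ofReal ((1 + C' / lam ^ s * ((bonds Λ).card : ℝ)) ^ 2) *
          ∑ b ∈ bonds Λ, moment μ M lam s (Λ : Set (Site d)) E 0 b.1 = b →
        ∀ᶠ z in 𝓝[{z : ℂ | z.im ≠ 0}] E,
          contractionFactor μ M lam s C Λ' z ≤ ENNReal.ofReal β := by
  obtain ⟨lam₀, hlam₀, hhigh⟩ :=
    exists_contractionFactor_singleton_le (d := d) hM hμM hs0 hs1 hCtop hC
  obtain ⟨C', hC', hlow⟩ := exists_contractionFactor_le (d := d) (μ := μ) hM hs0 hCtop lam₀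
  refine ⟨C', hC', fun lam hlam Λ h0 b hb => ?_⟩
  rcases le_total lam₀ lam with h | h
  · exact ⟨{0}, 1 / 2, by simp, by norm_num, by norm_num, fun E _ =>
      eventually_nhdsWithin_of_forall fun z hz => hhigh lam h z hz⟩
  -- Any `β` strictly between `b` and one works; it is fixed before `E`, which makes the decay
  -- constants uniform over all energies with the same `b`.
  · obtain ⟨β, hbβ, hβ1⟩ := exists_between hb
    have hβtop : β ≠ ⊤ := hβ1.ne_top
    refine ⟨Λ, β.toReal, h0, ENNReal.toReal_pos (pos_of_gt hbβ).ne' hβtop, ?_, fun E hE => ?_⟩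
    · simpa using (ENNReal.toReal_lt_toReal hβtop ENNReal.one_ne_top).2 hβ1
    · rw [ENNReal.ofReal_toReal hβtop]
      exact eventually_contractionFactor_le hM hμM hs0 hs1 hfb hCtop hlam Λ E
        (((hlow lam hlam h Λ E).trans_eq hE).trans_lt hbβ)

theorem theorem1 {d : ℕ} (hd : 0 < d) {S : Type*} [MeasurableSpace S] (P : Measure S)
    [IsProbabilityMeasure P] (V : Anderson.Site d → S → ℝ) (hV : Anderson.IsRegular P V)
    (s : ℝ) (hs0 : 0 < s) (hs1 : s < 1) :
    ∃ C : ℝ, 0 < C ∧ ∀ lam : ℝ, 0 < lam → ∀ Λ : Finset (Anderson.Site d), 0 ∈ Λ →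
      ∀ b : ℝ≥0∞, b < 1 → ∃ A μ : ℝ, 0 < μ ∧
        ∀ E : ℂ, Anderson.criterion P V lam s C Λ E = b →
          (E.im = 0 → ∃ a₁ a₂ : ℝ, E.re ∈ Set.Ioo a₁ a₂ ∧
            Anderson.FractionalMomentCondition P V lam s a₁ a₂) ∧
          ∀ R : Set (Anderson.Site d), ∀ x ∈ R, ∀ y ∈ R,
            limsup (fun η : ℝ => Anderson.fracMoment P V lam s R (E + η * Complex.I) x y)
                (𝓝[>] 0)
              ≤ ENNReal.ofReal (A * Real.exp (-μ * Anderson.regionDist R x y)) ∧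
            limsup (fun η : ℝ => Anderson.fracMoment P V lam s R (E + η * Complex.I) x y)
                (𝓝[<] 0)
              ≤ ENNReal.ofReal (A * Real.exp (-μ * Anderson.regionDist R x y)) := by
  obtain ⟨ν, hν, hνa, M, hM, hνM, hlaw, hmap, hfb⟩ := hV.exists_law
  obtain ⟨C₁, hC₁top, hC₁⟩ := hfb s hs0 hs1
  obtain ⟨C, hC, hscale⟩ :=
    Anderson.exists_contracting_scale (d := d) hM hνM hs0 hs1 hfb hC₁top hC₁
  refine ⟨C, hC, fun lam hlam Λ h0 b hb => ?_⟩
  obtain ⟨Λ', β, h0', hβ0, hβ1, hev⟩ := hscale lam hlam Λ h0 b hb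
  obtain ⟨A, m, hA, hm, hexp⟩ :=
    Anderson.exists_moment_le_exp hM hνM hs0 hs1 hC₁top hC₁ hlam Λ' h0' hβ0 hβ1
  refine ⟨A, m, hm, fun E hE => ?_⟩
  have hcrit : ENNReal.ofReal ((1 + C / lam ^ s * ((Anderson.bonds Λ).card : ℝ)) ^ 2) *
      ∑ b ∈ Anderson.bonds Λ, Anderson.moment ν M lam s (Λ : Set (Anderson.Site d)) E 0 b.1
        = b := by
    rw [← hE, Anderson.criterion]
    congr 1
    exact Finset.sum_congr rfl fun b _ => (Anderson.fracMoment_eq_moment hV.measurable hνM hlaw hmap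
      lam s _ E 0 b.1 (Anderson.aemeasurable_green_rpow hM hνM hs0 hs1 hC₁top hC₁ hlam Λ E 0
        b.1)).symm
  -- The neighbourhood of `E` does not depend on the region or the sites, because the contraction
  -- factor involves only `Λ'`; this uniformity is what permits an open energy interval.
  have hdecay : ∀ᶠ z in 𝓝[{z : ℂ | z.im ≠ 0}] E, ∀ R : Set (Anderson.Site d), ∀ x ∈ R, ∀ y ∈ R,
      Anderson.fracMoment P V lam s R z x y
        ≤ ENNReal.ofReal (A * Real.exp (-m * Anderson.regionDist R x y)) := by
    filter_upwards [hev E hcrit, self_mem_nhdsWithin] with z hz hzim R x hx y hy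
    rw [Anderson.fracMoment_eq_moment hV.measurable hνM hlaw hmap lam s R z x y
      (Anderson.measurable_green_rpow hM R lam s hzim x y).aemeasurable]
    exact hexp z hzim hz R x hx y hy
  refine ⟨fun him => ?_, fun R x hx y hy => ?_⟩
  · have hVM : ∀ᵐ ω ∂P, ∀ x, |V x ω| ≤ M := by
      rw [ae_all_iff]
      intro x
      rw [← hmap x] at hνM
      exact ae_of_ae_map (hV.measurable x).aemeasurable hνM
    refine Anderson.exists_fractionalMomentCondition hM hs0 hVM hA hm him
      (hdecay.mono fun z hz x y => ?_)
    rw [← Anderson.regionDist_univ]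
    exact hz Set.univ x (Set.mem_univ x) y (Set.mem_univ y)
  · have hη := (Anderson.tendsto_add_mul_I E).eventually
      (hdecay.mono fun z hz => hz R x hx y hy)
    exact ⟨limsup_le_of_le (by isBoundedDefault)
        (hη.filter_mono (nhdsWithin_mono _ fun η hη => ne_of_gt hη)),
      limsup_le_of_le (by isBoundedDefault)
        (hη.filter_mono (nhdsWithin_mono _ fun η hη => ne_of_lt hη))⟩
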